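/- Let $\{v_{j,k}: j<k,\ j,k\in\mathbb Z\}$ be independent random variables with a common law, that of a random variable $v$ with values in $[-\infty,\infty)$; $v_{j,k}$ is the weight of the directed edge $(j,k)$. A path from $j$ to $k$ is a sequence of edges $(j_0,j_1),\dots,(j_{m-1},j_m)$ with $j=j_0<j_1<\dots<j_m=k$, and its weight is the sum of the weights of its edges. For $j<k$ let $w_{j,k}$ be the maximal weight of the paths from $j$ to $k$ of weight $>-\infty$ ($-\infty$ if there are none), and let $w_{j,j}=0$. Let $v^+$ have the conditional law of $v$ given $v>0$. Assume that $$\mathbf P(v>0)>0,\qquad \mathbf P(v^+=c)<1\ \text{ for any } c>0,\qquad \mathbf E e^{C'v^+}<\infty\ \text{ for some } C'>0. \tag{1}$$ A vertex $x\in\mathbb Z$ is a skeleton-plus vertex if it is joined to every vertex $j<x$ by a path from $j$ to $x$, and to every vertex $k>x$ by a path from $x$ to $k$, all of whose edges have positive weights. Let $0\le t_0^+<t_1^+$ be the first two nonnegative skeleton-plus vertices (they exist almost surely), and put $$\gamma^+=\frac1{\mathbf E(t_1^+-t_0^+)},\qquad V=\mathbf E\min\{v_{i,j}:\ t_0^+\le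 i<j\le t_1^+,\ v_{i,j}>0\},\qquad \operatorname{ess\,inf} v^+=\inf\{t>0:\ \mathbf P(v^+<t)>0\}.$$ Let $c_1,c_2$ be real numbers with $$\gamma^+\operatorname{ess\,inf}v^+<c_2\le c_1<\gamma^+V. \tag{2}$$ A vertex $x\in\mathbb Z$ is a renewal vertex if $$w_{x-j,x}\ge c_1 j\ \ (j\ge1),\qquad v_{x-j,x+i}<c_2(i+j)\ \ (i,j\ge1),\qquad w_{x,x+i}\ge c_1 i\ \ (i\ge1).$$ Then, almost surely, there are at least two nonnegative renewal vertices. Let $0\le\Gamma_0<\Gamma_1$ be the two smallest ones. There is a constant $C>0$ such that $$\mathbf E\exp(C\,w_{0,\Gamma_0})<\infty\qquad\text{and}\qquad \mathbf E\exp(C\,w_{\Gamma_0,\Gamma_1})<\infty .$$ -/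

import Mathlib

open MeasureTheory ProbabilityTheory Set

open scoped ENNReal

noncomputable section

namespace WeightedLineGraph

/-- The edges of the graph: all pairs `(j, k)` of integers with `j < k`. -/
abbrev Edge : Type := {e : ℤ × ℤ // e.1 < e.2}

/-- A path from `j` to `k` in the graph: vertices `j = x₀ < x₁ < ⋯ < xₘ = k`, where `m` is the
length. The path of length zero is the only path from a vertex to itself. -/
structure EdgePath (j k : ℤ) where
  length : ℕ
  vertex : Fin (length + 1) → ℤ
  strictMono : StrictMono vertex
  source : vertex 0 = j
  target : vertex (Fin.last length) = k

/- In the following deterministic notions, `u j k` (for `j < k`) is the weight of the edge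
`(j, k)`; the values `u j k` with `k ≤ j` are never used. -/

/-- The weight of the `s`-th edge of a path. -/
def EdgePath.edgeWeight {j k : ℤ} (π : EdgePath j k) (u : ℤ → ℤ → EReal) (s : Fin π.length) : EReal :=
  u (π.vertex s.castSucc) (π.vertex s.succ)

/-- The weight of a path: the sum of the weights of its edges. -/
def EdgePath.weight {j k : ℤ} (π : EdgePath j k) (u : ℤ → ℤ → EReal) : EReal :=
  ∑ s : Fin π.length, π.edgeWeight u s

/-- The paths from `j` to `k` of weight `> -∞`. -/
def finitePaths (u : ℤ → ℤ → EReal) (j k : ℤ) : Set (EdgePath j k) :=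
  {π | ⊥ < π.weight u}

/-- The paths from `j` to `k` all of whose edges have positive weight. -/
def positivePaths (u : ℤ → ℤ → EReal) (j k : ℤ) : Set (EdgePath j k) :=
  {π | ∀ s, 0 < π.edgeWeight u s}

/-- The maximal weight `w_{j,k}` of the paths of finite weight from `j` to `k`. There are finitely
many paths from `j` to `k`, so the supremum is a maximum, and it is `-∞` if there are no paths of
finite weight. For `j = k` the value is `0`. -/
def maxWeight (u : ℤ → ℤ → EReal) (j k : ℤ) : EReal :=
  ⨆ π ∈ finitePaths u j k, π.weight u

/-- The skeleton-plus vertices: those connected with every other vertex by a path with edges of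
positive weight only. -/
def skeletonPlus (u : ℤ → ℤ → EReal) : Set ℤ :=
  {x | (∀ j, j < x → (positivePaths u j x).Nonempty) ∧
    ∀ k, x < k → (positivePaths u x k).Nonempty}

/-- `w_{x,x+i} ≥ c i` for all `i ≥ 1`. -/
def RightEvent (u : ℤ → ℤ → EReal) (c : ℝ) (x : ℤ) : Prop :=
  ∀ i : ℕ, 1 ≤ i → ((c * i : ℝ) : EReal) ≤ maxWeight u x (x + i)

/-- `w_{x-j,x} ≥ c j` for all `j ≥ 1`. -/
def LeftEvent (u : ℤ → ℤ → EReal) (c : ℝ) (x : ℤ) : Prop :=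
  ∀ j : ℕ, 1 ≤ j → ((c * j : ℝ) : EReal) ≤ maxWeight u (x - j) x

/-- `v_{x-j,x+i} < c (j + i)` for all `i, j ≥ 1`. -/
def CrossEvent (u : ℤ → ℤ → EReal) (c : ℝ) (x : ℤ) : Prop :=
  ∀ i j : ℕ, 1 ≤ i → 1 ≤ j → u (x - j) (x + i) < ((c * (j + i) : ℝ) : EReal)

/-- The set of renewal vertices. -/
def renewalSet (u : ℤ → ℤ → EReal) (c₁ c₂ : ℝ) : Set ℤ :=
  {x | LeftEvent u c₁ x ∧ CrossEvent u c₂ x ∧ RightEvent u c₁ x}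

/-- The smallest nonnegative element of `S` (if there is one). -/
def firstPoint (S : Set ℤ) : ℤ := sInf {x | x ∈ S ∧ 0 ≤ x}

/-- The second smallest nonnegative element of `S` (if there is one). -/
def secondPoint (S : Set ℤ) : ℤ := sInf {x | x ∈ S ∧ firstPoint S < x}

/-- The minimum of the positive weights of the edges `(i, j)` with `a ≤ i < j ≤ b`. -/
def minPositiveWeight (u : ℤ → ℤ → EReal) (a b : ℤ) : EReal :=
  sInf {y | ∃ i j : ℤ, a ≤ i ∧ i < j ∧ j ≤ b ∧ 0 < u i j ∧ y = u i j}

/-- The law of `v⁺`, i.e. the law `ν` of `v` conditioned on `v > 0`. -/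
def plusLaw (ν : Measure EReal) : Measure EReal := ProbabilityTheory.cond ν (Ioi 0)

/-- `v` takes positive values with positive probability, `v⁺` is not concentrated at one point, and
`v⁺` has a finite exponential moment. -/
structure MainCondition (ν : Measure EReal) : Prop where
  pos : 0 < ν (Ioi 0)
  nondegenerate : ∀ c : ℝ, 0 < c → plusLaw ν {(c : EReal)} < 1
  exp_moment : ∃ C : ℝ, 0 < C ∧ ∫⁻ x, EReal.exp ((C : EReal) * x) ∂(plusLaw ν) < ∞

/-- `ess inf v⁺ = inf {t > 0 : P(v⁺ < t) > 0}`. -/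
def essInfPlus (ν : Measure EReal) : ℝ :=
  sInf {t : ℝ | 0 < t ∧ 0 < plusLaw ν (Iio (t : EReal))}

/-- The weights `v j k`, `j < k`, are independent random variables with common law `ν`, and they
take values in `[-∞, ∞)`. -/
structure IsWeightFamily {Ω : Type*} [MeasurableSpace Ω] (P : Measure Ω) (ν : Measure EReal)
    (v : ℤ → ℤ → Ω → EReal) : Prop where
  measurable : ∀ j k, j < k → Measurable (v j k)
  indep : iIndepFun (fun e : Edge => v e.1.1 e.1.2) P
  law : ∀ j k, j < k → P.map (v j k) = ν
  lt_top : ν {⊤} = 0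

section Random

variable {Ω : Type*}

/-- The configuration of weights at `ω`. -/
def config (v : ℤ → ℤ → Ω → EReal) (ω : Ω) : ℤ → ℤ → EReal := fun j k => v j k ω

/-- The first nonnegative skeleton-plus vertex `t₀⁺`. -/
def tPlus₀ (v : ℤ → ℤ → Ω → EReal) (ω : Ω) : ℤ := firstPoint (skeletonPlus (config v ω))

/-- The second nonnegative skeleton-plus vertex `t₁⁺`. -/
def tPlus₁ (v : ℤ → ℤ → Ω → EReal) (ω : Ω) : ℤ := secondPoint (skeletonPlus (config v ω))

/-- The first nonnegative renewal vertex `Γ₀`. -/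
def renewal₀ (v : ℤ → ℤ → Ω → EReal) (c₁ c₂ : ℝ) (ω : Ω) : ℤ :=
  firstPoint (renewalSet (config v ω) c₁ c₂)

/-- The second nonnegative renewal vertex `Γ₁`. -/
def renewal₁ (v : ℤ → ℤ → Ω → EReal) (c₁ c₂ : ℝ) (ω : Ω) : ℤ :=
  secondPoint (renewalSet (config v ω) c₁ c₂)

variable [MeasurableSpace Ω]

/-- `γ⁺ = 1 / E(t₁⁺ - t₀⁺)`. -/
def gammaPlus (P : Measure Ω) (v : ℤ → ℤ → Ω → EReal) : ℝ :=
  1 / ∫ ω, ((tPlus₁ v ω - tPlus₀ v ω : ℤ) : ℝ) ∂P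

/-- The expectation `V` of the minimum of the positive edge weights between `t₀⁺` and `t₁⁺`. -/
def meanMinWeight (P : Measure Ω) (v : ℤ → ℤ → Ω → EReal) : ℝ :=
  ∫ ω, (minPositiveWeight (config v ω) (tPlus₀ v ω) (tPlus₁ v ω)).toReal ∂P

/-- The condition `γ⁺ ess inf v⁺ < c₂ ≤ c₁ < γ⁺ V`. -/
def AdmissibleConstants (P : Measure Ω) (ν : Measure EReal) (v : ℤ → ℤ → Ω → EReal)
    (c₁ c₂ : ℝ) : Prop :=
  gammaPlus P v * essInfPlus ν < c₂ ∧ c₂ ≤ c₁ ∧ c₁ < gammaPlus P v * meanMinWeight P v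

end Random

end WeightedLineGraph

end

open WeightedLineGraph

/-! Let κ be the mean of the positive part of v_{0,1} on the event that 0 is a skeleton-plus vertex.
At a skeleton-plus vertex x the edge (x, x+1) is positive, being the only path from x to x+1. A path
can use all these edges and join them by positive edges, so w_{0,n} is at least the sum of v_{x,x+1}
over the skeleton-plus vertices x in [0,n), up to one boundary term. Hence w_{0,n} grows at least
with slope κ. A regeneration argument (`lintegral_edge_firstSkel`) shows that the mean weight of the
edge leaving t₀⁺ is E(t₁⁺ - t₀⁺) κ. The minimum in V is at most this weight, so γ⁺V ≤ κ and c₁ < κ.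

Exponential estimates come from one localisation principle. Being skeleton-plus, or being a renewal
vertex, follows from a condition on edges within distance m unless x lies in a bad interval of
length at least m. Badness depends only on edges inside the interval and has exponentially small
probability in its length. For large m such intervals cover a fixed fraction of [0,n) only with
exponentially small probability (`LocalBad.expDecay_badCover`), while sums of bounded local
variables obey Hoeffding's inequality (`expDecay_sum_local`). The principle is used for the lower
deviations of w_{0,n} (`expDecay_maxWeight_lt`), and again to find at least two renewal vertices in
[0,n) (`LocalBad.expDecay_card_good_le_one`).

A vertex is a renewal vertex with positive probability: the left, crossing and right conditions use
disjoint sets of edges, and each has positive probability (`measure_rightEvent_pos`,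
`measure_crossEvent_pos`).

Finally, exp(C w_{k,l}) is at most a sum over paths of products of independent factors, so its mean
is at most r^{l-k} for some finite r. Since Γ₀ or Γ₁ equals l only on an event of exponentially
small probability, Hölder's inequality makes a small power of these exponentials summable
(`exists_lintegral_tsum_rpow_ne_top`). -/

noncomputable section

namespace WeightedLineGraph

/-! ### Paths and their weights -/

/-- There is a path from `a` to `b` with positive edge weights. -/
def Conn (u : ℤ → ℤ → EReal) : ℤ → ℤ → Prop :=
  Relation.ReflTransGen fun a b => a < b ∧ 0 < u a b

/-- `WalkWeight u a b r`: some path from `a` to `b` has weight `r`. -/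
inductive WalkWeight (u : ℤ → ℤ → EReal) (a : ℤ) : ℤ → EReal → Prop
  | nil : WalkWeight u a a 0
  | snoc {b c : ℤ} {r : EReal} : WalkWeight u a b r → b < c → WalkWeight u a c (r + u b c)

variable {u u' : ℤ → ℤ → EReal} {a b c : ℤ} {r s : EReal}

lemma walkWeight_sum (n : ℕ) : ∀ x : Fin (n + 1) → ℤ, StrictMono x →
    WalkWeight u (x 0) (x (Fin.last n)) (∑ s : Fin n, u (x s.castSucc) (x s.succ)) := by
  induction n with
  | zero => intro x _; simpa using WalkWeight.nil
  | succ n ih =>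
    intro x hx
    rw [Fin.sum_univ_castSucc]
    have h := ih (fun i => x i.castSucc) (hx.comp (Fin.strictMono_castSucc))
    exact WalkWeight.snoc h (hx (Fin.castSucc_lt_last _))

lemma EdgePath.walkWeight (π : EdgePath a b) : WalkWeight u a b (π.weight u) := by
  have h := walkWeight_sum (u := u) π.length π.vertex π.strictMono
  rwa [π.source, π.target] at h

lemma conn_of_vertices (n : ℕ) : ∀ x : Fin (n + 1) → ℤ, StrictMono x →
    (∀ s : Fin n, 0 < u (x s.castSucc) (x s.succ)) → Conn u (x 0) (x (Fin.last n)) := by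
  induction n with
  | zero => intro x _ _; exact Relation.ReflTransGen.refl
  | succ n ih =>
    intro x hx hp
    have h := ih (fun i => x i.castSucc) (hx.comp (Fin.strictMono_castSucc))
      (fun s => hp s.castSucc)
    exact Relation.ReflTransGen.tail h ⟨hx (Fin.castSucc_lt_last _), hp (Fin.last n)⟩

lemma EdgePath.exists_snoc (π : EdgePath a b) (h : b < c) : ∃ π' : EdgePath a c,
    (∀ u, π'.weight u = π.weight u + u b c) ∧
    ∀ u, (∀ s, 0 < π.edgeWeight u s) → 0 < u b c → ∀ s, 0 < π'.edgeWeight u s := by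
  have hlast : π.vertex (Fin.last _) = b := π.target
  refine ⟨⟨π.length + 1, Fin.snoc π.vertex c, ?_, ?_, ?_⟩, ?_, ?_⟩
  · refine Fin.strictMono_iff_lt_succ.2 fun i => ?_
    refine Fin.lastCases ?_ (fun i => ?_) i
    · rw [Fin.snoc_castSucc, Fin.succ_last, Fin.snoc_last, hlast]; exact h
    · rw [Fin.snoc_castSucc, ← Fin.castSucc_succ, Fin.snoc_castSucc]
      exact π.strictMono (Fin.castSucc_lt_succ)
  · have : (0 : Fin (π.length + 1 + 1)) = Fin.castSucc 0 := rfl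
    rw [this, Fin.snoc_castSucc, π.source]
  · exact Fin.snoc_last _ _
  · intro u
    simp only [EdgePath.weight, EdgePath.edgeWeight]
    rw [Fin.sum_univ_castSucc]
    simp only [Fin.snoc_castSucc, Fin.succ_last, Fin.snoc_last, hlast, ← Fin.castSucc_succ]
  · intro u hp hc s
    simp only [EdgePath.edgeWeight] at hp ⊢
    refine Fin.lastCases ?_ (fun i => ?_) s
    · rw [Fin.snoc_castSucc, Fin.succ_last, Fin.snoc_last, hlast]; exact hc
    · rw [Fin.snoc_castSucc, ← Fin.castSucc_succ, Fin.snoc_castSucc]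
      exact hp i

/-- The path of length zero. -/
def EdgePath.nil (a : ℤ) : EdgePath a a where
  length := 0
  vertex := fun _ => a
  strictMono := fun i j h => absurd h (by omega)
  source := rfl
  target := rfl

lemma WalkWeight.exists_path (h : WalkWeight u a b r) : ∃ π : EdgePath a b, π.weight u = r := by
  induction h with
  | nil => exact ⟨EdgePath.nil a, Fin.sum_univ_zero _⟩
  | snoc _ hbc ih =>
    obtain ⟨π, hπ⟩ := ih
    obtain ⟨π', h1, _⟩ := π.exists_snoc hbc
    exact ⟨π', by rw [h1, hπ]⟩

lemma conn_iff : (positivePaths u a b).Nonempty ↔ Conn u a b := by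
  constructor
  · rintro ⟨π, hπ⟩
    have h := conn_of_vertices (u := u) π.length π.vertex π.strictMono hπ
    rwa [π.source, π.target] at h
  · intro h
    induction h with
    | refl => exact ⟨EdgePath.nil a, fun s => Fin.elim0 s⟩
    | tail _ hbc ih =>
      obtain ⟨π, hπ⟩ := ih
      obtain ⟨π', _, h2⟩ := π.exists_snoc hbc.1
      exact ⟨π', h2 u hπ hbc.2⟩

lemma mem_skeletonPlus {x : ℤ} :
    x ∈ skeletonPlus u ↔ (∀ j, j < x → Conn u j x) ∧ ∀ k, x < k → Conn u x k := by
  simp only [skeletonPlus, Set.mem_ofPred_eq, conn_iff]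

/-- A path of weight -∞ cannot raise a supremum, so the restriction to finite paths may be dropped.
-/
lemma maxWeight_eq_iSup : maxWeight u a b = ⨆ π : EdgePath a b, π.weight u := by
  refine le_antisymm (iSup_le fun π => iSup_le fun _ => le_iSup (fun π => EdgePath.weight π u) π)
    (iSup_le fun π => ?_)
  by_cases h : ⊥ < π.weight u
  · exact le_iSup₂ (f := fun (π : EdgePath a b) (_ : π ∈ finitePaths u a b) => π.weight u) π h
  · rw [not_bot_lt_iff.1 h]; exact bot_le

lemma WalkWeight.le_maxWeight (h : WalkWeight u a b r) : r ≤ maxWeight u a b := by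
  obtain ⟨π, rfl⟩ := h.exists_path
  rw [maxWeight_eq_iSup]
  exact le_iSup (fun π => EdgePath.weight π u) π

lemma maxWeight_le (h : ∀ s, WalkWeight u a b s → s ≤ r) : maxWeight u a b ≤ r := by
  rw [maxWeight_eq_iSup]
  exact iSup_le fun π => h _ π.walkWeight

lemma exists_walkWeight_of_lt (h : r < maxWeight u a b) : ∃ s, WalkWeight u a b s ∧ r < s := by
  by_contra! H
  exact absurd (maxWeight_le fun s hs => H s hs) (not_le.2 h)

lemma WalkWeight.trans (h : WalkWeight u a b r) (h' : WalkWeight u b c s) :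
    WalkWeight u a c (r + s) := by
  induction h' with
  | nil => simpa using h
  | snoc _ hbc ih => rw [← add_assoc]; exact ih.snoc hbc

lemma WalkWeight.single (h : a < b) : WalkWeight u a b (u a b) := by
  simpa using WalkWeight.nil.snoc (u := u) h

lemma WalkWeight.le (h : WalkWeight u a b r) : a ≤ b := by
  induction h with
  | nil => exact le_rfl
  | snoc _ hbc ih => exact ih.trans hbc.le

/-- Superadditivity: concatenate nearly optimal paths. Strict lower approximations spare a case
distinction for infinite values. -/
lemma maxWeight_add_le (u : ℤ → ℤ → EReal) (a b c : ℤ) :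
    maxWeight u a b + maxWeight u b c ≤ maxWeight u a c := by
  refine EReal.add_le_of_forall_lt fun r hr s hs => ?_
  obtain ⟨r', hr', hrr⟩ := exists_walkWeight_of_lt hr
  obtain ⟨s', hs', hss⟩ := exists_walkWeight_of_lt hs
  exact (add_le_add hrr.le hss.le).trans (hr'.trans hs').le_maxWeight

lemma le_maxWeight_of_le (h : r ≤ maxWeight u a b) (h' : s ≤ maxWeight u b c) :
    r + s ≤ maxWeight u a c := (add_le_add h h').trans (maxWeight_add_le u a b c)

lemma edge_le_maxWeight (h : a < b) : u a b ≤ maxWeight u a b :=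
  (WalkWeight.single h).le_maxWeight

lemma Conn.refl (a : ℤ) : Conn u a a := Relation.ReflTransGen.refl

lemma Conn.trans (h : Conn u a b) (h' : Conn u b c) : Conn u a c :=
  Relation.ReflTransGen.trans h h'

lemma Conn.of_pos (h : a < b) (h' : 0 < u a b) : Conn u a b :=
  Relation.ReflTransGen.single ⟨h, h'⟩

lemma Conn.le (h : Conn u a b) : a ≤ b := by
  induction h with
  | refl => exact le_rfl
  | tail _ hbc ih => exact ih.trans hbc.1.le

lemma Conn.nonneg (h : Conn u a b) : 0 ≤ maxWeight u a b := by
  induction h with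
  | refl => exact WalkWeight.nil.le_maxWeight
  | tail _ hbc ih =>
    simpa using le_maxWeight_of_le ih (hbc.2.le.trans (edge_le_maxWeight hbc.1))

/-- No vertex lies strictly between a and a+1, so the path is this single edge. -/
lemma Conn.pos_succ (h : Conn u a (a + 1)) : 0 < u a (a + 1) := by
  rcases Relation.ReflTransGen.cases_tail h with h | ⟨d, h1, h2, h3⟩
  · omega
  · have := Conn.le h1
    obtain rfl : d = a := by omega
    exact h3

/-- Two configurations agree on the edges between vertices of `[a, b]`. -/
def AgreeOn (u u' : ℤ → ℤ → EReal) (a b : ℤ) : Prop :=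
  ∀ j k, a ≤ j → j < k → k ≤ b → u j k = u' j k

lemma AgreeOn.symm (h : AgreeOn u u' a b) : AgreeOn u' u a b :=
  fun j k h1 h2 h3 => (h j k h1 h2 h3).symm

lemma AgreeOn.mono {a' b' : ℤ} (h : AgreeOn u u' a b) (ha : a ≤ a') (hb : b' ≤ b) :
    AgreeOn u u' a' b' :=
  fun j k h1 h2 h3 => h j k (ha.trans h1) h2 (h3.trans hb)

lemma WalkWeight.congr (h : WalkWeight u a b r) (hu : AgreeOn u u' a b) :
    WalkWeight u' a b r := by
  induction h with
  | nil => exact .nil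
  | snoc h hbc ih =>
    rw [hu _ _ h.le hbc le_rfl]
    exact (ih (hu.mono le_rfl hbc.le)).snoc hbc

lemma maxWeight_congr (hu : AgreeOn u u' a b) : maxWeight u a b = maxWeight u' a b :=
  le_antisymm (maxWeight_le fun _ h => (h.congr hu).le_maxWeight)
    (maxWeight_le fun _ h => (h.congr hu.symm).le_maxWeight)

lemma Conn.congr (h : Conn u a b) (hu : AgreeOn u u' a b) : Conn u' a b := by
  induction h with
  | refl => exact .refl a
  | tail h hbc ih =>
    refine (ih (hu.mono le_rfl hbc.1.le)).trans (.of_pos hbc.1 ?_)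
    rw [← hu _ _ (Conn.le h) hbc.1 le_rfl]; exact hbc.2

lemma conn_congr (hu : AgreeOn u u' a b) : Conn u a b ↔ Conn u' a b :=
  ⟨fun h => h.congr hu, fun h => h.congr hu.symm⟩

/-- The configuration seen from `x`. -/
def shiftConfig (x : ℤ) (u : ℤ → ℤ → EReal) : ℤ → ℤ → EReal := fun j k => u (j + x) (k + x)

/-- The reflected configuration. -/
def reflectConfig (u : ℤ → ℤ → EReal) : ℤ → ℤ → EReal := fun j k => u (-k) (-j)

lemma shiftConfig_neg (x : ℤ) (u : ℤ → ℤ → EReal) : shiftConfig (-x) (shiftConfig x u) = u := by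
  ext j k; simp [shiftConfig]

lemma reflectConfig_reflectConfig (u : ℤ → ℤ → EReal) : reflectConfig (reflectConfig u) = u := by
  ext j k; simp [reflectConfig]

lemma WalkWeight.of_shift {x : ℤ} (h : WalkWeight (shiftConfig x u) a b r) :
    WalkWeight u (a + x) (b + x) r := by
  induction h with
  | nil => exact .nil
  | snoc _ hbc ih => exact ih.snoc (by omega)

lemma WalkWeight.of_reflect (h : WalkWeight (reflectConfig u) a b r) :
    WalkWeight u (-b) (-a) r := by
  induction h with
  | nil => exact .nil
  | @snoc b c r _ hbc ih =>
    rw [add_comm]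
    exact (WalkWeight.single (by omega)).trans ih

lemma maxWeight_shiftConfig (x : ℤ) (u : ℤ → ℤ → EReal) (a b : ℤ) :
    maxWeight (shiftConfig x u) a b = maxWeight u (a + x) (b + x) := by
  refine le_antisymm (maxWeight_le fun _ h => h.of_shift.le_maxWeight)
    (maxWeight_le fun s h => ?_)
  rw [← shiftConfig_neg x u] at h
  simpa using h.of_shift.le_maxWeight

lemma maxWeight_reflectConfig (u : ℤ → ℤ → EReal) (a b : ℤ) :
    maxWeight (reflectConfig u) a b = maxWeight u (-b) (-a) := by
  refine le_antisymm (maxWeight_le fun _ h => h.of_reflect.le_maxWeight)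
    (maxWeight_le fun s h => ?_)
  rw [← reflectConfig_reflectConfig u] at h
  simpa using h.of_reflect.le_maxWeight

lemma Conn.of_shift {x : ℤ} (h : Conn (shiftConfig x u) a b) : Conn u (a + x) (b + x) := by
  induction h with
  | refl => exact .refl _
  | tail _ hbc ih => exact ih.trans (.of_pos (by have := hbc.1; omega) hbc.2)

lemma conn_shiftConfig (x : ℤ) (u : ℤ → ℤ → EReal) (a b : ℤ) :
    Conn (shiftConfig x u) a b ↔ Conn u (a + x) (b + x) := by
  refine ⟨Conn.of_shift, fun h => ?_⟩
  rw [← shiftConfig_neg x u] at h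
  simpa using h.of_shift

lemma mem_skeletonPlus_shiftConfig (x y : ℤ) (u : ℤ → ℤ → EReal) :
    y ∈ skeletonPlus (shiftConfig x u) ↔ y + x ∈ skeletonPlus u := by
  simp only [mem_skeletonPlus, conn_shiftConfig]
  constructor
  · rintro ⟨h1, h2⟩
    exact ⟨fun j hj => by simpa using h1 (j - x) (by omega),
      fun j hj => by simpa using h2 (j - x) (by omega)⟩
  · rintro ⟨h1, h2⟩
    exact ⟨fun j hj => h1 _ (by omega), fun j hj => h2 _ (by omega)⟩

lemma rightEvent_shiftConfig {d : ℝ} (x y : ℤ) (u : ℤ → ℤ → EReal) :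
    RightEvent (shiftConfig x u) d y ↔ RightEvent u d (y + x) := by
  simp only [RightEvent, maxWeight_shiftConfig]
  refine forall_congr' fun i => ?_
  rw [show y + i + x = y + x + i by ring]

lemma leftEvent_shiftConfig {d : ℝ} (x y : ℤ) (u : ℤ → ℤ → EReal) :
    LeftEvent (shiftConfig x u) d y ↔ LeftEvent u d (y + x) := by
  simp only [LeftEvent, maxWeight_shiftConfig]
  refine forall_congr' fun i => ?_
  rw [show y - i + x = y + x - i by ring]

lemma crossEvent_shiftConfig {d : ℝ} (x y : ℤ) (u : ℤ → ℤ → EReal) :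
    CrossEvent (shiftConfig x u) d y ↔ CrossEvent u d (y + x) := by
  simp only [CrossEvent, shiftConfig]
  refine forall_congr' fun i => forall_congr' fun j => ?_
  rw [show y - j + x = y + x - j by ring, show y + i + x = y + x + i by ring]

lemma mem_renewalSet_shiftConfig {c₁ c₂ : ℝ} (x y : ℤ) (u : ℤ → ℤ → EReal) :
    y ∈ renewalSet (shiftConfig x u) c₁ c₂ ↔ y + x ∈ renewalSet u c₁ c₂ := by
  simp only [renewalSet, Set.mem_ofPred_eq, leftEvent_shiftConfig, crossEvent_shiftConfig,
    rightEvent_shiftConfig]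

lemma rightEvent_reflectConfig {d : ℝ} (u : ℤ → ℤ → EReal) :
    RightEvent (reflectConfig u) d 0 ↔ LeftEvent u d 0 := by
  simp only [RightEvent, LeftEvent, maxWeight_reflectConfig]
  simp

end WeightedLineGraph

end

noncomputable section

namespace WeightedLineGraph

open scoped NNReal

/-! ### Exponentially decaying sequences -/

/-- `f n ≤ A ρ ^ n` for some `A < ∞` and `ρ < 1`. -/
def ExpDecay (f : ℕ → ℝ≥0∞) : Prop :=
  ∃ A ρ : ℝ≥0, 0 < ρ ∧ ρ < 1 ∧ ∀ n, f n ≤ A * (ρ : ℝ≥0∞) ^ n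

namespace ExpDecay

variable {f g : ℕ → ℝ≥0∞}

lemma mono (hg : ExpDecay g) (h : ∀ n, f n ≤ g n) : ExpDecay f := by
  obtain ⟨A, ρ, h0, h1, h2⟩ := hg
  exact ⟨A, ρ, h0, h1, fun n => (h n).trans (h2 n)⟩

lemma pow {ρ : ℝ≥0∞} (h : ρ < 1) : ExpDecay (fun n => ρ ^ n) := by
  lift ρ to ℝ≥0 using h.ne_top
  refine ⟨1, max ρ 2⁻¹, lt_max_of_lt_right (by simp), max_lt (by exact_mod_cast h) ?_, fun n => ?_⟩
  · exact inv_lt_one_of_one_lt₀ one_lt_two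
  · rw [ENNReal.coe_one, one_mul]
    exact pow_le_pow_left' (ENNReal.coe_le_coe.2 (le_max_left _ _)) n

lemma exp_neg {c : ℝ} (hc : 0 < c) : ExpDecay (fun n => ENNReal.ofReal (Real.exp (-c * n))) := by
  refine (pow (ρ := ENNReal.ofReal (Real.exp (-c))) ?_).mono fun n => ?_
  · rw [ENNReal.ofReal_lt_one]; simpa using hc
  · rw [← ENNReal.ofReal_pow (Real.exp_nonneg _), ← Real.exp_nat_mul, mul_comm]

lemma add (hf : ExpDecay f) (hg : ExpDecay g) : ExpDecay (fun n => f n + g n) := by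
  obtain ⟨A, ρ, h0, h1, h2⟩ := hf
  obtain ⟨B, σ, k0, k1, k2⟩ := hg
  refine ⟨A + B, max ρ σ, lt_max_of_lt_left h0, max_lt h1 k1, fun n => ?_⟩
  rw [ENNReal.coe_add, add_mul]
  refine add_le_add ((h2 n).trans ?_) ((k2 n).trans ?_)
  · exact mul_le_mul_right (pow_le_pow_left' (ENNReal.coe_le_coe.2 (le_max_left _ _)) n) _
  · exact mul_le_mul_right (pow_le_pow_left' (ENNReal.coe_le_coe.2 (le_max_right _ _)) n) _

lemma const_mul (hf : ExpDecay f) {C : ℝ≥0∞} (hC : C ≠ ∞) : ExpDecay (fun n => C * f n) := by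
  obtain ⟨A, ρ, h0, h1, h2⟩ := hf
  lift C to ℝ≥0 using hC
  refine ⟨C * A, ρ, h0, h1, fun n => ?_⟩
  rw [ENNReal.coe_mul, mul_assoc]
  exact mul_le_mul_right (h2 n) _

/-- The first n₀ terms are absorbed by B 2^{n₀} 2^{-n}, which is at least B for n < n₀. -/
lemma of_eventually (hg : ExpDecay g) {B : ℝ≥0∞} (hB : B ≠ ∞) (hf : ∀ n, f n ≤ B) (n₀ : ℕ)
    (h : ∀ n, n₀ ≤ n → f n ≤ g n) : ExpDecay f := by
  have hp : ((2⁻¹ : ℝ≥0) : ℝ≥0∞) < 1 := by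
    exact_mod_cast inv_lt_one_of_one_lt₀ (one_lt_two (α := ℝ≥0))
  refine (hg.add ((pow hp).const_mul (C := B * 2 ^ n₀)
    (ENNReal.mul_ne_top hB (by simp)))).mono fun n => ?_
  rcases le_or_gt n₀ n with hn | hn
  · exact (h n hn).trans le_self_add
  · refine (hf n).trans (le_trans ?_ le_add_self)
    rw [mul_assoc]
    refine le_mul_of_one_le_right' ?_
    have : (2 : ℝ≥0∞) ^ n * ((2⁻¹ : ℝ≥0) : ℝ≥0∞) ^ n = 1 := by
      rw [← mul_pow]
      have : (2 : ℝ≥0∞) * ((2⁻¹ : ℝ≥0) : ℝ≥0∞) = 1 := by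
        rw [ENNReal.coe_inv (by norm_num)]
        exact ENNReal.mul_inv_cancel (by simp) (by simp)
      rw [this, one_pow]
    rw [← this]
    gcongr
    · exact one_le_two

/-- For ρ < σ < 1 the sequence n (ρ/σ)^n is bounded, so the factor n only costs a slightly worse
rate. -/
lemma nat_mul (hf : ExpDecay f) : ExpDecay (fun n => n * f n) := by
  obtain ⟨A, ρ, h0, h1, h2⟩ := hf
  obtain ⟨σ, hσ, hσ1⟩ := exists_between h1
  have hlim := tendsto_self_mul_const_pow_of_lt_one (r := (ρ / σ : ℝ)) (by positivity)
    (by rw [div_lt_one (by exact_mod_cast h0.trans hσ)]; exact_mod_cast hσ)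
  obtain ⟨K, hK⟩ := hlim.bddAbove_range
  have hKn : ∀ n : ℕ, (n : ℝ≥0) * (ρ / σ) ^ n ≤ K.toNNReal := by
    intro n
    rw [← Real.toNNReal_coe (r := (n : ℝ≥0) * (ρ / σ) ^ n)]
    refine Real.toNNReal_le_toNNReal ?_
    push_cast
    exact hK ⟨n, rfl⟩
  have hσ0 : 0 < σ := h0.trans hσ
  refine ⟨A * K.toNNReal, σ, hσ0, hσ1, fun n => ?_⟩
  calc (n : ℝ≥0∞) * f n ≤ n * (A * (ρ : ℝ≥0∞) ^ n) := by gcongr; exact h2 n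
    _ = ((A * ((n * (ρ / σ) ^ n) * σ ^ n) : ℝ≥0) : ℝ≥0∞) := by
        have : (n : ℝ≥0) * (ρ / σ) ^ n * σ ^ n = n * ρ ^ n := by
          rw [mul_assoc, ← mul_pow, div_mul_cancel₀ _ hσ0.ne']
        rw [this]; push_cast; ring
    _ ≤ ((A * (K.toNNReal * σ ^ n) : ℝ≥0) : ℝ≥0∞) := by
        rw [ENNReal.coe_le_coe]; gcongr; exact hKn n
    _ = _ := by push_cast; ring

lemma tail (hf : ExpDecay f) : ExpDecay (fun n => ∑' k, f (n + k)) := by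
  obtain ⟨A, ρ, h0, h1, h2⟩ := hf
  refine ((pow (ρ := ρ) (by exact_mod_cast h1)).const_mul (C := A * (1 - (ρ : ℝ≥0∞))⁻¹) ?_).mono
    fun n => ?_
  · refine ENNReal.mul_ne_top (by simp) (ENNReal.inv_ne_top.2 ?_)
    rw [← ENNReal.coe_one, ← ENNReal.coe_sub]
    exact_mod_cast (tsub_pos_of_lt h1).ne'
  · calc ∑' k, f (n + k) ≤ ∑' k, A * (ρ : ℝ≥0∞) ^ n * (ρ : ℝ≥0∞) ^ k := by
          refine ENNReal.tsum_le_tsum fun k => (h2 _).trans ?_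
          rw [pow_add, mul_assoc]
      _ = _ := by rw [ENNReal.tsum_mul_left, ENNReal.tsum_geometric]; ring

lemma tsum_ne_top (hf : ExpDecay f) : ∑' n, f n ≠ ∞ := by
  obtain ⟨A, ρ, -, -, h⟩ := hf.tail
  have := h 0
  simp only [zero_add, pow_zero, mul_one] at this
  exact (this.trans_lt ENNReal.coe_lt_top).ne

lemma tendsto (hf : ExpDecay f) : Filter.Tendsto f Filter.atTop (nhds 0) := by
  have := ENNReal.tendsto_cofinite_zero_of_tsum_ne_top hf.tsum_ne_top
  rwa [Nat.cofinite_eq_atTop] at this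

/-- The new rate is ρ^{1/N}; rounding costs the factor ρ⁻¹, because n < N (n / N + 1). -/
lemma comp_div (hf : ExpDecay f) {N : ℕ} (hN : 0 < N) : ExpDecay (fun n => f (n / N)) := by
  obtain ⟨A, ρ, h0, h1, h2⟩ := hf
  set σ : ℝ≥0 := ρ ^ ((N : ℝ)⁻¹) with hσ
  have hσN : σ ^ N = ρ := NNReal.rpow_inv_natCast_pow _ hN.ne'
  have hσ0 : 0 < σ := NNReal.rpow_pos h0
  have hσ1 : σ < 1 := NNReal.rpow_lt_one h1 (by positivity)
  refine ⟨A * ρ⁻¹, σ, hσ0, hσ1, fun n => (h2 _).trans ?_⟩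
  have key : ρ ^ (n / N) ≤ ρ⁻¹ * σ ^ n := by
    rw [le_inv_mul_iff₀ h0, ← pow_succ', ← hσN, ← pow_mul]
    refine pow_le_pow_of_le_one hσ0.le hσ1.le ?_
    have := Nat.lt_mul_div_succ n hN
    exact this.le
  rw [ENNReal.coe_mul, mul_assoc]
  gcongr
  exact_mod_cast key

lemma comp_succ_iff : ExpDecay (fun n => f (n + 1)) → f 0 ≠ ∞ → ExpDecay f := by
  rintro ⟨A, ρ, h0, h1, h2⟩ hf0
  refine ⟨A * ρ⁻¹ + (f 0).toNNReal, ρ, h0, h1, fun n => ?_⟩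
  rcases n with _ | n
  · rw [pow_zero, mul_one, ENNReal.coe_add, ENNReal.coe_toNNReal hf0]; exact le_add_self
  · refine (h2 n).trans ?_
    rw [ENNReal.coe_add, add_mul]
    refine le_trans ?_ le_self_add
    have : A * ρ ^ n = A * ρ⁻¹ * ρ ^ (n + 1) := by
      rw [pow_succ]; field_simp
    exact_mod_cast this.le

end ExpDecay

/-! ### The canonical probability space -/

/-- Configurations of edge weights. -/
abbrev EdgeConfig : Type := Edge → EReal

/-- The weights as a function of two vertices; the value is `0` when there is no edge. -/
def EdgeConfig.weights (W : EdgeConfig) : ℤ → ℤ → EReal :=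
  fun j k => if h : j < k then W ⟨(j, k), h⟩ else 0

lemma EdgeConfig.weights_of_lt (W : EdgeConfig) {j k : ℤ} (h : j < k) :
    W.weights j k = W ⟨(j, k), h⟩ := dif_pos h

lemma measurable_weights (j k : ℤ) : Measurable fun W : EdgeConfig => W.weights j k := by
  unfold EdgeConfig.weights
  split_ifs
  · exact measurable_pi_apply _
  · exact measurable_const

/-- The joint law of independent edge weights with law `ν`. -/
def weightLaw (ν : Measure EReal) [IsProbabilityMeasure ν] : Measure EdgeConfig :=
  Measure.infinitePi fun _ => ν

instance (ν : Measure EReal) [IsProbabilityMeasure ν] : IsProbabilityMeasure (weightLaw ν) := by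
  unfold weightLaw; infer_instance

/-- The edges between vertices of `[a, b]`. -/
def edgesIn (a b : ℤ) : Set Edge := {e | a ≤ e.1.1 ∧ e.1.2 ≤ b}

lemma agreeOn_weights {W W' : EdgeConfig} {a b : ℤ} (h : ∀ e ∈ edgesIn a b, W e = W' e) :
    AgreeOn W.weights W'.weights a b := by
  intro j k h1 h2 h3
  rw [W.weights_of_lt h2, W'.weights_of_lt h2]
  exact h _ ⟨h1, h3⟩

/-- The intervals may share an endpoint, since an edge needs two distinct vertices. Thus variables
attached to successive steps of a path are independent. -/
lemma disjoint_edgesIn {a b c d : ℤ} (h : b ≤ c) : Disjoint (edgesIn a b) (edgesIn c d) := by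
  refine Set.disjoint_left.2 fun e h1 h2 => ?_
  have h3 := e.2
  have h4 := h1.2
  have h5 := h2.1
  omega

section Independence

variable {ν : Measure EReal} [IsProbabilityMeasure ν]

lemma iIndepFun_eval : iIndepFun (fun (e : Edge) (W : EdgeConfig) => W e) (weightLaw ν) :=
  iIndepFun_infinitePi (X := fun _ => id) (fun _ => measurable_id)

lemma map_eval (e : Edge) : (weightLaw ν).map (fun W => W e) = ν :=
  Measure.infinitePi_map_eval _ e

lemma weightLaw_edge {j k : ℤ} (h : j < k) {s : Set EReal} (hs : MeasurableSet s) :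
    weightLaw ν {W | W.weights j k ∈ s} = ν s := by
  conv_rhs => rw [← map_eval (ν := ν) ⟨(j, k), h⟩]
  have := Measure.map_apply (μ := weightLaw ν) (f := fun W : EdgeConfig => W ⟨(j, k), h⟩)
    (measurable_pi_apply _) hs
  rw [this]
  simp only [EdgeConfig.weights_of_lt _ h]
  rfl

lemma lintegral_edge {j k : ℤ} (h : j < k) {f : EReal → ℝ≥0∞} (hf : Measurable f) :
    ∫⁻ W, f (EdgeConfig.weights W j k) ∂weightLaw ν = ∫⁻ x, f x ∂ν := by
  conv_rhs => rw [← map_eval (ν := ν) ⟨(j, k), h⟩]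
  rw [lintegral_map hf (measurable_pi_apply _)]
  simp only [EdgeConfig.weights_of_lt _ h]

/-- Setting the coordinates outside S to 0 does not change the value of f, so f factors through the
coordinates in S. -/
lemma measurable_iSup_comap_of_dependsOn {α : Type*} [MeasurableSpace α] {f : EdgeConfig → α}
    (hf : Measurable f) {S : Set Edge} (hS : DependsOn f S) :
    Measurable[⨆ e ∈ S, MeasurableSpace.comap (fun W : EdgeConfig => W e) inferInstance] f := by
  classical
  set g : EdgeConfig → EdgeConfig := fun W e => if e ∈ S then W e else 0 with hg
  have hfg : f = f ∘ g := by
    ext1 W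
    refine hS fun e he => ?_
    simp [hg, he]
  rw [hfg]
  refine hf.comp ?_
  refine @measurable_pi_lambda _ _ _ (_) _ _ fun e => ?_
  by_cases he : e ∈ S
  · simp only [hg, he, if_true]
    refine Measurable.mono (comap_measurable _) ?_ le_rfl
    exact le_iSup₂ (f := fun (e : Edge) (_ : e ∈ S) =>
      MeasurableSpace.comap (fun W : EdgeConfig => W e) inferInstance) e he
  · simp only [hg, he, if_false]
    exact measurable_const

lemma indepFun_of_dependsOn {α β : Type*} [MeasurableSpace α] [MeasurableSpace β]
    {f : EdgeConfig → α} {g : EdgeConfig → β} (hf : Measurable f) (hg : Measurable g)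
    {S T : Set Edge} (hS : DependsOn f S) (hT : DependsOn g T) (hST : Disjoint S T) :
    IndepFun f g (weightLaw ν) := by
  rw [IndepFun_iff_Indep]
  have h := indep_iSup_of_disjoint (μ := weightLaw ν)
    (m := fun e : Edge => MeasurableSpace.comap (fun W : EdgeConfig => W e) inferInstance)
    (fun e => (measurable_pi_apply e).comap_le) iIndepFun_eval.iIndep hST
  exact indep_of_indep_of_le_left (indep_of_indep_of_le_right h
    (measurable_iSup_comap_of_dependsOn hg hT).comap_le)
    (measurable_iSup_comap_of_dependsOn hf hS).comap_le

lemma measure_inter_of_dependsOn {A B : Set EdgeConfig} (hA : MeasurableSet A)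
    (hB : MeasurableSet B) {S T : Set Edge} (hS : DependsOn (· ∈ A) S) (hT : DependsOn (· ∈ B) T)
    (hST : Disjoint S T) : weightLaw ν (A ∩ B) = weightLaw ν A * weightLaw ν B := by
  have h := (indepFun_of_dependsOn (ν := ν) (measurable_mem.2 hA) (measurable_mem.2 hB)
    hS hT hST).measure_inter_preimage_eq_mul {True} {True} trivial trivial
  have e : ∀ C : Set EdgeConfig, (fun W => W ∈ C) ⁻¹' {True} = C := by intro C; ext; simp
  rwa [e, e] at h

lemma lintegral_mul_of_dependsOn {f g : EdgeConfig → ℝ≥0∞} (hf : Measurable f) (hg : Measurable g)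
    {S T : Set Edge} (hS : DependsOn f S) (hT : DependsOn g T) (hST : Disjoint S T) :
    ∫⁻ W, f W * g W ∂weightLaw ν = (∫⁻ W, f W ∂weightLaw ν) * ∫⁻ W, g W ∂weightLaw ν :=
  lintegral_mul_eq_lintegral_mul_lintegral_of_indepFun hf hg
    (indepFun_of_dependsOn hf hg hS hT hST)

lemma measure_biInter_of_dependsOn {ι : Type*} (s : Finset ι) {C : ι → Set EdgeConfig}
    (hC : ∀ i ∈ s, MeasurableSet (C i)) {T : ι → Set Edge}
    (hT : ∀ i ∈ s, DependsOn (· ∈ C i) (T i))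
    (hd : ∀ i ∈ s, ∀ j ∈ s, i ≠ j → Disjoint (T i) (T j)) :
    weightLaw ν (⋂ i ∈ s, C i) = ∏ i ∈ s, weightLaw ν (C i) := by
  classical
  induction s using Finset.induction_on with
  | empty => simp
  | insert i s hi ih =>
    rw [Finset.prod_insert hi, Finset.set_biInter_insert,
      measure_inter_of_dependsOn (S := T i) (T := ⋃ j ∈ s, T j), ih]
    · exact fun j hj => hC j (Finset.mem_insert_of_mem hj)
    · exact fun j hj => hT j (Finset.mem_insert_of_mem hj)
    · exact fun j hj k hk => hd j (Finset.mem_insert_of_mem hj) k (Finset.mem_insert_of_mem hk)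
    · exact hC i (Finset.mem_insert_self _ _)
    · exact Finset.measurableSet_biInter _ fun j hj => hC j (Finset.mem_insert_of_mem hj)
    · exact hT i (Finset.mem_insert_self _ _)
    · intro W W' h
      simp only [Set.mem_iInter, eq_iff_iff]
      refine forall_congr' fun j => forall_congr' fun hj => ?_
      have := hT j (Finset.mem_insert_of_mem hj) (x := W) (y := W')
        fun e he => h e (Set.mem_biUnion hj he)
      exact iff_of_eq this
    · rw [Set.disjoint_iUnion₂_right]
      intro j hj
      exact hd i (Finset.mem_insert_self _ _) j (Finset.mem_insert_of_mem hj)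
        (by rintro rfl; exact hi hj)

lemma iIndepFun_of_dependsOn {ι α : Type*} [MeasurableSpace α] {f : ι → EdgeConfig → α}
    (hf : ∀ i, Measurable (f i)) {T : ι → Set Edge} (hT : ∀ i, DependsOn (f i) (T i))
    (hd : ∀ i j, i ≠ j → Disjoint (T i) (T j)) : iIndepFun f (weightLaw ν) := by
  rw [iIndepFun_iff_measure_inter_preimage_eq_mul]
  intro s A hA
  refine measure_biInter_of_dependsOn s (fun i hi => hf i (hA i hi)) (T := T) (fun i hi => ?_)
    fun i _ j _ h => hd i j h
  intro W W' h
  simp only [Set.mem_preimage, hT i h]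

/-! ### Invariance -/

/-- Distinct edges keep distinct labels, so the relabelled weights are again independent with law ν.
Translations and the reflection are special cases. -/
lemma measurePreserving_reindex {σ : Edge → Edge} (hσ : Function.Injective σ) :
    MeasurePreserving (fun (W : EdgeConfig) e => W (σ e)) (weightLaw ν) (weightLaw ν) := by
  refine ⟨measurable_pi_lambda _ fun e => measurable_pi_apply _, ?_⟩
  rw [iIndepFun.map_fun_eq_infinitePi_map (fun e => measurable_pi_apply _)
    (iIndepFun_eval.precomp hσ)]
  have : ∀ e, (weightLaw ν).map (fun W => W (σ e)) = ν := fun e => map_eval _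
  simp only [this]
  rfl

/-- The shifted configuration. -/
def EdgeConfig.shift (x : ℤ) (W : EdgeConfig) : EdgeConfig :=
  fun e => W ⟨(e.1.1 + x, e.1.2 + x), by have := e.2; simpa using this⟩

/-- The reflected configuration. -/
def EdgeConfig.reflect (W : EdgeConfig) : EdgeConfig :=
  fun e => W ⟨(-e.1.2, -e.1.1), by have := e.2; simpa using this⟩

lemma measurePreserving_shift (x : ℤ) :
    MeasurePreserving (EdgeConfig.shift x) (weightLaw ν) (weightLaw ν) := by
  refine measurePreserving_reindex (σ := fun e => ⟨(e.1.1 + x, e.1.2 + x), _⟩) ?_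
  rintro ⟨⟨a, b⟩, h⟩ ⟨⟨c, d⟩, h'⟩ h
  simp only [Subtype.mk.injEq, Prod.mk.injEq, add_left_inj] at h ⊢
  exact h

lemma measurePreserving_reflect :
    MeasurePreserving EdgeConfig.reflect (weightLaw ν) (weightLaw ν) := by
  refine measurePreserving_reindex (σ := fun e => ⟨(-e.1.2, -e.1.1), _⟩) ?_
  rintro ⟨⟨a, b⟩, h⟩ ⟨⟨c, d⟩, h'⟩ h
  simp only [Subtype.mk.injEq, Prod.mk.injEq, neg_inj] at h ⊢
  exact h.symm

lemma weights_shift (x : ℤ) (W : EdgeConfig) : (W.shift x).weights = shiftConfig x W.weights := by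
  ext j k
  simp [EdgeConfig.weights, EdgeConfig.shift, shiftConfig]

lemma weights_reflect (W : EdgeConfig) : W.reflect.weights = reflectConfig W.weights := by
  ext j k
  simp [EdgeConfig.weights, EdgeConfig.reflect, reflectConfig]

end Independence

/-! ### Measurability -/

instance (a b : ℤ) : Countable (EdgePath a b) := by
  refine Function.Injective.countable
    (f := fun π : EdgePath a b => (⟨π.length, π.vertex⟩ : Σ n : ℕ, Fin (n + 1) → ℤ)) ?_
  rintro ⟨n, x, _, _, _⟩ ⟨n', x', _, _, _⟩ h
  simp only [Sigma.mk.injEq] at h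
  obtain ⟨rfl, h⟩ := h
  obtain rfl := eq_of_heq h
  rfl

lemma measurable_maxWeight (a b : ℤ) :
    Measurable fun W : EdgeConfig => maxWeight W.weights a b := by
  simp only [maxWeight_eq_iSup]
  refine Measurable.iSup fun π => ?_
  exact Finset.measurable_fun_sum _ fun s _ => measurable_weights _ _

lemma measurableSet_conn (a b : ℤ) : MeasurableSet {W : EdgeConfig | Conn W.weights a b} := by
  simp only [← conn_iff]
  have : {W : EdgeConfig | (positivePaths W.weights a b).Nonempty} =
      ⋃ π : EdgePath a b, ⋂ s : Fin π.length, {W | 0 < π.edgeWeight W.weights s} := by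
    ext W; simp [positivePaths, Set.Nonempty]
  rw [this]
  refine MeasurableSet.iUnion fun π => MeasurableSet.iInter fun s => ?_
  exact measurableSet_lt measurable_const (measurable_weights _ _)

lemma measurableSet_skeletonPlus (x : ℤ) :
    MeasurableSet {W : EdgeConfig | x ∈ skeletonPlus W.weights} := by
  simp only [mem_skeletonPlus, measurableSet_setOfPred]
  refine Measurable.and (Measurable.forall fun j => Measurable.imp measurable_const ?_)
    (Measurable.forall fun j => Measurable.imp measurable_const ?_)
  · exact measurableSet_setOfPred.1 (measurableSet_conn _ _)
  · exact measurableSet_setOfPred.1 (measurableSet_conn _ _)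

lemma measurableSet_rightEvent (c : ℝ) (x : ℤ) :
    MeasurableSet {W : EdgeConfig | RightEvent W.weights c x} := by
  simp only [RightEvent, measurableSet_setOfPred]
  refine Measurable.forall fun j => Measurable.imp measurable_const ?_
  exact measurableSet_setOfPred.1 (measurableSet_le measurable_const (measurable_maxWeight _ _))

lemma measurableSet_leftEvent (c : ℝ) (x : ℤ) :
    MeasurableSet {W : EdgeConfig | LeftEvent W.weights c x} := by
  simp only [LeftEvent, measurableSet_setOfPred]
  refine Measurable.forall fun j => Measurable.imp measurable_const ?_
  exact measurableSet_setOfPred.1 (measurableSet_le measurable_const (measurable_maxWeight _ _))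

lemma measurableSet_crossEvent (c : ℝ) (x : ℤ) :
    MeasurableSet {W : EdgeConfig | CrossEvent W.weights c x} := by
  simp only [CrossEvent, measurableSet_setOfPred]
  refine Measurable.forall fun i => Measurable.forall fun j =>
    Measurable.imp measurable_const (Measurable.imp measurable_const ?_)
  exact measurableSet_setOfPred.1 (measurableSet_lt (measurable_weights _ _) measurable_const)

lemma measurableSet_renewalSet (c₁ c₂ : ℝ) (x : ℤ) :
    MeasurableSet {W : EdgeConfig | x ∈ renewalSet W.weights c₁ c₂} := by
  have : {W : EdgeConfig | x ∈ renewalSet W.weights c₁ c₂} =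
      {W | LeftEvent W.weights c₁ x} ∩ ({W | CrossEvent W.weights c₂ x} ∩
        {W | RightEvent W.weights c₁ x}) := by
    ext W; rfl
  rw [this]
  exact (measurableSet_leftEvent _ _).inter
    ((measurableSet_crossEvent _ _).inter (measurableSet_rightEvent _ _))

end WeightedLineGraph

end

noncomputable section

namespace WeightedLineGraph

open scoped NNReal

/-! ### Sums over paths -/

/-- The sum over the paths from `a` to `a + n` of the products of `F` along the edges. -/
def pathSum (F : ℤ → ℤ → ℝ≥0∞) (a : ℤ) : ℕ → ℝ≥0∞
  | 0 => 1
  | n + 1 => ∑ k : Fin (n + 1), pathSum F a k.1 * F (a + k.1) (a + (n + 1 : ℕ))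

lemma pathSum_mul_le (F : ℤ → ℤ → ℝ≥0∞) (a : ℤ) {k n : ℕ} (h : k < n) :
    pathSum F a k * F (a + k) (a + n) ≤ pathSum F a n := by
  obtain ⟨n, rfl⟩ : ∃ n', n = n' + 1 := ⟨n - 1, by omega⟩
  rw [pathSum]
  exact Finset.single_le_sum
    (f := fun k : Fin (n + 1) => pathSum F a k.1 * F (a + k.1) (a + (n + 1 : ℕ)))
    (fun _ _ => zero_le) (Finset.mem_univ ⟨k, h⟩)

lemma measurable_pathSum {F : ℤ → ℤ → EdgeConfig → ℝ≥0∞} (hF : ∀ a b, a < b → Measurable (F a b))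
    (a : ℤ) (n : ℕ) : Measurable fun W => pathSum (fun j k => F j k W) a n := by
  induction n using Nat.strong_induction_on with
  | _ n ih =>
    rcases n with _ | n
    · simp only [pathSum]; exact measurable_const
    · simp only [pathSum]
      refine Finset.measurable_fun_sum _ fun k _ => (ih _ k.2).mul (hF _ _ ?_)
      have := k.2; omega

lemma dependsOn_pathSum {F : ℤ → ℤ → EdgeConfig → ℝ≥0∞}
    (hF : ∀ a b, a < b → DependsOn (F a b) (edgesIn a b))
    (a : ℤ) (n : ℕ) : DependsOn (fun W => pathSum (fun j k => F j k W) a n) (edgesIn a (a + n)) := by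
  induction n using Nat.strong_induction_on with
  | _ n ih =>
    intro W W' h
    rcases n with _ | n
    · simp only [pathSum]
    · simp only [pathSum]
      refine Finset.sum_congr rfl fun k _ => ?_
      have hk := k.2
      have h1 := ih k.1 k.2 (x := W) (y := W') fun e he => h e ⟨he.1, he.2.trans (by omega)⟩
      simp only at h1
      rw [h1, hF _ _ (by omega) fun e he => h e ⟨le_trans (by omega) he.1, he.2⟩]

/-- Split at the last edge: the sum up to it and its own factor live on adjacent intervals and are
independent. The means therefore satisfy a renewal inequality, and `hr` says that r^n is a
supersolution. -/
lemma lintegral_pathSum_le {ν : Measure EReal} [IsProbabilityMeasure ν]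
    {F : ℤ → ℤ → EdgeConfig → ℝ≥0∞} (hF : ∀ a b, a < b → Measurable (F a b))
    (hF' : ∀ a b, a < b → DependsOn (F a b) (edgesIn a b)) {g : ℕ → ℝ≥0∞}
    (hg : ∀ (a : ℤ) (n : ℕ), 0 < n → ∫⁻ W, F a (a + n) W ∂weightLaw ν ≤ g n) {r : ℝ≥0∞}
    (hr : ∀ n : ℕ, ∑ k : Fin (n + 1), r ^ k.1 * g (n + 1 - k.1) ≤ r ^ (n + 1)) (a : ℤ) (n : ℕ) :
    ∫⁻ W, pathSum (fun j k => F j k W) a n ∂weightLaw ν ≤ r ^ n := by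
  induction n using Nat.strong_induction_on with
  | _ n ih =>
    rcases n with _ | n
    · simp [pathSum]
    · simp only [pathSum]
      rw [lintegral_finsetSum]
      · refine (Finset.sum_le_sum fun k _ => ?_).trans (hr n)
        have hk := k.2
        rw [lintegral_mul_of_dependsOn (measurable_pathSum hF a k.1) (hF _ _ (by omega))
          (dependsOn_pathSum hF' a k.1) (hF' _ _ (by omega)) (disjoint_edgesIn le_rfl)]
        refine mul_le_mul' (ih _ hk) ?_
        have := hg (a + k.1) (n + 1 - k.1) (by omega)
        rwa [show a + (k.1 : ℤ) + ((n + 1 - k.1 : ℕ) : ℤ) = a + ((n + 1 : ℕ) : ℤ) by omega] at this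
      · intro k _
        have := k.2
        exact (measurable_pathSum hF a k.1).mul (hF _ _ (by omega))

/-- Disjoint intervals, with the gaps filled by unit steps of factor at least 1, form one of the
paths in the sum. The induction removes either the interval ending at the right end or a unit step
there. -/
lemma prod_le_pathSum {F : ℤ → ℤ → ℝ≥0∞} (hF : ∀ a, 1 ≤ F a (a + 1)) (a : ℤ) (n : ℕ) :
    ∀ u : Finset (ℤ × ℤ), (∀ p ∈ u, a ≤ p.1 ∧ p.1 < p.2 ∧ p.2 ≤ a + n) →
      (u : Set (ℤ × ℤ)).PairwiseDisjoint (fun p => Icc p.1 p.2) →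
      ∏ p ∈ u, F p.1 p.2 ≤ pathSum F a n := by
  induction n using Nat.strong_induction_on with
  | _ n ih =>
    intro u hu hd
    rcases n with _ | n
    · have : u = ∅ := by
        refine Finset.eq_empty_of_forall_notMem fun p hp => ?_
        have := hu p hp; push_cast at this; omega
      subst this; simp [pathSum]
    · by_cases h : ∃ p ∈ u, p.2 = a + (n + 1 : ℕ)
      · obtain ⟨p, hp, hp2⟩ := h
        obtain ⟨h1, h2, -⟩ := hu p hp
        obtain ⟨k, hk⟩ : ∃ k : ℕ, p.1 = a + k := ⟨(p.1 - a).toNat, by omega⟩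
        rw [← Finset.prod_erase_mul _ _ hp]
        have hkn : k < n + 1 := by omega
        refine le_trans (mul_le_mul' (ih k hkn _ ?_ ?_) ?_) (pathSum_mul_le F a hkn)
        · intro q hq
          obtain ⟨hqp, hq⟩ := Finset.mem_erase.1 hq
          obtain ⟨k1, k2, k3⟩ := hu q hq
          refine ⟨k1, k2, ?_⟩
          by_contra hlt
          have := Set.disjoint_left.1 (hd hq hp hqp) (show q.2 ∈ Icc q.1 q.2 from ⟨k2.le, le_rfl⟩)
          exact this ⟨by omega, by omega⟩
        · exact hd.subset (by simp)
        · rw [hk, hp2]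
      · push Not at h
        refine le_trans ?_ (pathSum_mul_le F a (Nat.lt_succ_self n))
        refine le_trans (ih n (Nat.lt_succ_self n) u (fun p hp => ?_) hd) ?_
        · obtain ⟨k1, k2, k3⟩ := hu p hp
          have := h p hp
          exact ⟨k1, k2, by omega⟩
        · refine le_mul_of_one_le_right' ?_
          have := hF (a + n)
          rwa [show a + (n : ℤ) + 1 = a + ((n + 1 : ℕ) : ℤ) by push_cast; ring] at this

/-! ### Coverings by bad intervals -/

/-- A family of events indexed by the intervals `[a, b]` with `a < b`, depending on the edges
in the interval, with probabilities decaying exponentially in the length. -/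
structure LocalBad (ν : Measure EReal) [IsProbabilityMeasure ν] (B : ℤ → ℤ → Set EdgeConfig) :
    Prop where
  measurable : ∀ a b, a < b → MeasurableSet (B a b)
  dependsOn : ∀ a b, a < b → DependsOn (· ∈ B a b) (edgesIn a b)
  decay : ∃ f, ExpDecay f ∧ ∀ (a : ℤ) (n : ℕ), 0 < n → weightLaw ν (B a (a + n)) ≤ f n

/-- The vertices contained in a bad interval of length at least `m`. -/
def badCover (B : ℤ → ℤ → Set EdgeConfig) (m : ℕ) (W : EdgeConfig) : Set ℤ :=
  {x | ∃ a b, a < b ∧ a ≤ x ∧ x ≤ b ∧ (m : ℤ) ≤ b - a ∧ W ∈ B a b}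

/-- Some bad interval of length at least `n` meets `[0, n)`. -/
def farBad (B : ℤ → ℤ → Set EdgeConfig) (n : ℕ) : Set EdgeConfig :=
  {W | ∃ a b : ℤ, a < n ∧ 0 ≤ b ∧ (n : ℤ) ≤ b - a ∧ a < b ∧ W ∈ B a b}

variable {ν : Measure EReal} [IsProbabilityMeasure ν] {B : ℤ → ℤ → Set EdgeConfig}

/-- Union bound: an interval of length l ≥ n meeting [0,n) starts in [-l, n), which leaves at most
2l positions. -/
lemma LocalBad.expDecay_farBad (hB : LocalBad ν B) :
    ExpDecay fun n => weightLaw ν (farBad B n) := by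
  obtain ⟨f, hf, hfB⟩ := hB.decay
  refine ((hf.nat_mul.const_mul (C := 2) (by simp)).tail).mono fun n => ?_
  have hsub : farBad B n ⊆
      ⋃ k : ℕ, ⋃ a ∈ Finset.Ico (-((n + k : ℕ) : ℤ)) n, B a (a + (n + k : ℕ)) := by
    rintro W ⟨a, b, h1, h2, h3, h4, h5⟩
    obtain ⟨l, hl⟩ : ∃ l : ℕ, b = a + (n + l : ℕ) := ⟨(b - a - n).toNat, by push_cast; omega⟩
    refine Set.mem_iUnion.2 ⟨l, Set.mem_iUnion₂.2 ⟨a, Finset.mem_Ico.2 ⟨by omega, h1⟩, ?_⟩⟩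
    rwa [← hl]
  refine (measure_mono hsub).trans ((measure_iUnion_le _).trans ?_)
  refine ENNReal.tsum_le_tsum fun k => ?_
  refine (measure_biUnion_finset_le _ _).trans ?_
  calc ∑ a ∈ Finset.Ico (-((n + k : ℕ) : ℤ)) n, weightLaw ν (B a (a + (n + k : ℕ)))
      ≤ ∑ a ∈ Finset.Ico (-((n + k : ℕ) : ℤ)) n, f (n + k) := by
        refine Finset.sum_le_sum fun a ha => hfB _ _ ?_
        have := Finset.mem_Ico.1 ha
        omega
    _ = (n + (n + k) : ℕ) * f (n + k) := by
        rw [Finset.sum_const, nsmul_eq_mul, Int.card_Ico]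
        congr 2
        omega
    _ ≤ (2 * (n + k) : ℕ) * f (n + k) := by
        gcongr; omega
    _ = 2 * ((n + k : ℕ) * f (n + k)) := by push_cast; ring

open Classical in
/-- Outside of `farBad`, a disjoint family of long bad intervals in `[-n, 2n]` has at least a
sixth of the size of the covered set. -/
lemma exists_disjoint_bad {W : EdgeConfig} {n m : ℕ} (hfar : W ∉ farBad B n) :
    ∃ u : Finset (ℤ × ℤ), (∀ p ∈ u, -(n : ℤ) ≤ p.1 ∧ p.1 < p.2 ∧ p.2 ≤ 2 * n) ∧
      (∀ p ∈ u, (m : ℤ) ≤ p.2 - p.1 ∧ W ∈ B p.1 p.2) ∧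
      (u : Set (ℤ × ℤ)).PairwiseDisjoint (fun p => Icc p.1 p.2) ∧
      ((Finset.range n).filter fun i : ℕ => (i : ℤ) ∈ badCover B m W).card ≤
        6 * ∑ p ∈ u, (p.2 - p.1).toNat := by
  set t : Set (ℤ × ℤ) := {p | p.1 < p.2 ∧ (m : ℤ) ≤ p.2 - p.1 ∧ W ∈ B p.1 p.2 ∧ p.1 < n ∧ 0 ≤ p.2}
    with ht
  have hlen : ∀ p ∈ t, p.2 - p.1 < n := by
    rintro p ⟨h1, -, h3, h4, h5⟩
    by_contra! h
    exact hfar ⟨p.1, p.2, h4, h5, h, h1, h3⟩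
  -- With ratio 2, every interval of `t` meets a selected one at least half as long, so it lies in
  -- the latter enlarged by twice its length on both sides.
  obtain ⟨u, hut, hud, hcov⟩ := Vitali.exists_disjoint_subfamily_covering_enlargement
    (fun p : ℤ × ℤ => Icc p.1 p.2) t (fun p => ((p.2 - p.1 : ℤ) : ℝ)) 2 one_lt_two
    (fun p hp => by have := hp.1; exact_mod_cast (by omega : 0 ≤ p.2 - p.1)) n
    (fun p hp => by exact_mod_cast (hlen p hp).le)
    (fun p hp => Set.nonempty_Icc.2 hp.1.le)
  have hrange : ∀ p ∈ t, -(n : ℤ) ≤ p.1 ∧ p.1 < p.2 ∧ p.2 ≤ 2 * n := by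
    intro p hp
    have h1 := hlen p hp
    obtain ⟨h2, -, -, h4, h5⟩ := hp
    exact ⟨by omega, h2, by omega⟩
  have hfin : u.Finite := by
    refine Set.Finite.subset (Set.finite_Icc ((-(n : ℤ), -(n : ℤ))) ((2 * n : ℤ), (2 * n : ℤ)))
      fun p hp => ?_
    obtain ⟨h1, h2, h3⟩ := hrange p (hut hp)
    exact ⟨⟨h1, by simp only; omega⟩, ⟨by simp only; omega, h3⟩⟩
  refine ⟨hfin.toFinset, fun p hp => hrange p (hut (hfin.mem_toFinset.1 hp)), fun p hp => ?_,
    by simpa using hud, ?_⟩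
  · have := hut (hfin.mem_toFinset.1 hp)
    exact ⟨this.2.1, this.2.2.1⟩
  · calc _ ≤ (hfin.toFinset.biUnion fun p =>
          Finset.Icc (p.1 - 2 * (p.2 - p.1)) (p.2 + 2 * (p.2 - p.1))).card := by
          refine Finset.card_le_card_of_injOn (fun i : ℕ => (i : ℤ)) (fun i hi => ?_)
            (fun i _ j _ h => by simpa using h)
          simp only [Finset.coe_filter, Finset.mem_range, Set.mem_ofPred_eq] at hi
          obtain ⟨hin, a, b, hab, h1, h2, h3, h4⟩ := hi
          obtain ⟨q, hq, ⟨z, hz1, hz2⟩, hlq⟩ := hcov (a, b) ⟨hab, h3, h4, by omega, by omega⟩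
          have hlq' : b - a ≤ 2 * (q.2 - q.1) := by exact_mod_cast hlq
          simp only [Finset.coe_biUnion, Set.mem_iUnion, Finset.coe_Icc]
          refine ⟨q, hfin.mem_toFinset.2 hq, ?_⟩
          simp only [Set.mem_Icc] at hz1 hz2 ⊢
          omega
      _ ≤ ∑ p ∈ hfin.toFinset,
          (Finset.Icc (p.1 - 2 * (p.2 - p.1)) (p.2 + 2 * (p.2 - p.1))).card :=
          Finset.card_biUnion_le
      _ ≤ 6 * ∑ p ∈ hfin.toFinset, (p.2 - p.1).toNat := by
          rw [Finset.mul_sum]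
          refine Finset.sum_le_sum fun p hp => ?_
          have := (hut (hfin.mem_toFinset.1 hp)).1
          -- An enlarged interval has 5l + 1 vertices, at most 6l because l ≥ 1.
          rw [Int.card_Icc]
          omega

-- An exponential Markov argument. If a fraction 1/T of [0,n) is covered, `exists_disjoint_bad`
-- gives disjoint bad intervals in [-n,2n] of total length at least n/(6T), unless the rare event
-- `farBad` occurs. Reward a bad interval of length l by the factor τ^{Kl}. The sum over paths
-- across [-n,2n] is then at least τ^{4n}, while its mean is at most τ^{3n} once short bad intervals
-- are ignored.
open Classical in
theorem LocalBad.expDecay_badCover (hB : LocalBad ν B) (T : ℕ) : ∃ m₀ : ℕ, ∀ m, m₀ ≤ m →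
    ExpDecay fun n => weightLaw ν {W | n ≤ T *
      ((Finset.range n).filter fun i : ℕ => (i : ℤ) ∈ badCover B m W).card} := by
  obtain ⟨f, ⟨A, ρ, hρ0, hρ1, hfρ⟩, hfB⟩ := hB.decay
  -- 24 = 4 · 6: the covering constant 6, and the exponent 4n that has to beat the length 3n of
  -- [-n,2n].
  set K := 24 * T with hK
  -- With τ = 1/t the reward leaves some decay: τ^{Kl} A ρ^l = A t^l.
  set t : ℝ≥0 := ρ ^ (((K + 1 : ℕ) : ℝ)⁻¹) with ht
  have htK : t ^ (K + 1) = ρ := NNReal.rpow_inv_natCast_pow _ (by omega)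
  have ht0 : 0 < t := NNReal.rpow_pos hρ0
  have ht1 : t < 1 := NNReal.rpow_lt_one hρ1 (by positivity)
  set τ : ℝ≥0 := t⁻¹ with hτ
  have hτ1 : 1 < τ := (one_lt_inv₀ ht0).2 ht1
  have hτt : τ * t = 1 := inv_mul_cancel₀ ht0.ne'
  have htail : ExpDecay fun n => ∑' k, (A : ℝ≥0∞) * (t : ℝ≥0∞) ^ (n + k) :=
    ((ExpDecay.pow (ρ := t) (by exact_mod_cast ht1)).const_mul (C := A) (by simp)).tail
  -- Beyond m₀ the rewarded probabilities sum to less than τ - 1, the room needed for τ^n to be a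
  -- supersolution of the renewal inequality.
  obtain ⟨m₀, hm₀⟩ := (htail.tendsto.eventually (gt_mem_nhds
    (show (0 : ℝ≥0∞) < ((τ - 1 : ℝ≥0) : ℝ≥0∞) by
      exact_mod_cast tsub_pos_of_lt hτ1))).exists_forall_of_atTop
  refine ⟨m₀, fun m hm => ?_⟩
  set h : ℕ → ℝ≥0∞ := fun l => if m ≤ l then (A : ℝ≥0∞) * (t : ℝ≥0∞) ^ l else 0 with hh
  have hsum : ∑' l, h l ≤ ((τ - 1 : ℝ≥0) : ℝ≥0∞) := by
    refine le_trans ?_ (hm₀ m hm).le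
    rw [← ENNReal.summable.sum_add_tsum_nat_add' (f := h) (k := m)]
    rw [Finset.sum_eq_zero, zero_add]
    · refine ENNReal.tsum_le_tsum fun k => ?_
      rw [add_comm k m]
      exact (if_pos (Nat.le_add_right m k)).le
    · intro l hl
      simp only [hh, if_neg (not_le.2 (Finset.mem_range.1 hl))]
  set F : ℤ → ℤ → EdgeConfig → ℝ≥0∞ := fun a b W =>
    (if b = a + 1 then 1 else 0) +
      (if (m : ℤ) ≤ b - a then (B a b).indicator (fun _ => (τ : ℝ≥0∞) ^ (K * (b - a).toNat)) W
        else 0) with hF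
  have hFm : ∀ a b, a < b → Measurable (F a b) := by
    intro a b hab
    refine measurable_const.add ?_
    split_ifs
    · exact measurable_const.indicator (hB.measurable a b hab)
    · exact measurable_const
  have hFd : ∀ a b, a < b → DependsOn (F a b) (edgesIn a b) := by
    intro a b hab W W' hW
    have := iff_of_eq (hB.dependsOn a b hab hW)
    simp only [hF, Set.indicator, this]
  have hFg : ∀ (a : ℤ) (n : ℕ), 0 < n → ∫⁻ W, F a (a + n) W ∂weightLaw ν ≤
      (if n = 1 then 1 else 0) + h n := by
    intro a n hn
    simp only [hF]
    rw [lintegral_add_left measurable_const, lintegral_const, measure_univ, mul_one]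
    refine add_le_add ?_ ?_
    · split_ifs <;> first | omega | simp
    · have e : a + (n : ℤ) - a = n := by ring
      simp only [e, Nat.cast_le, hh, Int.toNat_natCast]
      split_ifs with hmn
      · rw [lintegral_indicator (hB.measurable _ _ (by omega)), setLIntegral_const]
        refine (mul_le_mul_right ((hfB a n hn).trans (hfρ n)) _).trans (le_of_eq ?_)
        rw [← htK]
        have : τ ^ (K * n) * (A * (t ^ (K + 1)) ^ n) = A * t ^ n := by
          have : τ ^ (K * n) * t ^ (K * n) = 1 := by rw [← mul_pow, hτt, one_pow]
          calc _ = A * t ^ n * (τ ^ (K * n) * t ^ (K * n)) := by ring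
            _ = _ := by rw [this, mul_one]
        exact_mod_cast this
      · simp
  have hr : ∀ n : ℕ, ∑ k : Fin (n + 1), (τ : ℝ≥0∞) ^ k.1 *
      ((if n + 1 - k.1 = 1 then 1 else 0) + h (n + 1 - k.1)) ≤ (τ : ℝ≥0∞) ^ (n + 1) := by
    intro n
    have hτ1' : (1 : ℝ≥0∞) ≤ τ := by exact_mod_cast hτ1.le
    rw [Fin.sum_univ_eq_sum_range (fun k => (τ : ℝ≥0∞) ^ k *
      ((if n + 1 - k = 1 then 1 else 0) + h (n + 1 - k)))]
    calc _ = ∑ k ∈ Finset.range (n + 1), ((if n = k then (τ : ℝ≥0∞) ^ k else 0) +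
          (τ : ℝ≥0∞) ^ k * h (n + 1 - k)) := by
          refine Finset.sum_congr rfl fun k hk => ?_
          have := Finset.mem_range.1 hk
          rw [mul_add]
          congr 1
          by_cases hkn : n = k
          · rw [if_pos hkn, if_pos (by omega), mul_one]
          · rw [if_neg hkn, if_neg (by omega), mul_zero]
      _ ≤ (τ : ℝ≥0∞) ^ n + ∑ k ∈ Finset.range (n + 1), (τ : ℝ≥0∞) ^ n * h (k + 1) := by
          rw [Finset.sum_add_distrib, Finset.sum_ite_eq,
            if_pos (Finset.self_mem_range_succ n)]
          refine add_le_add le_rfl ?_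
          rw [← Finset.sum_range_reflect (fun k => (τ : ℝ≥0∞) ^ n * h (k + 1))]
          refine Finset.sum_le_sum fun k hk => ?_
          have := Finset.mem_range.1 hk
          rw [show n + 1 - 1 - k + 1 = n + 1 - k by omega]
          exact mul_le_mul_left (pow_le_pow_right₀ hτ1' (by omega)) _
      _ ≤ (τ : ℝ≥0∞) ^ n + (τ : ℝ≥0∞) ^ n * ((τ - 1 : ℝ≥0) : ℝ≥0∞) := by
          rw [← Finset.mul_sum]
          refine add_le_add le_rfl (mul_le_mul_right (le_trans ?_ hsum) _)
          refine le_trans (ENNReal.sum_le_tsum _) ?_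
          rw [← ENNReal.summable.sum_add_tsum_nat_add' (f := h) (k := 1)]
          exact le_add_self
      _ = (τ : ℝ≥0∞) ^ (n + 1) := by
          have : τ ^ n + τ ^ n * (τ - 1) = τ ^ (n + 1) := by
            rw [← mul_one_add, add_tsub_cancel_of_le hτ1.le, pow_succ]
          exact_mod_cast this
  have hE := fun n : ℕ => lintegral_pathSum_le (g := fun n => (if n = 1 then 1 else 0) + h n)
    hFm hFd hFg hr (-n) (3 * n)
  have hcov : ∀ n : ℕ, {W | n ≤ T *
      ((Finset.range n).filter fun i : ℕ => (i : ℤ) ∈ badCover B m W).card} ⊆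
      farBad B n ∪ {W | (τ : ℝ≥0∞) ^ (4 * n) ≤ pathSum (fun j k => F j k W) (-n) (3 * n)} := by
    intro n W hW
    by_cases hfar : W ∈ farBad B n
    · exact Or.inl hfar
    right
    obtain ⟨u, hu1, hu2, hu3, hu4⟩ := exists_disjoint_bad (m := m) hfar
    have hW' : n ≤ T * ((Finset.range n).filter fun i : ℕ => (i : ℤ) ∈ badCover B m W).card := hW
    have h4n : 4 * n ≤ K * ∑ p ∈ u, (p.2 - p.1).toNat := by
      calc 4 * n ≤ 4 * (T * (6 * ∑ p ∈ u, (p.2 - p.1).toNat)) := by gcongr; exact hW'.trans (by gcongr)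
        _ = _ := by rw [hK]; ring
    have hτ1' : (1 : ℝ≥0∞) ≤ τ := by exact_mod_cast hτ1.le
    calc (τ : ℝ≥0∞) ^ (4 * n) ≤ (τ : ℝ≥0∞) ^ (K * ∑ p ∈ u, (p.2 - p.1).toNat) :=
          pow_le_pow_right₀ hτ1' h4n
      _ = ∏ p ∈ u, (τ : ℝ≥0∞) ^ (K * (p.2 - p.1).toNat) := by
          rw [Finset.mul_sum, Finset.prod_pow_eq_pow_sum]
      _ ≤ ∏ p ∈ u, F p.1 p.2 W := by
          refine Finset.prod_le_prod' fun p hp => ?_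
          obtain ⟨k1, k2⟩ := hu2 p hp
          simp only [hF, if_pos k1, Set.indicator_of_mem k2]
          exact le_add_self
      _ ≤ pathSum (fun j k => F j k W) (-n) (3 * n) := by
          refine prod_le_pathSum (F := fun j k => F j k W) (fun a => ?_) _ _ u (fun p hp => ?_) hu3
          · simp only [hF, if_true]; exact le_self_add
          · obtain ⟨k1, k2, k3⟩ := hu1 p hp
            exact ⟨k1, k2, by push_cast; omega⟩
  refine (hB.expDecay_farBad.add (ExpDecay.pow (ρ := t) (by exact_mod_cast ht1))).mono fun n => ?_
  refine (measure_mono (hcov n)).trans ((measure_union_le _ _).trans (add_le_add le_rfl ?_))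
  have hτ0 : (τ : ℝ≥0∞) ^ (4 * n) ≠ 0 := pow_ne_zero _ (by simpa using (zero_lt_one.trans hτ1).ne')
  -- Markov's inequality: τ^{3n} / τ^{4n} = t^n.
  refine (meas_ge_le_lintegral_div (measurable_pathSum hFm _ _).aemeasurable hτ0
    (by simp)).trans ?_
  refine (ENNReal.div_le_div_right (hE n) _).trans ?_
  rw [ENNReal.div_le_iff hτ0 (by simp)]
  have : τ ^ (3 * n) = t ^ n * τ ^ (4 * n) := by
    rw [show 4 * n = n + 3 * n by ring, pow_add, ← mul_assoc, ← mul_pow, mul_comm t, hτt, one_pow,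
      one_mul]
  exact_mod_cast this.le

end WeightedLineGraph

end

noncomputable section

namespace WeightedLineGraph

open scoped NNReal

variable {ν : Measure EReal} [IsProbabilityMeasure ν] {B : ℤ → ℤ → Set EdgeConfig}

/-! ### Sums of local variables -/

/-- The edges between vertices at distance at most `m` from `x`. -/
abbrev edgesNear (m : ℕ) (x : ℤ) : Set Edge := edgesIn (x - m) (x + m)

/-- Hoeffding's inequality: the centred variables -f i range in an interval of length M, hence are
sub-Gaussian with variance proxy (M/2)². -/
lemma measure_sum_lt_le {f : ℕ → EdgeConfig → ℝ} {M c c' : ℝ} (hM : 0 < M) (hcc : c' < c)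
    (hf : ∀ i, Measurable (f i)) (hf0 : ∀ i W, f i W ∈ Set.Icc 0 M)
    (hi : iIndepFun f (weightLaw ν)) (hc : ∀ i, c ≤ ∫ W, f i W ∂weightLaw ν) (K : ℕ) :
    weightLaw ν {W | ∑ k ∈ Finset.range K, f k W ≤ c' * K} ≤
      ENNReal.ofReal (Real.exp (-(2 * (c - c') ^ 2 / M ^ 2) * K)) := by
  rcases Nat.eq_zero_or_pos K with rfl | hK
  · simp
  have hsub : ∀ i, HasSubgaussianMGF (fun W => -f i W - ∫ W', -f i W' ∂weightLaw ν)
      ((‖0 - (-M)‖₊ / 2) ^ 2) (weightLaw ν) := fun i =>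
    hasSubgaussianMGF_of_mem_Icc (hf i).neg.aemeasurable
      (ae_of_all _ fun W => ⟨by linarith [(hf0 i W).2], by linarith [(hf0 i W).1]⟩)
  have hind : iIndepFun (fun i W => -f i W - ∫ W', -f i W' ∂weightLaw ν) (weightLaw ν) :=
    hi.comp (fun i x => -x - ∫ W', -f i W' ∂weightLaw ν) fun i => by fun_prop
  have hε : 0 ≤ (c - c') * K := mul_nonneg (by linarith) (Nat.cast_nonneg K)
  have key := HasSubgaussianMGF.measure_sum_ge_le_of_iIndepFun hind (s := Finset.range K)
    (fun i _ => hsub i) hε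
  have hle : weightLaw ν {W | ∑ k ∈ Finset.range K, f k W ≤ c' * K} ≤
      weightLaw ν {W | (c - c') * K ≤
        ∑ i ∈ Finset.range K, (-f i W - ∫ W', -f i W' ∂weightLaw ν)} := by
    refine measure_mono fun W hW => ?_
    simp only [Set.mem_ofPred_eq] at hW ⊢
    rw [Finset.sum_sub_distrib, Finset.sum_neg_distrib]
    have : ∑ i ∈ Finset.range K, ∫ W', -f i W' ∂weightLaw ν ≤ ∑ i ∈ Finset.range K, -c := by
      refine Finset.sum_le_sum fun i _ => ?_
      rw [integral_neg]; linarith [hc i]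
    rw [Finset.sum_const, Finset.card_range, nsmul_eq_mul] at this
    linarith
  refine hle.trans ?_
  rw [← ofReal_measureReal]
  refine ENNReal.ofReal_le_ofReal (key.trans (le_of_eq ?_))
  congr 1
  have hn : ((‖0 - (-M)‖₊ : ℝ≥0) : ℝ) = M := by simp [abs_of_pos hM]
  rw [Finset.sum_const, Finset.card_range, nsmul_eq_mul]
  push_cast at hn ⊢
  rw [hn]
  have : (K : ℝ) ≠ 0 := by positivity
  field_simp

lemma sum_range_mul_eq (f : ℕ → ℝ) (N K : ℕ) :
    ∑ i ∈ Finset.range (K * N), f i =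
      ∑ r ∈ Finset.range N, ∑ k ∈ Finset.range K, f (r + k * N) := by
  rw [Finset.sum_comm]
  induction K with
  | zero => simp
  | succ K ih =>
    rw [Nat.succ_mul, Finset.sum_range_add, ih, Finset.sum_range_succ]
    simp only [add_comm]

/-- The sums of bounded local variables with mean at least `c` have exponentially small
probability to be much smaller than their mean. -/
theorem expDecay_sum_local {f : ℤ → EdgeConfig → ℝ} {M c c' : ℝ} {m : ℕ} (hc'0 : 0 ≤ c')
    (hcc : c' < c) (hf : ∀ x, Measurable (f x)) (hf0 : ∀ x W, f x W ∈ Set.Icc 0 M)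
    (hfd : ∀ x, DependsOn (f x) (edgesNear m x)) (hc : ∀ x, c ≤ ∫ W, f x W ∂weightLaw ν) :
    ExpDecay fun n => weightLaw ν {W | ∑ i ∈ Finset.range n, f i W < c' * n} := by
  have hM0 : 0 ≤ M := by
    obtain ⟨h1, h2⟩ := hf0 0 (fun _ => 0)
    exact h1.trans h2
  wlog hM : 0 < M generalizing M
  · exact this (M := M + 1) (fun x W => ⟨(hf0 x W).1, (hf0 x W).2.trans (by linarith)⟩)
      (by linarith) (by linarith)
  -- Vertices of one residue class modulo N have neighbourhoods with disjoint edge sets, so the sum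
  -- splits into N sums of independent variables.
  set N := 2 * m + 1 with hN
  set d := (c + c') / 2 with hd
  have hdc : d < c := by rw [hd]; linarith
  have hcd : c' < d := by rw [hd]; linarith
  -- For K ≥ K₀ one has c'(K+1) ≤ dK, which pays for the incomplete last block of length less than
  -- N.
  obtain ⟨K₀, hK₀⟩ := exists_nat_gt (c' / (d - c'))
  have hexp : ExpDecay fun n => (N : ℝ≥0∞) *
      ENNReal.ofReal (Real.exp (-(2 * (c - d) ^ 2 / M ^ 2) * (n / N : ℕ))) :=
    ((ExpDecay.exp_neg (c := 2 * (c - d) ^ 2 / M ^ 2)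
      (by have : 0 < c - d := by linarith
          positivity)).comp_div (N := N) (by omega)).const_mul (by simp)
  refine hexp.of_eventually (B := 1) (by simp) (fun _ => prob_le_one) (K₀ * N) fun n hn => ?_
  set K := n / N with hK
  have hK0 : K₀ ≤ K := (Nat.le_div_iff_mul_le (by omega)).2 hn
  have hnK : n < (K + 1) * N := by
    have := Nat.lt_mul_div_succ n (show 0 < N by omega)
    rw [mul_comm] at this; exact this
  have hKn : K * N ≤ n := Nat.div_mul_le_self n N
  have hsub : {W | ∑ i ∈ Finset.range n, f i W < c' * n} ⊆ ⋃ r ∈ Finset.range N,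
      {W | ∑ k ∈ Finset.range K, f ((r + k * N : ℕ) : ℤ) W ≤ d * K} := by
    intro W hW
    by_contra hcon
    simp only [Set.mem_iUnion, Set.mem_ofPred_eq, not_exists, not_le] at hcon hW
    have h1 : ∑ i ∈ Finset.range (K * N), f (i : ℤ) W ≤ ∑ i ∈ Finset.range n, f i W :=
      Finset.sum_le_sum_of_subset_of_nonneg (Finset.range_mono hKn) fun i _ _ => (hf0 i W).1
    rw [sum_range_mul_eq (fun i => f (i : ℤ) W)] at h1
    have h2 : ∑ r ∈ Finset.range N, d * K ≤
        ∑ r ∈ Finset.range N, ∑ k ∈ Finset.range K, f ((r + k * N : ℕ) : ℤ) W :=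
      Finset.sum_le_sum fun r hr => (hcon r hr).le
    rw [Finset.sum_const, Finset.card_range, nsmul_eq_mul] at h2
    have h3 : c' * (K + 1) ≤ d * K := by
      rw [div_lt_iff₀ (by linarith)] at hK₀
      have : (K₀ : ℝ) ≤ K := by exact_mod_cast hK0
      nlinarith
    have h4 : c' * n ≤ c' * ((K + 1) * N) := by
      refine mul_le_mul_of_nonneg_left ?_ hc'0
      exact_mod_cast hnK.le
    have h5 : (N : ℝ) * (c' * (K + 1)) ≤ N * (d * K) :=
      mul_le_mul_of_nonneg_left h3 (Nat.cast_nonneg _)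
    linarith
  refine (measure_mono hsub).trans ((measure_biUnion_finset_le _ _).trans ?_)
  refine (Finset.sum_le_sum fun r hr => measure_sum_lt_le (f := fun k => f ((r + k * N : ℕ) : ℤ))
    hM hdc (fun k => hf _) (fun k => hf0 _) ?_ (fun k => hc _) K).trans (le_of_eq ?_)
  · refine iIndepFun_of_dependsOn (fun k => hf _) (T := fun k => edgesNear m ((r + k * N : ℕ) : ℤ))
      (fun k => hfd _) fun k l hkl => ?_
    rcases lt_or_gt_of_ne hkl with h | h
    · refine disjoint_edgesIn ?_
      have : (k + 1) * N ≤ l * N := Nat.mul_le_mul_right _ h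
      push_cast; zify at this; linarith
    · refine (disjoint_edgesIn ?_).symm
      have : (l + 1) * N ≤ k * N := Nat.mul_le_mul_right _ h
      push_cast; zify at this; linarith
  · rw [Finset.sum_const, Finset.card_range, nsmul_eq_mul]

/-! ### Abundance of good vertices -/

open Classical in
/-- Suppose that a vertex is good as soon as a local event occurs and it is not covered by a long
bad interval. Then, up to an exponentially small probability, there are at least two good
vertices in `[0, n)`. -/
theorem LocalBad.expDecay_card_good_le_one (hB : LocalBad ν B) {G : ℤ → Set EdgeConfig}
    {Gl : ℕ → ℤ → Set EdgeConfig} (hGm : ∀ m x, MeasurableSet (Gl m x))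
    (hGd : ∀ m x, DependsOn (· ∈ Gl m x) (edgesNear m x)) {δ : ℝ≥0∞} (hδ : 0 < δ)
    (hGδ : ∀ m x, δ ≤ weightLaw ν (Gl m x))
    (hG : ∀ m x W, W ∈ Gl m x → x ∉ badCover B m W → W ∈ G x) :
    ExpDecay fun n => weightLaw ν
      {W | ((Finset.range n).filter fun i : ℕ => W ∈ G i).card ≤ 1} := by
  have hδ1 : δ ≤ 1 := (hGδ 0 0).trans prob_le_one
  have hδt : δ ≠ ∞ := (hδ1.trans_lt ENNReal.one_lt_top).ne
  set e := δ.toReal with he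
  have he0 : 0 < e := ENNReal.toReal_pos hδ.ne' hδt
  -- The bad cover then removes at most en/4 vertices, while at least en/2 are locally good. For n >
  -- 4/e more than one good vertex remains.
  obtain ⟨T, hT⟩ := exists_nat_gt (4 / e)
  obtain ⟨m, hm⟩ := hB.expDecay_badCover T
  have h1 := hm m le_rfl
  have h2 : ExpDecay fun n : ℕ => weightLaw ν {W | ∑ i ∈ Finset.range n,
      (Gl m i).indicator (fun _ => (1 : ℝ)) W < e / 2 * n} := by
    refine expDecay_sum_local (f := fun x => (Gl m x).indicator fun _ => (1 : ℝ)) (M := 1) (c := e)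
      (c' := e / 2) (m := m) (by positivity) (by linarith)
      (fun x => measurable_const.indicator (hGm m x)) (fun x W => ?_) (fun x W W' h => ?_)
      (fun x => ?_)
    · by_cases h : W ∈ Gl m x <;> simp [h]
    · have := iff_of_eq (hGd m x h)
      simp only [Set.indicator, this]
    · rw [integral_indicator (hGm m x), setIntegral_const, smul_eq_mul, mul_one, he]
      exact ENNReal.toReal_mono (measure_ne_top _ _) (hGδ m x)
  obtain ⟨n₀, hn₀⟩ := exists_nat_gt (4 / e)
  refine (h1.add h2).of_eventually (B := 1) (by simp) (fun _ => prob_le_one) n₀ fun n hn => ?_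
  refine (measure_mono ?_).trans (measure_union_le _ _)
  intro W hW
  by_contra hcon
  simp only [Set.mem_union, Set.mem_ofPred_eq, not_or, not_le, not_lt] at hcon hW
  obtain ⟨k1, k2⟩ := hcon
  set H := (Finset.range n).filter fun i : ℕ => (i : ℤ) ∈ badCover B m W
  have hcard : ∑ i ∈ Finset.range n, (Gl m i).indicator (fun _ => (1 : ℝ)) W =
      ((Finset.range n).filter fun i : ℕ => W ∈ Gl m i).card := by
    rw [Finset.card_filter]
    push_cast
    rfl
  have hle : ((Finset.range n).filter fun i : ℕ => W ∈ Gl m i).card ≤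
      ((Finset.range n).filter fun i : ℕ => W ∈ G i).card + H.card := by
    refine (Finset.card_le_card fun i hi => ?_).trans (Finset.card_union_le _ _)
    simp only [H, Finset.mem_filter, Finset.mem_union] at hi ⊢
    by_cases hc : (i : ℤ) ∈ badCover B m W
    · exact Or.inr ⟨hi.1, hc⟩
    · exact Or.inl ⟨hi.1, hG m i W hi.2 hc⟩
  rw [hcard] at k2
  have hT0 : (0 : ℝ) < T := lt_trans (by positivity) hT
  have k1' : (T : ℝ) * H.card < n := by exact_mod_cast k1
  have k3 : (((Finset.range n).filter fun i : ℕ => W ∈ Gl m i).card : ℝ) ≤ 1 + H.card := by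
    exact_mod_cast hle.trans (Nat.add_le_add_right hW _)
  have k4 : (4 : ℝ) / e < n := hn₀.trans_le (by exact_mod_cast hn)
  rw [div_lt_iff₀ he0] at hT k4
  have hH0 : (0 : ℝ) ≤ H.card := Nat.cast_nonneg _
  have k5 : 4 * (H.card : ℝ) ≤ n * e := by nlinarith
  linarith

end WeightedLineGraph

end

noncomputable section

namespace WeightedLineGraph

open scoped NNReal

variable {ν : Measure EReal} [IsProbabilityMeasure ν]

/-! ### Connectivity -/

/-- The n two-edge paths through the intermediate vertices use pairwise disjoint pairs of edges.
Each is positive with probability ν(Ioi 0)², independently of the others. -/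
lemma measure_not_conn_le (a : ℤ) (n : ℕ) :
    weightLaw ν {W | ¬ Conn W.weights a (a + (n + 1 : ℕ))} ≤ (1 - ν (Ioi 0) ^ 2) ^ n := by
  set D : ℕ → Set EdgeConfig := fun i =>
    {W | 0 < W.weights a (a + (i + 1 : ℕ))} ∩ {W | 0 < W.weights (a + (i + 1 : ℕ)) (a + (n + 1 : ℕ))}
    with hD
  set T : ℕ → Set Edge := fun i => {e | e.1 = (a, a + ((i + 1 : ℕ) : ℤ)) ∨
    e.1 = (a + ((i + 1 : ℕ) : ℤ), a + ((n + 1 : ℕ) : ℤ))} with hT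
  have hm : ∀ j k, MeasurableSet {W : EdgeConfig | 0 < W.weights j k} := fun j k =>
    measurableSet_lt measurable_const (measurable_weights j k)
  have hdep : ∀ (j k : ℤ) (h : j < k) (S : Set Edge), (⟨(j, k), h⟩ : Edge) ∈ S →
      DependsOn (· ∈ {W : EdgeConfig | 0 < W.weights j k}) S := by
    intro j k h S hS W W' hW
    simp only [Set.mem_ofPred_eq, EdgeConfig.weights_of_lt _ h, hW _ hS]
  have hDp : ∀ i < n, weightLaw ν (D i) = ν (Ioi 0) ^ 2 := by
    intro i hi
    rw [hD, measure_inter_of_dependsOn (hm _ _) (hm _ _)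
      (hdep _ _ (by omega) (edgesIn a (a + (i + 1 : ℕ))) ⟨le_rfl, le_rfl⟩)
      (hdep _ _ (by omega) (edgesIn (a + (i + 1 : ℕ)) (a + (n + 1 : ℕ))) ⟨le_rfl, le_rfl⟩)
      (disjoint_edgesIn le_rfl), sq]
    exact congrArg₂ (· * ·) (weightLaw_edge (by omega) measurableSet_Ioi)
      (weightLaw_edge (by omega) measurableSet_Ioi)
  have hsub : {W : EdgeConfig | ¬ Conn W.weights a (a + (n + 1 : ℕ))} ⊆
      ⋂ i ∈ Finset.range n, (D i)ᶜ := by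
    intro W hW
    simp only [Set.mem_iInter, Finset.mem_range]
    rintro i hi ⟨h1, h2⟩
    exact hW ((Conn.of_pos (by omega) h1).trans (.of_pos (by omega) h2))
  refine (measure_mono hsub).trans ?_
  rw [measure_biInter_of_dependsOn (Finset.range n)
    (fun i _ => ((hm _ _).inter (hm _ _)).compl) (T := T)]
  · refine (Finset.prod_le_prod' (g := fun _ => 1 - ν (Ioi 0) ^ 2) fun i hi => ?_).trans (by simp)
    rw [measure_compl ((hm _ _).inter (hm _ _)) (measure_ne_top _ _), measure_univ]
    exact (congrArg (1 - ·) (hDp i (Finset.mem_range.1 hi))).le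
  · intro i hi W W' hW
    have hi := Finset.mem_range.1 hi
    have h1 := iff_of_eq (hdep a (a + (i + 1 : ℕ)) (by omega) (T i) (Or.inl rfl) hW)
    have h2 := iff_of_eq (hdep (a + (i + 1 : ℕ)) (a + (n + 1 : ℕ)) (by omega) (T i) (Or.inr rfl) hW)
    simp only [Set.mem_compl_iff, Set.mem_inter_iff, h1, h2]
  · intro i hi j hj hij
    have hi := Finset.mem_range.1 hi
    have hj := Finset.mem_range.1 hj
    refine Set.disjoint_left.2 fun e h1 h2 => ?_
    rcases h1 with h1 | h1 <;> rcases h2 with h2 | h2 <;>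
    · rw [h1] at h2
      simp only [Prod.mk.injEq] at h2
      omega

lemma dependsOn_conn {a b : ℤ} : DependsOn (fun W : EdgeConfig => Conn W.weights a b) (edgesIn a b) :=
  fun _ _ h => propext (conn_congr (agreeOn_weights h))

lemma localBad_conn (hp : 0 < ν (Ioi 0)) :
    LocalBad ν (fun a b => {W | ¬ Conn W.weights a b}) where
  measurable a b _ := (measurableSet_conn a b).compl
  dependsOn a b _ W W' h := by
    have := iff_of_eq (dependsOn_conn (a := a) (b := b) h)
    simp only [Set.mem_ofPred_eq, this]
  decay := by
    refine ⟨fun n => weightLaw ν {W | ¬ Conn W.weights 0 (0 + (n : ℤ))}, ?_, fun a n _ => ?_⟩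
    · refine ExpDecay.comp_succ_iff ?_ (measure_ne_top _ _)
      refine (ExpDecay.pow (ρ := 1 - ν (Ioi 0) ^ 2) ?_).mono fun n => measure_not_conn_le 0 n
      exact ENNReal.sub_lt_self (by simp) (by simp) (pow_ne_zero _ hp.ne')
    · have := (measurePreserving_shift (ν := ν) a).measure_preimage
        (measurableSet_conn 0 (0 + n)).compl.nullMeasurableSet
      refine le_trans ?_ this.le
      refine measure_mono fun W hW => ?_
      simp only [Set.mem_preimage, Set.mem_ofPred_eq, Set.mem_compl_iff, weights_shift, conn_shiftConfig]
      rwa [zero_add, zero_add, add_comm (n : ℤ)]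

/-! ### Skeleton vertices -/

/-- `x` is a skeleton-plus vertex. -/
def skelEvent (x : ℤ) : Set EdgeConfig := {W | x ∈ skeletonPlus W.weights}

/-- `x` is connected with all the vertices at distance at most `m`. -/
def localSkelEvent (m : ℕ) (x : ℤ) : Set EdgeConfig :=
  {W | (∀ j, x - m ≤ j → j < x → Conn W.weights j x) ∧
    ∀ k, x < k → k ≤ x + m → Conn W.weights x k}

lemma measurableSet_skelEvent (x : ℤ) : MeasurableSet (skelEvent x) :=
  measurableSet_skeletonPlus x

lemma measurableSet_conn' (a b : ℤ) : Measurable fun W : EdgeConfig => Conn W.weights a b :=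
  measurableSet_setOfPred.1 (measurableSet_conn a b)

lemma measurableSet_localSkelEvent (m : ℕ) (x : ℤ) : MeasurableSet (localSkelEvent m x) := by
  simp only [localSkelEvent, measurableSet_setOfPred]
  exact (Measurable.forall fun j => Measurable.imp measurable_const
    (Measurable.imp measurable_const (measurableSet_conn' _ _))).and
    (Measurable.forall fun j => Measurable.imp measurable_const
    (Measurable.imp measurable_const (measurableSet_conn' _ _)))

lemma dependsOn_localSkelEvent (m : ℕ) (x : ℤ) :
    DependsOn (· ∈ localSkelEvent m x) (edgesNear m x) := by
  intro W W' h
  have hc : ∀ a b, x - m ≤ a → b ≤ x + m → (Conn (EdgeConfig.weights W) a b ↔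
      Conn (EdgeConfig.weights W') a b) :=
    fun a b ha hb => conn_congr ((agreeOn_weights h).mono ha hb)
  simp only [localSkelEvent, Set.mem_ofPred_eq, eq_iff_iff]
  refine and_congr (forall_congr' fun j => forall_congr' fun h1 => forall_congr' fun h2 => ?_)
    (forall_congr' fun j => forall_congr' fun h1 => forall_congr' fun h2 => ?_)
  · exact hc j x h1 (by omega)
  · exact hc x j (by omega) h2

lemma skelEvent_subset_localSkelEvent (m : ℕ) (x : ℤ) : skelEvent x ⊆ localSkelEvent m x := by
  intro W hW
  obtain ⟨h1, h2⟩ := mem_skeletonPlus.1 hW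
  exact ⟨fun j _ h => h1 j h, fun k h _ => h2 k h⟩

/-- If x is not joined to some vertex, locality puts that vertex at distance greater than m, and the
interval between the two is a bad interval containing x. -/
lemma mem_skelEvent_of_local {m : ℕ} {x : ℤ} {W : EdgeConfig} (h : W ∈ localSkelEvent m x)
    (hx : x ∉ badCover (fun a b => {W | ¬ Conn W.weights a b}) m W) : W ∈ skelEvent x := by
  refine mem_skeletonPlus.2 ⟨fun j hj => ?_, fun k hk => ?_⟩
  · by_contra hc
    by_cases hm : x - m ≤ j
    · exact hc (h.1 j hm hj)
    · exact hx ⟨j, x, hj, hj.le, le_rfl, by omega, hc⟩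
  · by_contra hc
    by_cases hm : k ≤ x + m
    · exact hc (h.2 k hk hm)
    · exact hx ⟨x, k, hk, le_rfl, hk.le, by omega, hc⟩

lemma preimage_shift_skelEvent (x y : ℤ) :
    EdgeConfig.shift x ⁻¹' skelEvent y = skelEvent (y + x) := by
  ext W
  simp only [skelEvent, Set.mem_preimage, Set.mem_ofPred_eq, weights_shift,
    mem_skeletonPlus_shiftConfig]

lemma measure_skelEvent (x : ℤ) : weightLaw ν (skelEvent x) = weightLaw ν (skelEvent 0) := by
  rw [← (measurePreserving_shift (ν := ν) x).measure_preimage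
    (measurableSet_skelEvent 0).nullMeasurableSet, preimage_shift_skelEvent, zero_add]

open Classical in
lemma expDecay_card_skelEvent (hp : 0 < ν (Ioi 0)) (hS : 0 < weightLaw ν (skelEvent 0)) :
    ExpDecay fun n => weightLaw ν
      {W | ((Finset.range n).filter fun i : ℕ => W ∈ skelEvent i).card ≤ 1} :=
  (localBad_conn hp).expDecay_card_good_le_one measurableSet_localSkelEvent
    dependsOn_localSkelEvent hS
    (fun m x => (measure_skelEvent x).ge.trans
      (measure_mono (skelEvent_subset_localSkelEvent m x)))
    fun _ _ _ => mem_skelEvent_of_local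

/-! ### Lower deviations of the maximal weight -/

/-- Every selected skeleton vertex i contributes the edge (i, i+1). From i+1 positive edges lead to
the next selected vertex, adding a nonnegative weight. -/
lemma sum_le_maxWeight {u : ℤ → ℤ → EReal} {y : ℕ → ℝ} (s : Finset ℕ) :
    ∀ b : ℕ, (∀ i ∈ s, i < b) → (∀ i ∈ s, (i : ℤ) ∈ skeletonPlus u) → (b : ℤ) ∈ skeletonPlus u →
      (∀ i ∈ s, (y i : EReal) ≤ u i (i + 1)) →
      ((∑ i ∈ s, y i : ℝ) : EReal) ≤ maxWeight u 0 b := by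
  induction s using Finset.induction_on_max with
  | empty =>
    intro b _ _ hb _
    simp only [Finset.sum_empty, EReal.coe_zero]
    rcases Nat.eq_zero_or_pos b with rfl | h
    · exact (Conn.refl 0).nonneg
    · exact ((mem_skeletonPlus.1 hb).1 0 (by omega)).nonneg
  | insert a s ha ih =>
    intro b hb hs hbS hy
    rw [Finset.sum_insert (fun h => lt_irrefl _ (ha a h)), add_comm, EReal.coe_add]
    have hab := hb a (Finset.mem_insert_self _ _)
    have h1 := ih a ha (fun i hi => hs i (Finset.mem_insert_of_mem hi))
      (hs a (Finset.mem_insert_self _ _)) fun i hi => hy i (Finset.mem_insert_of_mem hi)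
    refine le_maxWeight_of_le h1 ?_
    have h2 : 0 ≤ maxWeight u ((a : ℤ) + 1) b := by
      rcases Nat.lt_or_ge (a + 1) b with h | h
      · exact ((mem_skeletonPlus.1 hbS).1 _ (by omega)).nonneg
      · rw [show (b : ℤ) = a + 1 by omega]; exact (Conn.refl _).nonneg
    have h3 := le_maxWeight_of_le
      ((hy a (Finset.mem_insert_self _ _)).trans (edge_le_maxWeight (lt_add_one _))) h2
    simpa using h3

/-- The endpoint n need not be a skeleton vertex. The edge of the last selected vertex is given up,
at a loss of at most M, and this vertex is joined to n by positive edges. -/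
lemma sum_sub_le_maxWeight {u : ℤ → ℤ → EReal} {y : ℕ → ℝ} {M : ℝ} (hM : ∀ i, y i ≤ M)
    {s : Finset ℕ} (hne : s.Nonempty) {n : ℕ} (hsn : ∀ i ∈ s, i < n)
    (hs : ∀ i ∈ s, (i : ℤ) ∈ skeletonPlus u) (hy : ∀ i ∈ s, (y i : EReal) ≤ u i (i + 1)) :
    ((∑ i ∈ s, y i - M : ℝ) : EReal) ≤ maxWeight u 0 n := by
  classical
  set a := s.max' hne
  have ha : a ∈ s := s.max'_mem hne
  have h1 := sum_le_maxWeight (u := u) (y := y) (s.erase a) a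
    (fun i hi => s.lt_max'_of_mem_erase_max' hne hi)
    (fun i hi => hs i (Finset.mem_of_mem_erase hi)) (hs a ha)
    fun i hi => hy i (Finset.mem_of_mem_erase hi)
  have h2 := ((mem_skeletonPlus.1 (hs a ha)).2 n (by exact_mod_cast hsn a ha)).nonneg
  have h3 := le_maxWeight_of_le h1 h2
  rw [add_zero] at h3
  refine le_trans (EReal.coe_le_coe_iff.2 ?_) h3
  rw [← Finset.add_sum_erase s y ha]
  linarith [hM a]

/-- The weight of the edge `(x, x + 1)`, truncated to `[0, M]`. -/
def truncWeight (M : ℕ) (x : ℤ) (W : EdgeConfig) : ℝ :=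
  (min (W.weights x (x + 1)).toENNReal M).toReal

lemma measurable_truncWeight (M : ℕ) (x : ℤ) : Measurable (truncWeight M x) :=
  ((measurable_weights x (x + 1)).ereal_toENNReal.min measurable_const).ennreal_toReal

lemma truncWeight_mem (M : ℕ) (x : ℤ) (W : EdgeConfig) : truncWeight M x W ∈ Set.Icc 0 (M : ℝ) := by
  refine ⟨ENNReal.toReal_nonneg, ?_⟩
  have := ENNReal.toReal_mono (b := M) (by simp) (min_le_right (W.weights x (x + 1)).toENNReal M)
  simpa [truncWeight] using this

lemma ofReal_truncWeight (M : ℕ) (x : ℤ) (W : EdgeConfig) :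
    ENNReal.ofReal (truncWeight M x W) = min (W.weights x (x + 1)).toENNReal M :=
  ENNReal.ofReal_toReal (ne_top_of_le_ne_top (by simp) (min_le_right _ _))

lemma truncWeight_le (M : ℕ) {x : ℤ} {W : EdgeConfig} (h : 0 < W.weights x (x + 1)) :
    (truncWeight M x W : EReal) ≤ W.weights x (x + 1) := by
  rw [truncWeight, EReal.coe_ennreal_toReal (ne_top_of_le_ne_top (by simp) (min_le_right _ _)),
    ← EReal.coe_toENNReal h.le]
  exact EReal.coe_ennreal_le_coe_ennreal_iff.2 (by simp)

lemma exists_lt_setLIntegral_min {α : Type*} [MeasurableSpace α] {μ : Measure α} {s : Set α}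
    {f : α → ℝ≥0∞} (hf : Measurable f) {c : ℝ≥0∞} (hc : c < ∫⁻ x in s, f x ∂μ) :
    ∃ M : ℕ, c < ∫⁻ x in s, min (f x) M ∂μ := by
  have h : ∫⁻ x in s, f x ∂μ = ⨆ M : ℕ, ∫⁻ x in s, min (f x) M ∂μ := by
    rw [← lintegral_iSup (fun M => hf.min measurable_const)]
    · congr 1
      ext x
      have := inf_iSup_eq (f x) (fun n : ℕ => (n : ℝ≥0∞))
      rw [ENNReal.iSup_natCast, inf_top_eq] at this
      exact this
    · intro M N hMN x
      exact min_le_min le_rfl (by exact_mod_cast hMN)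
  rw [h] at hc
  exact lt_iSup_iff.1 hc

open Classical in
/-- If `c` is smaller than the mean of the weight of `(0, 1)` on the event that `0` is a skeleton
vertex, then the maximal weight is at least linear with slope `c`, up to an exponentially small
probability. -/
theorem expDecay_maxWeight_lt (hp : 0 < ν (Ioi 0)) {c : ℝ} (hc0 : 0 ≤ c)
    (hc : ENNReal.ofReal c < ∫⁻ W in skelEvent 0, (W.weights 0 1).toENNReal ∂weightLaw ν) :
    ExpDecay fun n => weightLaw ν {W | maxWeight W.weights 0 n < ((c * n : ℝ) : EReal)} := by
  -- The strict inequality survives truncation at a large level M, so that bounded variables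
  -- suffice.
  obtain ⟨M, hM⟩ := exists_lt_setLIntegral_min (measurable_weights 0 1).ereal_toENNReal hc
  set d := ∫ W, (skelEvent 0).indicator (truncWeight M 0) W ∂weightLaw ν with hd
  have hind : ∀ (A : Set EdgeConfig) (x : ℤ) (W : EdgeConfig),
      A.indicator (truncWeight M x) W ∈ Set.Icc 0 (M : ℝ) := by
    intro A x W
    by_cases h : W ∈ A
    · rw [Set.indicator_of_mem h]; exact truncWeight_mem M x W
    · rw [Set.indicator_of_notMem h]; exact ⟨le_rfl, Nat.cast_nonneg _⟩
  have hint : ∀ (A : Set EdgeConfig) (x : ℤ), MeasurableSet A →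
      Integrable (A.indicator (truncWeight M x)) (weightLaw ν) := fun A x hA =>
    Integrable.of_mem_Icc 0 M ((measurable_truncWeight M x).indicator hA).aemeasurable
      (ae_of_all _ fun W => hind A x W)
  have hcd : c < d := by
    have h1 : ENNReal.ofReal d =
        ∫⁻ W in skelEvent 0, min (W.weights 0 1).toENNReal M ∂weightLaw ν := by
      rw [hd, ofReal_integral_eq_lintegral_ofReal (hint _ _ (measurableSet_skelEvent 0))
        (ae_of_all _ fun W => (hind _ _ W).1), ← lintegral_indicator (measurableSet_skelEvent 0)]
      congr 1
      ext W
      by_cases h : W ∈ skelEvent 0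
      · rw [Set.indicator_of_mem h, Set.indicator_of_mem h, ofReal_truncWeight, zero_add]
      · rw [Set.indicator_of_notMem h, Set.indicator_of_notMem h, ENNReal.ofReal_zero]
    rw [← h1] at hM
    exact (ENNReal.ofReal_lt_ofReal_iff_of_nonneg hc0).1 hM
  set c' := (c + d) / 2 with hc'
  have hc'd : c' < d := by rw [hc']; linarith
  have hcc' : c < c' := by rw [hc']; linarith
  -- Of the margin (c' - c)n, one third pays for the vertices in the bad cover and, for large n,
  -- another third for the boundary term M.
  obtain ⟨T, hT⟩ := exists_nat_gt (3 * M / (c' - c))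
  obtain ⟨m, hm⟩ := (localBad_conn hp).expDecay_badCover T
  have h1 := hm m le_rfl
  have h2 : ExpDecay fun n : ℕ => weightLaw ν {W | ∑ i ∈ Finset.range n,
      (localSkelEvent m i).indicator (truncWeight M i) W < c' * n} := by
    -- The range is m + 1 because the edge (x, x+1) has to be included even when m = 0.
    refine expDecay_sum_local (f := fun x => (localSkelEvent m x).indicator (truncWeight M x))
      (M := M) (c := d) (c' := c') (m := m + 1) (by linarith) hc'd
      (fun x => (measurable_truncWeight M x).indicator (measurableSet_localSkelEvent m x))
      (fun x W => hind _ _ _) (fun x W W' h => ?_) (fun x => ?_)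
    · have e1 := iff_of_eq (dependsOn_localSkelEvent m x
        (show ∀ e ∈ edgesNear m x, W e = W' e from fun e he =>
          h e ⟨by have := he.1; push_cast; omega, by have := he.2; push_cast; omega⟩))
      have e2 : truncWeight M x W = truncWeight M x W' := by
        rw [truncWeight, truncWeight, agreeOn_weights h x (x + 1) (by omega) (by omega)
          (by push_cast; omega)]
      simp only [Set.indicator, e1, e2]
    · have e1 : d = ∫ W, (skelEvent x).indicator (truncWeight M x) W ∂weightLaw ν := by
        have e2 := integral_map (μ := weightLaw ν) (φ := EdgeConfig.shift x)
          (measurePreserving_shift (ν := ν) x).measurable.aemeasurable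
          (f := (skelEvent 0).indicator (truncWeight M 0))
          ((measurable_truncWeight M 0).indicator
            (measurableSet_skelEvent 0)).aestronglyMeasurable
        rw [(measurePreserving_shift (ν := ν) x).map_eq] at e2
        rw [hd, e2]
        congr 1
        ext W
        have : W.shift x ∈ skelEvent 0 ↔ W ∈ skelEvent x := by
          rw [← Set.mem_preimage, preimage_shift_skelEvent, zero_add]
        simp only [Set.indicator, this, truncWeight, weights_shift, shiftConfig, zero_add,
          add_comm 1 x]
      rw [e1]
      refine integral_mono (hint _ _ (measurableSet_skelEvent x))
        (hint _ _ (measurableSet_localSkelEvent m x)) fun W => ?_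
      exact Set.indicator_le_indicator_of_subset (skelEvent_subset_localSkelEvent m x)
        (fun W => (truncWeight_mem M x W).1) W
  obtain ⟨n₀, hn₀⟩ := exists_nat_gt (3 * (M + 1) / (c' - c))
  refine (h1.add h2).of_eventually (B := 1) (by simp) (fun _ => prob_le_one) n₀ fun n hn => ?_
  refine (measure_mono ?_).trans (measure_union_le _ _)
  intro W hW
  by_contra hcon
  simp only [Set.mem_union, Set.mem_ofPred_eq, not_or, not_le, not_lt] at hcon hW
  obtain ⟨k1, k2⟩ := hcon
  set H := (Finset.range n).filter fun i : ℕ =>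
    (i : ℤ) ∈ badCover (fun a b => {W | ¬ Conn W.weights a b}) m W
  set s := (Finset.range n).filter fun i : ℕ => W ∈ localSkelEvent m i ∧
    (i : ℤ) ∉ badCover (fun a b => {W | ¬ Conn W.weights a b}) m W with hs
  have hδ : 0 < c' - c := by linarith
  have hsum : ∑ i ∈ Finset.range n, (localSkelEvent m i).indicator (truncWeight M i) W ≤
      ∑ i ∈ s, truncWeight M i W + M * H.card := by
    have : ∀ i ∈ Finset.range n, (localSkelEvent m i).indicator (truncWeight M i) W ≤
        (if W ∈ localSkelEvent m i ∧ (i : ℤ) ∉ badCover (fun a b => {W | ¬ Conn W.weights a b}) m W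
          then truncWeight M i W else 0) +
        (if (i : ℤ) ∈ badCover (fun a b => {W | ¬ Conn W.weights a b}) m W then (M : ℝ) else 0) := by
      intro i _
      have hM' := truncWeight_mem M i W
      by_cases e1 : W ∈ localSkelEvent m i
      · rw [Set.indicator_of_mem e1]
        split_ifs with e2 e3 e3
        · exact absurd e3 e2.2
        · simp
        · simpa using hM'.2
        · exact absurd ⟨e1, e3⟩ e2
      · rw [Set.indicator_of_notMem e1]
        split_ifs <;> first | positivity | simp_all
    refine (Finset.sum_le_sum this).trans (le_of_eq ?_)
    rw [Finset.sum_add_distrib, ← Finset.sum_filter, ← Finset.sum_filter, Finset.sum_const,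
      nsmul_eq_mul, mul_comm (M : ℝ)]
  have k3 : 3 * (M * (H.card : ℝ)) ≤ (c' - c) * n := by
    have k1' : (T : ℝ) * H.card < n := by exact_mod_cast k1
    rw [div_lt_iff₀ hδ] at hT
    have hH0 : (0 : ℝ) ≤ H.card := Nat.cast_nonneg _
    nlinarith
  have k4 : 3 * ((M : ℝ) + 1) < (c' - c) * n := by
    rw [div_lt_iff₀ hδ] at hn₀
    have : (n₀ : ℝ) ≤ n := by exact_mod_cast hn
    nlinarith
  have k5 : c * n + M < ∑ i ∈ s, truncWeight M i W := by
    have : c' * n = c * n + (c' - c) * n := by ring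
    linarith
  have hsS : ∀ i ∈ s, (i : ℤ) ∈ skeletonPlus W.weights := fun i hi =>
    mem_skelEvent_of_local (Finset.mem_filter.1 hi).2.1 (Finset.mem_filter.1 hi).2.2
  have hne : s.Nonempty := by
    rw [Finset.nonempty_iff_ne_empty]
    intro h
    rw [h, Finset.sum_empty] at k5
    have : 0 ≤ c * n := by positivity
    have : (0 : ℝ) ≤ M := Nat.cast_nonneg M
    linarith
  have key := sum_sub_le_maxWeight (u := W.weights) (y := fun i => truncWeight M i W) (M := M)
    (fun i => (truncWeight_mem M i W).2) hne (n := n)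
    (fun i hi => Finset.mem_range.1 (Finset.mem_filter.1 hi).1) hsS
    (fun i hi => truncWeight_le M ((mem_skeletonPlus.1 (hsS i hi)).2 _ (lt_add_one _)).pos_succ)
  have := (EReal.coe_lt_coe_iff.2 (show c * n < ∑ i ∈ s, truncWeight M i W - M by linarith))
  exact absurd hW (not_lt.2 (this.le.trans key))

end WeightedLineGraph

end

noncomputable section

namespace WeightedLineGraph

open scoped NNReal

variable {ν : Measure EReal} [IsProbabilityMeasure ν]

/-! ### First points of a set of integers -/

lemma isLeast_firstPoint {S : Set ℤ} (h : ∃ x ∈ S, 0 ≤ x) :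
    IsLeast {x | x ∈ S ∧ 0 ≤ x} (firstPoint S) := by
  obtain ⟨x, hx, hx0⟩ := h
  have hb : BddBelow {x | x ∈ S ∧ 0 ≤ x} := ⟨0, fun y hy => hy.2⟩
  exact ⟨Int.csInf_mem ⟨x, hx, hx0⟩ hb, fun y hy => csInf_le hb hy⟩

lemma isLeast_secondPoint {S : Set ℤ} (h : ∃ x ∈ S, ∃ y ∈ S, 0 ≤ x ∧ x < y) :
    IsLeast {x | x ∈ S ∧ firstPoint S < x} (secondPoint S) := by
  obtain ⟨x, hx, y, hy, hx0, hxy⟩ := h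
  have hb : BddBelow {x | x ∈ S ∧ firstPoint S < x} := ⟨firstPoint S, fun y hy => hy.2.le⟩
  have hf := (isLeast_firstPoint ⟨x, hx, hx0⟩).2 ⟨hx, hx0⟩
  exact ⟨Int.csInf_mem ⟨y, hy, hf.trans_lt hxy⟩ hb, fun y hy => csInf_le hb hy⟩

lemma ae_exists_of_expDecay {α : Type*} [MeasurableSpace α] {μ : Measure α} {D : ℕ → Set α}
    (h : ExpDecay fun n => μ (D n)) : ∀ᵐ W ∂μ, ∃ n, W ∉ D n := by
  rw [ae_iff]
  refine le_antisymm (ge_of_tendsto' h.tendsto fun n => measure_mono fun W hW => ?_) zero_le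
  simp only [not_exists, not_not, Set.mem_ofPred_eq] at hW
  exact hW n

open Classical in
lemma ae_exists_two_of_expDecay {α : Type*} [MeasurableSpace α] {μ : Measure α} {G : ℤ → Set α}
    (h : ExpDecay fun n => μ {W | ((Finset.range n).filter fun i : ℕ => W ∈ G i).card ≤ 1}) :
    ∀ᵐ W ∂μ, ∃ x, W ∈ G x ∧ ∃ y, W ∈ G y ∧ 0 ≤ x ∧ x < y := by
  filter_upwards [ae_exists_of_expDecay h] with W hW
  obtain ⟨n, hn⟩ := hW
  replace hn := Finset.one_lt_card.1 (not_le.1 hn)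
  obtain ⟨i, hi, j, hj, hij⟩ := hn
  have hi := (Finset.mem_filter.1 hi).2
  have hj := (Finset.mem_filter.1 hj).2
  rcases lt_or_gt_of_ne hij with h | h
  · exact ⟨i, hi, j, hj, by omega, by omega⟩
  · exact ⟨j, hj, i, hi, by omega, by omega⟩

lemma ae_exists_two_skeleton (hp : 0 < ν (Ioi 0)) (hS : 0 < weightLaw ν (skelEvent 0)) :
    ∀ᵐ W ∂weightLaw ν, ∃ x ∈ skeletonPlus W.weights, ∃ y ∈ skeletonPlus W.weights, 0 ≤ x ∧ x < y :=
  ae_exists_two_of_expDecay (G := skelEvent) (expDecay_card_skelEvent hp hS)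

/-- By translation invariance the estimate for the window [0,n) applies to [-n,0). -/
lemma ae_exists_nonpos_skeleton (hp : 0 < ν (Ioi 0)) (hS : 0 < weightLaw ν (skelEvent 0)) :
    ∀ᵐ W ∂weightLaw ν, ∃ x ∈ skeletonPlus W.weights, x ≤ 0 := by
  classical
  refine (ae_exists_of_expDecay (D := fun n : ℕ =>
    ⋂ i ∈ Finset.range n, (skelEvent ((i : ℤ) + (-n : ℤ)))ᶜ) ?_).mono ?_
  · refine (expDecay_card_skelEvent hp hS).mono fun n => ?_
    have hm : MeasurableSet (⋂ i ∈ Finset.range n, (skelEvent (i : ℤ))ᶜ) :=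
      Finset.measurableSet_biInter _ fun i _ => (measurableSet_skelEvent _).compl
    have e : (⋂ i ∈ Finset.range n, (skelEvent ((i : ℤ) + (-n : ℤ)))ᶜ) =
        EdgeConfig.shift (-n) ⁻¹' (⋂ i ∈ Finset.range n, (skelEvent (i : ℤ))ᶜ) := by
      simp only [Set.preimage_iInter, Set.preimage_compl, preimage_shift_skelEvent]
    rw [e, (measurePreserving_shift (-n : ℤ)).measure_preimage hm.nullMeasurableSet]
    refine measure_mono fun W hW => ?_
    simp only [Set.mem_iInter] at hW
    rw [Set.mem_ofPred_eq, Finset.filter_false_of_mem fun i hi => hW i hi]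
    simp
  · rintro W ⟨n, hn⟩
    simp only [Set.mem_iInter, not_forall, Finset.mem_range] at hn
    obtain ⟨i, hi, h⟩ := hn
    exact ⟨_, not_not.1 h, by omega⟩

/-! ### The cycle formula -/

/-- All vertices to the left of `j` are connected with `j`. -/
def leftConn (j : ℤ) : Set EdgeConfig := {W | ∀ i, i < j → Conn W.weights i j}

/-- All vertices to the right of `j` are connected with `j`. -/
def rightConn (j : ℤ) : Set EdgeConfig := {W | ∀ k, j < k → Conn W.weights j k}

/-- When `j` is a skeleton vertex: it is the first nonnegative one. -/
def leftFirst (j : ℤ) : Set EdgeConfig := leftConn j ∩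
  {W | ∀ i, 0 ≤ i → i < j →
    ¬ ((∀ h, h < i → Conn W.weights h i) ∧ ∀ h, i < h → h ≤ j → Conn W.weights i h)}

/-- When `0` is a skeleton vertex: there are no skeleton vertices in `(0, k]`. -/
def gapEvent (k : ℕ) : Set EdgeConfig :=
  {W | ∀ i : ℤ, 0 < i → i ≤ k →
    ¬ ((∀ h, 0 ≤ h → h < i → Conn W.weights h i) ∧ ∀ h, i < h → Conn W.weights i h)}

/-- The edges to the left of `j`. -/
def edgesLE (j : ℤ) : Set Edge := {e | e.1.2 ≤ j}

/-- The edges to the right of `j`. -/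
def edgesGE (j : ℤ) : Set Edge := {e | j ≤ e.1.1}

lemma disjoint_edgesLE_edgesGE (j : ℤ) : Disjoint (edgesLE j) (edgesGE j) := by
  refine Set.disjoint_left.2 fun e h1 h2 => ?_
  have h3 := e.2
  simp only [edgesLE, edgesGE, Set.mem_ofPred_eq] at h1 h2
  omega

lemma conn_congr_LE {j : ℤ} {W W' : EdgeConfig} (h : ∀ e ∈ edgesLE j, W e = W' e) {a b : ℤ}
    (hb : b ≤ j) : Conn W.weights a b ↔ Conn W'.weights a b :=
  conn_congr (agreeOn_weights fun e he => h e (he.2.trans hb))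

lemma conn_congr_GE {j : ℤ} {W W' : EdgeConfig} (h : ∀ e ∈ edgesGE j, W e = W' e) {a b : ℤ}
    (ha : j ≤ a) : Conn W.weights a b ↔ Conn W'.weights a b :=
  conn_congr (agreeOn_weights fun e he => h e (ha.trans he.1))

lemma skelEvent_eq (j : ℤ) : skelEvent j = leftConn j ∩ rightConn j := by
  ext W; exact mem_skeletonPlus

lemma measurableSet_leftConn (j : ℤ) : MeasurableSet (leftConn j) := by
  simp only [leftConn, measurableSet_setOfPred]
  exact Measurable.forall fun i => Measurable.imp measurable_const (measurableSet_conn' _ _)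

lemma measurableSet_rightConn (j : ℤ) : MeasurableSet (rightConn j) := by
  simp only [rightConn, measurableSet_setOfPred]
  exact Measurable.forall fun i => Measurable.imp measurable_const (measurableSet_conn' _ _)

lemma measurableSet_leftFirst (j : ℤ) : MeasurableSet (leftFirst j) := by
  refine (measurableSet_leftConn j).inter ?_
  simp only [measurableSet_setOfPred]
  exact Measurable.forall fun i => Measurable.imp measurable_const (Measurable.imp measurable_const
    (Measurable.not ((Measurable.forall fun h => Measurable.imp measurable_const
      (measurableSet_conn' _ _)).and (Measurable.forall fun h => Measurable.imp measurable_const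
      (Measurable.imp measurable_const (measurableSet_conn' _ _))))))

lemma measurableSet_gapEvent (k : ℕ) : MeasurableSet (gapEvent k) := by
  simp only [gapEvent, measurableSet_setOfPred]
  exact Measurable.forall fun i => Measurable.imp measurable_const (Measurable.imp measurable_const
    (Measurable.not ((Measurable.forall fun h => Measurable.imp measurable_const
      (Measurable.imp measurable_const (measurableSet_conn' _ _))).and
      (Measurable.forall fun h => Measurable.imp measurable_const (measurableSet_conn' _ _)))))

lemma dependsOn_leftConn (j : ℤ) : DependsOn (· ∈ leftConn j) (edgesLE j) := by
  intro W W' hW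
  simp only [leftConn, Set.mem_ofPred_eq, eq_iff_iff]
  exact forall_congr' fun i => forall_congr' fun _ => conn_congr_LE hW le_rfl

lemma dependsOn_rightConn (j : ℤ) : DependsOn (· ∈ rightConn j) (edgesGE j) := by
  intro W W' hW
  simp only [rightConn, Set.mem_ofPred_eq, eq_iff_iff]
  exact forall_congr' fun i => forall_congr' fun _ => conn_congr_GE hW le_rfl

lemma dependsOn_leftFirst (j : ℤ) : DependsOn (· ∈ leftFirst j) (edgesLE j) := by
  intro W W' hW
  simp only [leftFirst, Set.mem_inter_iff, Set.mem_ofPred_eq, eq_iff_iff]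
  refine and_congr (iff_of_eq (dependsOn_leftConn j hW)) (forall_congr' fun i =>
    forall_congr' fun _ => forall_congr' fun hi => not_congr (and_congr (forall_congr' fun h =>
      forall_congr' fun _ => conn_congr_LE hW hi.le) (forall_congr' fun h =>
      forall_congr' fun _ => forall_congr' fun hh => conn_congr_LE hW hh)))

lemma dependsOn_gapEvent (k : ℕ) : DependsOn (· ∈ gapEvent k) (edgesGE 0) := by
  intro W W' hW
  simp only [gapEvent, Set.mem_ofPred_eq, eq_iff_iff]
  refine forall_congr' fun i =>
    forall_congr' fun hi => forall_congr' fun _ => not_congr (and_congr (forall_congr' fun h =>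
      forall_congr' fun hh => forall_congr' fun _ => conn_congr_GE hW hh) (forall_congr' fun h =>
      forall_congr' fun _ => conn_congr_GE hW hi.le))

/-- Once j is a skeleton vertex, connections from i < j to vertices beyond j can pass through j, so
the edges to the left of j decide whether i is a skeleton vertex. The event t₀⁺ = j thus splits into
independent conditions on the two sides of j. -/
lemma isLeast_skeleton_iff {W : EdgeConfig} {j : ℤ} (hj : 0 ≤ j) :
    W ∈ leftFirst j ∧ W ∈ rightConn j ↔ IsLeast {x | x ∈ skeletonPlus W.weights ∧ 0 ≤ x} j := by
  constructor
  · rintro ⟨⟨h1, h2⟩, h3⟩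
    refine ⟨⟨mem_skeletonPlus.2 ⟨h1, h3⟩, hj⟩, fun i hi => ?_⟩
    by_contra! hij
    obtain ⟨k1, k2⟩ := mem_skeletonPlus.1 hi.1
    exact h2 i hi.2 hij ⟨k1, fun h hh _ => k2 h hh⟩
  · rintro ⟨⟨h1, -⟩, h2⟩
    obtain ⟨k1, k2⟩ := mem_skeletonPlus.1 h1
    refine ⟨⟨k1, fun i hi hij hc => ?_⟩, k2⟩
    have : i ∈ skeletonPlus W.weights := by
      refine mem_skeletonPlus.2 ⟨hc.1, fun h hh => ?_⟩
      rcases le_or_gt h j with hhj | hhj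
      · exact hc.2 h hh hhj
      · exact (hc.2 j hij le_rfl).trans (k2 h hhj)
    exact absurd (h2 ⟨this, hi⟩) (not_le.2 hij)

/-- Connections from negative vertices can pass through the skeleton vertex 0. Hence edges to the
right of 0 determine the next skeleton vertices. -/
lemma mem_gapEvent_iff {W : EdgeConfig} (h0 : W ∈ skelEvent 0) (k : ℕ) :
    W ∈ gapEvent k ↔ ∀ i : ℤ, 0 < i → i ≤ k → W ∉ skelEvent i := by
  obtain ⟨h1, h2⟩ := mem_skeletonPlus.1 h0
  refine forall_congr' fun i => forall_congr' fun hi => forall_congr' fun _ => not_congr ?_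
  constructor
  · rintro ⟨k1, k2⟩
    refine mem_skeletonPlus.2 ⟨fun h hh => ?_, k2⟩
    rcases le_or_gt 0 h with hh0 | hh0
    · exact k1 h hh0 hh
    · exact (h1 h hh0).trans (k1 0 le_rfl hi)
  · intro h
    obtain ⟨k1, k2⟩ := mem_skeletonPlus.1 h
    exact ⟨fun h _ hh => k1 h hh, k2⟩

lemma mem_skelEvent_shift {W : EdgeConfig} {x y : ℤ} :
    W.shift x ∈ skelEvent y ↔ W ∈ skelEvent (y + x) := by
  rw [← preimage_shift_skelEvent, Set.mem_preimage]

lemma mem_rightConn_shift {W : EdgeConfig} (x : ℤ) : W.shift x ∈ rightConn 0 ↔ W ∈ rightConn x := by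
  simp only [rightConn, Set.mem_ofPred_eq, weights_shift, conn_shiftConfig, zero_add]
  constructor
  · intro h k hk; simpa using h (k - x) (by omega)
  · intro h k hk; exact h _ (by omega)

/-- The first nonnegative skeleton vertex. -/
def firstSkel (W : EdgeConfig) : ℤ := firstPoint (skeletonPlus W.weights)

/-- The second nonnegative skeleton vertex. -/
def secondSkel (W : EdgeConfig) : ℤ := secondPoint (skeletonPlus W.weights)

/-- The sum over `j` of the probabilities that the configuration to the left of `j` allows `j` to
be the first nonnegative skeleton vertex. -/
def firstRate (ν : Measure EReal) [IsProbabilityMeasure ν] : ℝ≥0∞ :=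
  ∑' j : ℕ, weightLaw ν (leftFirst j)

/-- Sum over the position j of the first skeleton vertex. That event is `leftFirst j` intersected
with `rightConn j`; the former is independent of what lies to the right of j, and translation brings
the latter to 0. Only the constant `firstRate ν` remembers the left side. -/
theorem lintegral_firstSkel (hp : 0 < ν (Ioi 0)) (hS : 0 < weightLaw ν (skelEvent 0))
    {φ : EdgeConfig → ℝ≥0∞} (hφ : Measurable φ) (hφd : DependsOn φ (edgesGE 0)) :
    AEMeasurable (fun W => φ (W.shift (firstSkel W))) (weightLaw ν) ∧
    ∫⁻ W, φ (W.shift (firstSkel W)) ∂weightLaw ν =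
      firstRate ν * ∫⁻ W in rightConn 0, φ W ∂weightLaw ν := by
  classical
  set ψ : EdgeConfig → ℝ≥0∞ := (rightConn 0).indicator φ with hψ
  have hψm : Measurable ψ := hφ.indicator (measurableSet_rightConn 0)
  have hψd : DependsOn ψ (edgesGE 0) := by
    intro W W' hW
    have := iff_of_eq (dependsOn_rightConn 0 hW)
    simp only [hψ, Set.indicator, this, hφd hW]
  have hsm : ∀ j : ℕ, Measurable fun W : EdgeConfig => ψ (W.shift j) := fun j =>
    hψm.comp (measurePreserving_shift (ν := ν) j).measurable
  have hsd : ∀ j : ℕ, DependsOn (fun W : EdgeConfig => ψ (W.shift j)) (edgesGE j) := by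
    intro j W W' hW
    refine hψd fun e he => hW _ ?_
    simp only [edgesGE, Set.mem_ofPred_eq] at he ⊢
    omega
  have hlm : ∀ j : ℕ, Measurable ((leftFirst (j : ℤ)).indicator (1 : EdgeConfig → ℝ≥0∞)) := fun j =>
    measurable_one.indicator (measurableSet_leftFirst _)
  have hld : ∀ j : ℕ, DependsOn ((leftFirst (j : ℤ)).indicator (1 : EdgeConfig → ℝ≥0∞))
      (edgesLE j) := by
    intro j W W' hW
    have := iff_of_eq (dependsOn_leftFirst (j : ℤ) hW)
    simp only [Set.indicator, this, Pi.one_apply]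
  have hae : (fun W => φ (W.shift (firstSkel W))) =ᵐ[weightLaw ν] fun W =>
      ∑' j : ℕ, (leftFirst (j : ℤ)).indicator (1 : EdgeConfig → ℝ≥0∞) W * ψ (W.shift j) := by
    filter_upwards [ae_exists_two_skeleton hp hS] with W hW
    obtain ⟨x, hx, y, -, hx0, -⟩ := hW
    have hL := isLeast_firstPoint ⟨x, hx, hx0⟩
    obtain ⟨j, hj⟩ : ∃ j : ℕ, firstSkel W = j := ⟨(firstSkel W).toNat, by
      have : 0 ≤ firstSkel W := hL.1.2
      omega⟩
    have hLj : IsLeast {x | x ∈ skeletonPlus W.weights ∧ 0 ≤ x} (j : ℤ) := by rw [← hj]; exact hL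
    obtain ⟨h1, h2⟩ := (isLeast_skeleton_iff (by omega)).2 hLj
    rw [tsum_eq_single j]
    · rw [Set.indicator_of_mem h1, Pi.one_apply, one_mul, hψ,
        Set.indicator_of_mem ((mem_rightConn_shift _).2 h2), hj]
    · intro i hi
      by_cases h3 : W ∈ leftFirst (i : ℤ)
      · rw [hψ, Set.indicator_of_notMem (fun h4 => hi ?_) φ, mul_zero]
        have := (isLeast_skeleton_iff (by omega)).1 ⟨h3, (mem_rightConn_shift _).1 h4⟩
        exact_mod_cast this.unique hLj
      · rw [Set.indicator_of_notMem h3, zero_mul]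
  refine ⟨⟨_, Measurable.tsum fun j => (hlm j).mul (hsm j), hae⟩, ?_⟩
  rw [lintegral_congr_ae hae, lintegral_tsum (f := fun (j : ℕ) W =>
    (leftFirst (j : ℤ)).indicator (1 : EdgeConfig → ℝ≥0∞) W * ψ (W.shift j))
    fun j => ((hlm j).mul (hsm j)).aemeasurable, firstRate,
    ← ENNReal.tsum_mul_right]
  refine tsum_congr fun j => ?_
  rw [lintegral_mul_of_dependsOn (hlm j) (hsm j) (hld j) (hsd j) (disjoint_edgesLE_edgesGE _),
    lintegral_indicator_one (measurableSet_leftFirst _),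
    (measurePreserving_shift (j : ℤ)).lintegral_comp hψm, hψ,
    lintegral_indicator (measurableSet_rightConn 0)]

/-- The number of `k` such that `gapEvent k` occurs. -/
def gapLength (W : EdgeConfig) : ℝ≥0∞ := ∑' k : ℕ, (gapEvent k).indicator 1 W

lemma measurable_gapLength : Measurable gapLength :=
  Measurable.tsum fun k => measurable_one.indicator (measurableSet_gapEvent k)

lemma dependsOn_gapLength : DependsOn gapLength (edgesGE 0) := by
  classical
  intro W W' hW
  refine tsum_congr fun k => ?_
  have := iff_of_eq (dependsOn_gapEvent k hW)
  simp only [Set.indicator, this, Pi.one_apply]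

/-- Seen from t₀⁺, the k-th gap event occurs exactly when k < t₁⁺ - t₀⁺. -/
lemma gapLength_shift_firstSkel {W : EdgeConfig}
    (hW : ∃ x ∈ skeletonPlus W.weights, ∃ y ∈ skeletonPlus W.weights, 0 ≤ x ∧ x < y) :
    gapLength (W.shift (firstSkel W)) = ENNReal.ofReal ((secondSkel W - firstSkel W : ℤ) : ℝ) := by
  classical
  obtain ⟨h1, h2⟩ := isLeast_secondPoint hW
  have hlt : firstSkel W < secondSkel W := h1.2
  have hf : W ∈ skelEvent (firstSkel W) := by
    obtain ⟨x, hx, y, -, hx0, -⟩ := hW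
    exact (isLeast_firstPoint ⟨x, hx, hx0⟩).1.1
  have h0 : W.shift (firstSkel W) ∈ skelEvent 0 := by
    rw [mem_skelEvent_shift, zero_add]; exact hf
  obtain ⟨l, hl⟩ : ∃ l : ℕ, secondSkel W = firstSkel W + l :=
    ⟨(secondSkel W - firstSkel W).toNat, by omega⟩
  have hk : ∀ k : ℕ, W.shift (firstSkel W) ∈ gapEvent k ↔ k < l := by
    intro k
    rw [mem_gapEvent_iff h0]
    simp only [mem_skelEvent_shift]
    constructor
    · intro h
      by_contra! hlk
      refine h l (by omega) (by exact_mod_cast hlk) ?_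
      rw [add_comm, ← hl]
      exact h1.1
    · intro h i hi hik hS
      have e' : firstPoint (skeletonPlus W.weights) = firstSkel W := rfl
      have := h2 ⟨hS, by omega⟩
      have e : secondPoint (skeletonPlus W.weights) = secondSkel W := rfl
      omega
  rw [gapLength, tsum_eq_sum (s := Finset.range l)]
  · rw [Finset.sum_congr rfl fun k hk' => Set.indicator_of_mem ((hk k).2 (Finset.mem_range.1 hk')) 1]
    simp [hl]
  · intro k hk'
    exact Set.indicator_of_notMem (fun h => hk' (Finset.mem_range.2 ((hk k).1 h))) _

/-- Kac's formula for the skeleton vertices. -/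
lemma lintegral_gapLength (hp : 0 < ν (Ioi 0)) (hS : 0 < weightLaw ν (skelEvent 0)) :
    ∫⁻ W in skelEvent 0, gapLength W ∂weightLaw ν = 1 := by
  simp only [gapLength]
  rw [lintegral_tsum fun k => (measurable_one.indicator (measurableSet_gapEvent k)).aemeasurable]
  -- After translation the k-th event says that -k is the largest nonpositive skeleton vertex. These
  -- events are disjoint and almost surely one of them occurs.
  set A : ℕ → Set EdgeConfig := fun k =>
    EdgeConfig.shift (-(k : ℤ)) ⁻¹' (gapEvent k ∩ skelEvent 0) with hA
  have hmA : ∀ k, MeasurableSet (gapEvent k ∩ skelEvent 0) := fun k =>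
    (measurableSet_gapEvent k).inter (measurableSet_skelEvent 0)
  have hAk : ∀ k, ∫⁻ W in skelEvent 0, (gapEvent k).indicator 1 W ∂weightLaw ν =
      weightLaw ν (A k) := by
    intro k
    rw [lintegral_indicator_one (measurableSet_gapEvent k),
      Measure.restrict_apply (measurableSet_gapEvent k), hA,
      (measurePreserving_shift (-(k : ℤ))).measure_preimage (hmA k).nullMeasurableSet]
  have hmem : ∀ k W, W ∈ A k ↔ W ∈ skelEvent (-(k : ℤ)) ∧
      ∀ i : ℤ, -(k : ℤ) < i → i ≤ 0 → W ∉ skelEvent i := by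
    intro k W
    simp only [hA, Set.mem_preimage, Set.mem_inter_iff]
    rw [and_comm, and_congr_left_iff.2 fun _ => Iff.rfl, mem_skelEvent_shift, zero_add]
    refine and_congr_right fun h => ?_
    rw [mem_gapEvent_iff (by rwa [mem_skelEvent_shift, zero_add])]
    simp only [mem_skelEvent_shift]
    constructor
    · intro h i hi hi0; simpa using h (i + k) (by omega) (by omega)
    · intro h i hi hi0; exact h _ (by omega) (by omega)
  simp only [hAk]
  have hmA' : ∀ k, MeasurableSet (A k) := fun k =>
    (measurePreserving_shift (ν := ν) _).measurable (hmA k)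
  rw [← measure_iUnion _ hmA', ← mem_ae_iff_prob_eq_one (MeasurableSet.iUnion hmA')]
  · classical
    filter_upwards [ae_exists_nonpos_skeleton hp hS] with W hW
    obtain ⟨x, hx, hx0⟩ := hW
    have hex : ∃ k : ℕ, W ∈ skelEvent (-(k : ℤ)) := ⟨(-x).toNat, by
      rwa [Int.toNat_of_nonneg (by omega), neg_neg]⟩
    refine Set.mem_iUnion.2 ⟨Nat.find hex, (hmem _ _).2 ⟨Nat.find_spec hex, fun i hi hi0 hS => ?_⟩⟩
    refine Nat.find_min hex (m := (-i).toNat) (by omega) ?_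
    rwa [Int.toNat_of_nonneg (by omega), neg_neg]
  · intro k l hkl
    refine Set.disjoint_left.2 fun W h1 h2 => ?_
    rw [hmem] at h1 h2
    rcases lt_or_gt_of_ne hkl with h | h
    · exact h2.2 _ (by omega) (by omega) h1.1
    · exact h1.2 _ (by omega) (by omega) h2.1

/-- The mean weight of the edge to the right of the first nonnegative skeleton vertex is the mean
length of a cycle multiplied by the mean of this weight at a typical skeleton vertex. -/
theorem lintegral_edge_firstSkel (hp : 0 < ν (Ioi 0)) (hS : 0 < weightLaw ν (skelEvent 0)) :
    ∫⁻ W, ((W.shift (firstSkel W)).weights 0 1).toENNReal ∂weightLaw ν =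
      (∫⁻ W, gapLength (W.shift (firstSkel W)) ∂weightLaw ν) *
        ∫⁻ W in skelEvent 0, (W.weights 0 1).toENNReal ∂weightLaw ν := by
  -- For functions of the right half-line, the means over `skelEvent 0` and over `rightConn 0`
  -- differ by the same constant factor. Kac's formula then eliminates both this factor and
  -- `firstRate ν`; no finiteness is needed.
  have key : ∀ φ : EdgeConfig → ℝ≥0∞, Measurable φ → DependsOn φ (edgesGE 0) →
      ∫⁻ W in skelEvent 0, φ W ∂weightLaw ν =
        weightLaw ν (leftConn 0) * ∫⁻ W in rightConn 0, φ W ∂weightLaw ν := by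
    classical
    intro φ hφ hφd
    have e : (skelEvent 0).indicator φ =
        fun W => (leftConn 0).indicator 1 W * (rightConn 0).indicator φ W := by
      ext W
      rw [skelEvent_eq]
      by_cases h1 : W ∈ leftConn 0 <;> by_cases h2 : W ∈ rightConn 0 <;> simp [h1, h2]
    rw [← lintegral_indicator (measurableSet_skelEvent 0), e, lintegral_mul_of_dependsOn
      (measurable_one.indicator (measurableSet_leftConn 0))
      (hφ.indicator (measurableSet_rightConn 0)) (S := edgesLE 0) (T := edgesGE 0) _ _
      (disjoint_edgesLE_edgesGE 0), lintegral_indicator_one (measurableSet_leftConn 0),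
      lintegral_indicator (measurableSet_rightConn 0)]
    · intro W W' hW
      have := iff_of_eq (dependsOn_leftConn 0 hW)
      simp only [Set.indicator, this, Pi.one_apply]
    · intro W W' hW
      have := iff_of_eq (dependsOn_rightConn 0 hW)
      simp only [Set.indicator, this, hφd hW]
  have hm := (measurable_weights 0 1).ereal_toENNReal
  have hd : DependsOn (fun W : EdgeConfig => (W.weights 0 1).toENNReal) (edgesGE 0) := by
    intro W W' hW
    simp only [EdgeConfig.weights_of_lt _ zero_lt_one]
    rw [hW _ (show (0 : ℤ) ≤ 0 from le_rfl)]
  have h1 := (lintegral_firstSkel hp hS hm hd).2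
  have h2 := (lintegral_firstSkel hp hS measurable_gapLength dependsOn_gapLength).2
  have h3 := lintegral_gapLength hp hS
  rw [key _ measurable_gapLength dependsOn_gapLength] at h3
  rw [h1, h2, key _ hm hd]
  calc _ = firstRate ν * (weightLaw ν (leftConn 0) *
        ∫⁻ W in rightConn 0, gapLength W ∂weightLaw ν) *
        ∫⁻ W in rightConn 0, (W.weights 0 1).toENNReal ∂weightLaw ν := by rw [h3, mul_one]
    _ = _ := by ring

end WeightedLineGraph

end

noncomputable section

namespace WeightedLineGraph

open scoped NNReal

variable {ν : Measure EReal} [IsProbabilityMeasure ν]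

/-! ### Positive probability of the renewal event -/

lemma dependsOn_weights {j k : ℤ} (h : j < k) {S : Set Edge} (hS : (⟨(j, k), h⟩ : Edge) ∈ S) :
    DependsOn (fun W : EdgeConfig => W.weights j k) S := by
  intro W W' hW
  simp only [EdgeConfig.weights_of_lt _ h, hW _ hS]

lemma dependsOn_maxWeight (a b : ℤ) :
    DependsOn (fun W : EdgeConfig => maxWeight W.weights a b) (edgesIn a b) :=
  fun _ _ h => maxWeight_congr (agreeOn_weights h)

lemma dependsOn_rightEvent (c : ℝ) (x : ℤ) :
    DependsOn (· ∈ {W : EdgeConfig | RightEvent W.weights c x}) (edgesGE x) := by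
  intro W W' hW
  simp only [RightEvent, Set.mem_ofPred_eq, eq_iff_iff]
  refine forall_congr' fun i => forall_congr' fun _ => ?_
  have := dependsOn_maxWeight x (x + i) (x := W) (y := W') fun e he => hW e he.1
  simp only at this
  rw [this]

lemma dependsOn_leftEvent (c : ℝ) (x : ℤ) :
    DependsOn (· ∈ {W : EdgeConfig | LeftEvent W.weights c x}) (edgesLE x) := by
  intro W W' hW
  simp only [LeftEvent, Set.mem_ofPred_eq, eq_iff_iff]
  refine forall_congr' fun i => forall_congr' fun _ => ?_
  have := dependsOn_maxWeight (x - i) x (x := W) (y := W') fun e he => hW e he.2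
  simp only at this
  rw [this]

lemma dependsOn_crossEvent (c : ℝ) (x : ℤ) :
    DependsOn (· ∈ {W : EdgeConfig | CrossEvent W.weights c x}) {e | e.1.1 < x ∧ x < e.1.2} := by
  intro W W' hW
  simp only [CrossEvent, Set.mem_ofPred_eq, eq_iff_iff]
  refine forall_congr' fun i => forall_congr' fun j => forall_congr' fun hi =>
    forall_congr' fun hj => ?_
  have := dependsOn_weights (j := x - j) (k := x + i) (by omega)
    (S := {e | e.1.1 < x ∧ x < e.1.2}) ⟨by simp only; omega, by simp only; omega⟩ hW
  simp only at this
  rw [this]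

/-- The edges (i, i+1), i < N, are prescribed to weigh at least c + η, which builds up a reserve. A
vertex N + k with 0 < k < L is reached by a positive edge from one of the L vertices before N, paid
for by the reserve. For k ≥ L the lower deviation bound is applied from N on. The failure event F
has probability less than 1 and depends only on edges ending beyond N, so it is independent of the
start. -/
theorem measure_rightEvent_pos (hp : 0 < ν (Ioi 0)) {c η : ℝ} (hc : 0 ≤ c) (hη : 0 < η)
    (h1 : 0 < ν (Ici ((c + η : ℝ) : EReal)))
    (htail : ExpDecay fun n =>
      weightLaw ν {W | maxWeight W.weights 0 n < ((c * n : ℝ) : EReal)}) :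
    0 < weightLaw ν {W | RightEvent W.weights c 0} := by
  -- This gives c(D+1) ≤ (c+η)(D-1): the weight collected on N - L steps covers the demand up to N +
  -- L, where N = DL.
  obtain ⟨D, hD⟩ := exists_nat_gt ((2 * c + η) / η)
  rw [div_lt_iff₀ hη] at hD
  have hD1 : 1 ≤ D := by
    rcases Nat.eq_zero_or_pos D with rfl | h
    · simp at hD; linarith
    · exact h
  have hq : ν (Iic 0) < 1 := by
    have e : (Iic (0 : EReal)) = (Ioi 0)ᶜ := by simp
    rw [e, prob_compl_eq_one_sub measurableSet_Ioi]
    exact ENNReal.sub_lt_self (by simp) (by simp) hp.ne'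
  -- The two terms bound the two ways to fail: fewer than L vertices, each missing all of its L
  -- edges, and the tail of the lower deviation probabilities.
  obtain ⟨L, hL⟩ := (((ExpDecay.pow hq).nat_mul.add htail.tail).tendsto.eventually
    (gt_mem_nhds zero_lt_one)).exists
  set N := D * L with hN
  have hLN : L ≤ N := Nat.le_mul_of_pos_left L hD1
  set E₁ : Set EdgeConfig := ⋂ i ∈ Finset.range N,
    {W | W.weights (i : ℤ) ((i : ℤ) + 1) ∈ Ici ((c + η : ℝ) : EReal)} with hE₁
  set E₂ : ℕ → Set EdgeConfig := fun k => ⋂ j ∈ Finset.range L,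
    {W | W.weights ((N - L + j : ℕ) : ℤ) (N + k) ∈ Iic (0 : EReal)} with hE₂
  set E₃ : ℕ → Set EdgeConfig := fun k =>
    {W | maxWeight W.weights N (N + k) < ((c * k : ℝ) : EReal)} with hE₃
  set F : Set EdgeConfig := (⋃ k ∈ Finset.Ico 1 L, E₂ k) ∪ ⋃ k : ℕ, E₃ (L + k) with hF
  have hmE : ∀ (a b : ℤ) (s : Set EReal), MeasurableSet s →
      MeasurableSet {W : EdgeConfig | W.weights a b ∈ s} := fun a b s hs =>
    measurable_weights a b hs
  have hmE₁ : MeasurableSet E₁ := Finset.measurableSet_biInter _ fun i _ =>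
    hmE _ _ _ measurableSet_Ici
  have hmE₂ : ∀ k, MeasurableSet (E₂ k) := fun k => Finset.measurableSet_biInter _ fun i _ =>
    hmE _ _ _ measurableSet_Iic
  have hmE₃ : ∀ k, MeasurableSet (E₃ k) := fun k =>
    measurableSet_lt (measurable_maxWeight _ _) measurable_const
  have hmF : MeasurableSet F := by
    refine (Finset.measurableSet_biUnion _ fun k _ => hmE₂ k).union
      (MeasurableSet.iUnion fun k => hmE₃ _)
  have hdep : ∀ (a b : ℤ) (h : a < b) (s : Set EReal) (S : Set Edge), (⟨(a, b), h⟩ : Edge) ∈ S →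
      DependsOn (· ∈ {W : EdgeConfig | W.weights a b ∈ s}) S := by
    intro a b h s S hS W W' hW
    have := dependsOn_weights h hS hW
    simp only at this
    simp only [Set.mem_ofPred_eq, this]
  have hE₁pos : 0 < weightLaw ν E₁ := by
    rw [hE₁, measure_biInter_of_dependsOn (Finset.range N) (fun i _ => hmE _ _ _ measurableSet_Ici)
      (T := fun i => {⟨((i : ℤ), (i : ℤ) + 1), lt_add_one _⟩}) (fun i _ => hdep _ _ _ _ _ rfl)]
    · rw [pos_iff_ne_zero, Finset.prod_ne_zero_iff]
      intro i _
      rw [weightLaw_edge (lt_add_one _) measurableSet_Ici]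
      exact h1.ne'
    · intro i _ j _ hij
      simpa using hij
  have hE₁d : DependsOn (· ∈ E₁) (edgesLE N) := by
    intro W W' hW
    simp only [hE₁, Set.mem_iInter, eq_iff_iff]
    refine forall_congr' fun i => forall_congr' fun hi => iff_of_eq (hdep _ _ (lt_add_one _) _ _ ?_ hW)
    have := Finset.mem_range.1 hi
    simp only [edgesLE, Set.mem_ofPred_eq]
    omega
  have hFd : DependsOn (· ∈ Fᶜ) {e : Edge | (N : ℤ) < e.1.2} := by
    intro W W' hW
    have k2 : ∀ k, 1 ≤ k → (W ∈ E₂ k ↔ W' ∈ E₂ k) := by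
      intro k hk
      simp only [hE₂, Set.mem_iInter]
      refine forall_congr' fun j => forall_congr' fun hj =>
        iff_of_eq (hdep _ _ ?_ _ {e : Edge | (N : ℤ) < e.1.2} ?_ hW)
      · have := Finset.mem_range.1 hj; omega
      · simp only [Set.mem_ofPred_eq]; omega
    have k3 : ∀ k, (W ∈ E₃ k ↔ W' ∈ E₃ k) := by
      intro k
      have := dependsOn_maxWeight (N : ℤ) (N + k) (x := W) (y := W') fun e he =>
        hW e (he.1.trans_lt e.2)
      simp only at this
      simp only [hE₃, Set.mem_ofPred_eq, this]
    simp only [hF, Set.mem_compl_iff, Set.mem_union, Set.mem_iUnion, eq_iff_iff]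
    refine not_congr (or_congr (exists_congr fun k => exists_congr fun hk =>
      k2 k (Finset.mem_Ico.1 hk).1) (exists_congr fun k => k3 _))
  have hFlt : weightLaw ν F < 1 := by
    refine lt_of_le_of_lt ?_ hL
    refine (measure_union_le _ _).trans (add_le_add ?_ ?_)
    · refine (measure_biUnion_finset_le _ _).trans ?_
      calc ∑ k ∈ Finset.Ico 1 L, weightLaw ν (E₂ k) ≤ ∑ k ∈ Finset.Ico 1 L, ν (Iic 0) ^ L := by
            refine Finset.sum_le_sum fun k hk => le_of_eq ?_
            have hk1 := (Finset.mem_Ico.1 hk).1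
            have hlt : ∀ j ∈ Finset.range L, ((N - L + j : ℕ) : ℤ) < N + k := by
              intro j hj
              have := Finset.mem_range.1 hj; omega
            rw [hE₂, measure_biInter_of_dependsOn (Finset.range L)
              (fun i _ => hmE _ _ _ measurableSet_Iic)
              (T := fun j => {e : Edge | e.1.1 = ((N - L + j : ℕ) : ℤ)})
              (fun j hj => hdep _ _ (hlt j hj) _ _ rfl)]
            · rw [Finset.prod_congr rfl fun j hj =>
                weightLaw_edge (ν := ν) (hlt j hj) measurableSet_Iic]
              simp
            · intro i _ j _ hij
              refine Set.disjoint_left.2 fun e h1 h2 => hij ?_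
              simp only [Set.mem_ofPred_eq] at h1 h2
              omega
        _ ≤ L * ν (Iic 0) ^ L := by
            rw [Finset.sum_const, nsmul_eq_mul, Nat.card_Ico]
            gcongr
            omega
    · refine (measure_iUnion_le _).trans (ENNReal.tsum_le_tsum fun k => ?_)
      have := (measurePreserving_shift (ν := ν) (N : ℤ)).measure_preimage
        (measurableSet_lt (measurable_maxWeight 0 (L + k : ℕ))
        (measurable_const (a := ((c * (L + k : ℕ) : ℝ) : EReal)))).nullMeasurableSet
      refine le_trans (measure_mono fun W hW => ?_) this.le
      simp only [Set.mem_preimage, Set.mem_ofPred_eq, weights_shift, maxWeight_shiftConfig]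
      rw [zero_add, add_comm _ (N : ℤ)]
      exact hW
  have hpos : 0 < weightLaw ν (E₁ ∩ Fᶜ) := by
    rw [measure_inter_of_dependsOn hmE₁ hmF.compl hE₁d hFd]
    · refine ENNReal.mul_pos hE₁pos.ne' ?_
      rw [prob_compl_eq_one_sub hmF]
      exact (tsub_pos_of_lt hFlt).ne'
    · refine Set.disjoint_left.2 fun e h1 h2 => ?_
      simp only [edgesLE, Set.mem_ofPred_eq] at h1 h2
      omega
  refine hpos.trans_le (measure_mono ?_)
  rintro W ⟨hW1, hW2⟩
  simp only [hE₁, Set.mem_iInter, Finset.mem_range, Set.mem_ofPred_eq, Set.mem_Ici] at hW1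
  simp only [hF, Set.mem_compl_iff, Set.mem_union, Set.mem_iUnion, not_or, not_exists] at hW2
  have hstep : ∀ j : ℕ, j ≤ N → (((c + η) * j : ℝ) : EReal) ≤ maxWeight W.weights 0 j := by
    intro j
    induction j with
    | zero => intro _; simpa using (Conn.refl 0).nonneg
    | succ j ih =>
      intro hj
      have := le_maxWeight_of_le (ih (by omega))
        ((hW1 j (by omega)).trans (edge_le_maxWeight (lt_add_one _)))
      rw [← EReal.coe_add] at this
      rwa [show (c + η) * ((j + 1 : ℕ) : ℝ) = (c + η) * j + (c + η) by push_cast; ring,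
        Nat.cast_succ]
  intro i hi
  rw [zero_add]
  rcases le_or_gt i N with hiN | hiN
  · refine le_trans (EReal.coe_le_coe_iff.2 ?_) (hstep i hiN)
    have : (0 : ℝ) ≤ i := Nat.cast_nonneg i
    nlinarith
  obtain ⟨k, rfl⟩ : ∃ k, i = N + k := ⟨i - N, by omega⟩
  push_cast
  rcases lt_or_ge k L with hk | hk
  · have h2 := hW2.1 k (Finset.mem_Ico.2 ⟨by omega, hk⟩)
    simp only [hE₂, Set.mem_iInter, not_forall, Finset.mem_range, Set.mem_ofPred_eq, Set.mem_Iic,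
      not_le] at h2
    obtain ⟨j, hj, h2⟩ := h2
    have h3 := le_maxWeight_of_le (hstep (N - L + j) (by omega))
      (h2.le.trans (edge_le_maxWeight (by omega)))
    rw [add_zero] at h3
    refine le_trans (EReal.coe_le_coe_iff.2 ?_) h3
    have e1 : (k : ℝ) ≤ L := by exact_mod_cast hk.le
    have e2 : ((D : ℝ) - 1) * L ≤ (N - L + j : ℕ) := by
      have : N ≤ (N - L + j) + L := by omega
      have : (N : ℝ) ≤ (N - L + j : ℕ) + L := by exact_mod_cast this
      rw [hN] at this ⊢
      push_cast at this ⊢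
      linarith
    have e3 : (N : ℝ) = D * L := by rw [hN]; push_cast; ring
    have hL0 : (0 : ℝ) ≤ L := Nat.cast_nonneg L
    calc c * ((N : ℝ) + k) ≤ c * (D * L + L) := by rw [e3]; gcongr
      _ ≤ (c + η) * (((D : ℝ) - 1) * L) := by nlinarith
      _ ≤ _ := by gcongr
  · obtain ⟨l, rfl⟩ : ∃ l, k = L + l := ⟨k - L, by omega⟩
    have h2 := hW2.2 l
    have h3 := le_maxWeight_of_le (hstep N le_rfl) (not_lt.1 h2)
    rw [← EReal.coe_add] at h3
    refine le_trans (EReal.coe_le_coe_iff.2 ?_) h3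
    have : (0 : ℝ) ≤ N := Nat.cast_nonneg N
    nlinarith

lemma measure_leftEvent (c : ℝ) : weightLaw ν {W | LeftEvent W.weights c 0} =
    weightLaw ν {W | RightEvent W.weights c 0} := by
  rw [← (measurePreserving_reflect (ν := ν)).measure_preimage
    (measurableSet_rightEvent c 0).nullMeasurableSet]
  congr 1
  ext W
  simp only [Set.mem_preimage, Set.mem_ofPred_eq, weights_reflect, rightEvent_reflectConfig]

/-- The finitely many edges with i, j ≤ K are light together with positive probability, since i + j
≥ 2 makes every threshold at least 2c. All other crossing edges are longer than K; at most l of them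
have length l, so a union bound makes them all light with positive probability. The two groups are
independent. -/
theorem measure_crossEvent_pos {c : ℝ} (hc : 0 < c) (h2 : 0 < ν (Iio ((2 * c : ℝ) : EReal)))
    (hq : ExpDecay fun n => ν (Ici ((c * n : ℝ) : EReal))) :
    0 < weightLaw ν {W | CrossEvent W.weights c 0} := by
  obtain ⟨K, hK⟩ := (hq.nat_mul.tail.tendsto.eventually (gt_mem_nhds zero_lt_one)).exists
  set A : Set EdgeConfig := ⋂ p ∈ Finset.Icc 1 K ×ˢ Finset.Icc 1 K,
    {W | W.weights (-(p.1 : ℕ) : ℤ) (p.2 : ℕ) ∈ Iio ((c * (p.1 + p.2) : ℝ) : EReal)} with hA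
  set F : Set EdgeConfig := {W | ∃ j i : ℕ, 1 ≤ j ∧ 1 ≤ i ∧ (K < j ∨ K < i) ∧
    W.weights (-j) i ∈ Ici ((c * (j + i) : ℝ) : EReal)} with hF
  have hmE : ∀ (a b : ℤ) (s : Set EReal), MeasurableSet s →
      MeasurableSet {W : EdgeConfig | W.weights a b ∈ s} := fun a b s hs =>
    measurable_weights a b hs
  have hdep : ∀ (a b : ℤ) (h : a < b) (s : Set EReal) (S : Set Edge), (⟨(a, b), h⟩ : Edge) ∈ S →
      DependsOn (· ∈ {W : EdgeConfig | W.weights a b ∈ s}) S := by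
    intro a b h s S hS W W' hW
    have := dependsOn_weights h hS hW
    simp only at this
    simp only [Set.mem_ofPred_eq, this]
  have hlt : ∀ p ∈ Finset.Icc 1 K ×ˢ Finset.Icc 1 K, (-(p.1 : ℕ) : ℤ) < (p.2 : ℕ) := by
    intro p hp
    simp only [Finset.mem_product, Finset.mem_Icc] at hp
    omega
  have hmA : MeasurableSet A := Finset.measurableSet_biInter _ fun p _ =>
    hmE _ _ _ measurableSet_Iio
  have hmF : MeasurableSet F := by
    simp only [hF, measurableSet_setOfPred]
    exact Measurable.exists fun j => Measurable.exists fun i => measurable_const.and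
      (measurable_const.and (measurable_const.and
        (measurableSet_setOfPred.1 (hmE _ _ _ measurableSet_Ici))))
  have hApos : 0 < weightLaw ν A := by
    rw [hA, measure_biInter_of_dependsOn _ (fun i _ => hmE _ _ _ measurableSet_Iio)
      (T := fun p => {e : Edge | e.1 = ((-(p.1 : ℕ) : ℤ), ((p.2 : ℕ) : ℤ))})
      (fun p hp => hdep _ _ (hlt p hp) _ _ (by rfl))]
    · rw [pos_iff_ne_zero, Finset.prod_ne_zero_iff]
      intro p hp
      rw [weightLaw_edge (hlt p hp) measurableSet_Iio]
      refine (h2.trans_le (measure_mono (Set.Iio_subset_Iio (EReal.coe_le_coe_iff.2 ?_)))).ne'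
      simp only [Finset.mem_product, Finset.mem_Icc] at hp
      have e1 : (1 : ℝ) ≤ p.1 := by exact_mod_cast hp.1.1
      have e2 : (1 : ℝ) ≤ p.2 := by exact_mod_cast hp.2.1
      nlinarith
    · intro p _ r _ hpr
      refine Set.disjoint_left.2 fun e h1 h2 => hpr ?_
      simp only [Set.mem_ofPred_eq] at h1 h2
      rw [h1] at h2
      simp only [Prod.mk.injEq] at h2
      ext <;> omega
  have hAd : DependsOn (· ∈ A) (edgesIn (-K) K) := by
    intro W W' hW
    simp only [hA, Set.mem_iInter, eq_iff_iff]
    refine forall_congr' fun p => forall_congr' fun hp => iff_of_eq (hdep _ _ (hlt p hp) _ _ ?_ hW)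
    simp only [Finset.mem_product, Finset.mem_Icc] at hp
    constructor <;> simp only <;> omega
  have hFd : DependsOn (· ∈ Fᶜ) (edgesIn (-K) K)ᶜ := by
    intro W W' hW
    simp only [hF, Set.mem_compl_iff, Set.mem_ofPred_eq, eq_iff_iff]
    refine not_congr (exists_congr fun j => exists_congr fun i => and_congr_right fun hj =>
      and_congr_right fun hi => and_congr_right fun hK =>
        iff_of_eq (hdep (-j) i (by omega) _ (edgesIn (-K) K)ᶜ ?_ hW))
    rintro ⟨h1, h2⟩
    simp only at h1 h2
    omega
  have hFlt : weightLaw ν F < 1 := by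
    refine lt_of_le_of_lt ?_ hK
    have hsub : F ⊆ ⋃ k : ℕ, ⋃ j ∈ Finset.range (K + k), {W |
        W.weights (-(j : ℤ)) ((K + k : ℕ) - j) ∈ Ici ((c * (K + k : ℕ) : ℝ) : EReal)} := by
      rintro W ⟨j, i, hj, hi, hK, h⟩
      obtain ⟨k, hk⟩ : ∃ k, j + i = K + k := ⟨j + i - K, by omega⟩
      refine Set.mem_iUnion.2 ⟨k, Set.mem_iUnion₂.2 ⟨j, Finset.mem_range.2 (by omega), ?_⟩⟩
      rw [Set.mem_ofPred_eq, ← hk]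
      push_cast
      rw [add_sub_cancel_left]
      exact h
    refine (measure_mono hsub).trans ((measure_iUnion_le _).trans (ENNReal.tsum_le_tsum fun k => ?_))
    refine (measure_biUnion_finset_le _ _).trans (le_of_eq ?_)
    rw [Finset.sum_congr rfl fun j hj => weightLaw_edge (ν := ν)
      (by have := Finset.mem_range.1 hj; omega) measurableSet_Ici, Finset.sum_const,
      Finset.card_range, nsmul_eq_mul]
  have hpos : 0 < weightLaw ν (A ∩ Fᶜ) := by
    rw [measure_inter_of_dependsOn hmA hmF.compl hAd hFd disjoint_compl_right]
    refine ENNReal.mul_pos hApos.ne' ?_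
    rw [prob_compl_eq_one_sub hmF]
    exact (tsub_pos_of_lt hFlt).ne'
  refine hpos.trans_le (measure_mono ?_)
  rintro W ⟨hW1, hW2⟩ i j hi hj
  rw [zero_sub, zero_add]
  by_cases h : K < j ∨ K < i
  · by_contra hcon
    exact hW2 ⟨j, i, hj, hi, h, not_lt.1 hcon⟩
  · push Not at h
    simp only [hA, Set.mem_iInter] at hW1
    exact hW1 (j, i) (Finset.mem_product.2 ⟨Finset.mem_Icc.2 ⟨hj, h.1⟩, Finset.mem_Icc.2 ⟨hi, h.2⟩⟩)

/-- `x` is a renewal vertex. -/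
def renewalEvent (c₁ c₂ : ℝ) (x : ℤ) : Set EdgeConfig := {W | x ∈ renewalSet W.weights c₁ c₂}

lemma measure_renewalEvent (c₁ c₂ : ℝ) (x : ℤ) :
    weightLaw ν (renewalEvent c₁ c₂ x) = weightLaw ν (renewalEvent c₁ c₂ 0) := by
  rw [← (measurePreserving_shift (ν := ν) x).measure_preimage
    (s := renewalEvent c₁ c₂ 0) (measurableSet_renewalSet c₁ c₂ 0).nullMeasurableSet]
  congr 1
  ext W
  simp only [renewalEvent, Set.mem_preimage, Set.mem_ofPred_eq, weights_shift,
    mem_renewalSet_shiftConfig, zero_add]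

/-- The three conditions involve edges ending at or before 0, straddling 0, and starting at or after
0, so they are independent. Reflection equates the left and right probabilities. -/
lemma measure_renewalEvent_pos {c₁ c₂ : ℝ} (h1 : 0 < weightLaw ν {W | RightEvent W.weights c₁ 0})
    (h2 : 0 < weightLaw ν {W | CrossEvent W.weights c₂ 0}) :
    0 < weightLaw ν (renewalEvent c₁ c₂ 0) := by
  have e : renewalEvent c₁ c₂ 0 = {W | LeftEvent W.weights c₁ 0} ∩
      ({W | CrossEvent W.weights c₂ 0} ∩ {W | RightEvent W.weights c₁ 0}) := by
    ext W; rfl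
  rw [e, measure_inter_of_dependsOn (measurableSet_leftEvent _ _)
    ((measurableSet_crossEvent _ _).inter (measurableSet_rightEvent _ _))
    (dependsOn_leftEvent c₁ 0) (T := (edgesLE 0)ᶜ) _ disjoint_compl_right,
    measure_inter_of_dependsOn (measurableSet_crossEvent _ _) (measurableSet_rightEvent _ _)
    (dependsOn_crossEvent c₂ 0) (dependsOn_rightEvent c₁ 0), measure_leftEvent]
  · exact ENNReal.mul_pos h1.ne' (ENNReal.mul_pos h2.ne' h1.ne').ne'
  · refine Set.disjoint_left.2 fun e h1 h2 => ?_
    simp only [edgesGE, Set.mem_ofPred_eq] at h1 h2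
    omega
  · intro W W' hW
    have k1 := iff_of_eq (dependsOn_crossEvent c₂ 0
      (show ∀ e ∈ {e : Edge | e.1.1 < 0 ∧ 0 < e.1.2}, W e = W' e from fun e he => hW e fun h => by
        simp only [edgesLE, Set.mem_ofPred_eq] at h he; omega))
    have k2 := iff_of_eq (dependsOn_rightEvent c₁ 0
      (show ∀ e ∈ edgesGE 0, W e = W' e from fun e he => hW e fun h => by
        have := e.2
        simp only [edgesLE, edgesGE, Set.mem_ofPred_eq] at h he; omega))
    simp only [Set.mem_inter_iff, k1, k2]

/-! ### Abundance of renewal vertices -/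

/-- The maximal weight of an interval is too small, or the edge joining its ends is too heavy. -/
def badInterval (c₁ c₂ : ℝ) (a b : ℤ) : Set EdgeConfig :=
  {W | maxWeight W.weights a b < ((c₁ * ((b - a : ℤ) : ℝ) : ℝ) : EReal)} ∪
    {W | ((c₂ * ((b - a : ℤ) : ℝ) : ℝ) : EReal) ≤ W.weights a b}

lemma localBad_badInterval {c₁ c₂ : ℝ}
    (htail : ExpDecay fun n =>
      weightLaw ν {W | maxWeight W.weights 0 n < ((c₁ * n : ℝ) : EReal)})
    (hq : ExpDecay fun n => ν (Ici ((c₂ * n : ℝ) : EReal))) :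
    LocalBad ν (badInterval c₁ c₂) where
  measurable a b _ := (measurableSet_lt (measurable_maxWeight _ _) measurable_const).union
    (measurableSet_le measurable_const (measurable_weights _ _))
  dependsOn a b h W W' hW := by
    have e1 := dependsOn_maxWeight a b hW
    have e2 := dependsOn_weights h (S := edgesIn a b) ⟨le_rfl, le_rfl⟩ hW
    simp only at e1 e2
    simp only [badInterval, Set.mem_union, Set.mem_ofPred_eq, e1, e2]
  decay := by
    refine ⟨_, htail.add hq, fun a n hn => (measure_union_le _ _).trans (add_le_add ?_ ?_)⟩
    · have := (measurePreserving_shift (ν := ν) a).measure_preimage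
        (measurableSet_lt (measurable_maxWeight 0 n)
        (measurable_const (a := ((c₁ * n : ℝ) : EReal)))).nullMeasurableSet
      refine le_trans (measure_mono fun W hW => ?_) this.le
      simp only [Set.mem_preimage, Set.mem_ofPred_eq, weights_shift, maxWeight_shiftConfig] at hW ⊢
      rw [zero_add, add_comm _ a]
      simpa using hW
    · have e : a + (n : ℤ) - a = n := by ring
      rw [e, Int.cast_natCast]
      exact (weightLaw_edge (ν := ν) (by omega) measurableSet_Ici).le

/-- The conditions of a renewal vertex at distances at most `m`. -/
def localRenewalEvent (c₁ c₂ : ℝ) (m : ℕ) (x : ℤ) : Set EdgeConfig :=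
  {W | (∀ j : ℕ, 1 ≤ j → j ≤ m → ((c₁ * j : ℝ) : EReal) ≤ maxWeight W.weights (x - j) x) ∧
    (∀ i j : ℕ, 1 ≤ i → 1 ≤ j → i ≤ m → j ≤ m →
      W.weights (x - j) (x + i) < ((c₂ * (j + i) : ℝ) : EReal)) ∧
    ∀ i : ℕ, 1 ≤ i → i ≤ m → ((c₁ * i : ℝ) : EReal) ≤ maxWeight W.weights x (x + i)}

lemma measurableSet_localRenewalEvent (c₁ c₂ : ℝ) (m : ℕ) (x : ℤ) :
    MeasurableSet (localRenewalEvent c₁ c₂ m x) := by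
  simp only [localRenewalEvent, measurableSet_setOfPred]
  refine (Measurable.forall fun j => measurable_const.imp (measurable_const.imp ?_)).and
    ((Measurable.forall fun i => Measurable.forall fun j => measurable_const.imp
      (measurable_const.imp (measurable_const.imp (measurable_const.imp ?_)))).and
    (Measurable.forall fun j => measurable_const.imp (measurable_const.imp ?_)))
  · exact measurableSet_setOfPred.1 (measurableSet_le measurable_const (measurable_maxWeight _ _))
  · exact measurableSet_setOfPred.1 (measurableSet_lt (measurable_weights _ _) measurable_const)
  · exact measurableSet_setOfPred.1 (measurableSet_le measurable_const (measurable_maxWeight _ _))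

lemma dependsOn_localRenewalEvent (c₁ c₂ : ℝ) (m : ℕ) (x : ℤ) :
    DependsOn (· ∈ localRenewalEvent c₁ c₂ m x) (edgesNear m x) := by
  intro W W' hW
  have h := agreeOn_weights hW
  simp only [localRenewalEvent, Set.mem_ofPred_eq, eq_iff_iff]
  refine and_congr (forall_congr' fun j => forall_congr' fun h1 => forall_congr' fun h2 => ?_)
    (and_congr (forall_congr' fun i => forall_congr' fun j => forall_congr' fun h1 =>
      forall_congr' fun h2 => forall_congr' fun h3 => forall_congr' fun h4 => ?_)
      (forall_congr' fun j => forall_congr' fun h1 => forall_congr' fun h2 => ?_))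
  · rw [maxWeight_congr (h.mono (a' := x - j) (b' := x) (by omega) (by omega))]
  · rw [h (x - j) (x + i) (by omega) (by omega) (by omega)]
  · rw [maxWeight_congr (h.mono (a' := x) (b' := x + j) (by omega) (by omega))]

lemma renewalEvent_subset_local (c₁ c₂ : ℝ) (m : ℕ) (x : ℤ) :
    renewalEvent c₁ c₂ x ⊆ localRenewalEvent c₁ c₂ m x := by
  rintro W ⟨h1, h2, h3⟩
  exact ⟨fun j hj _ => h1 j hj, fun i j hi hj _ _ => h2 i j hi hj, fun i hi _ => h3 i hi⟩

/-- A condition failing at a distance greater than m exhibits a bad interval that contains x and is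
longer than m. -/
lemma mem_renewalEvent_of_local {c₁ c₂ : ℝ} {m : ℕ} {x : ℤ} {W : EdgeConfig}
    (h : W ∈ localRenewalEvent c₁ c₂ m x) (hx : x ∉ badCover (badInterval c₁ c₂) m W) :
    W ∈ renewalEvent c₁ c₂ x := by
  obtain ⟨h1, h2, h3⟩ := h
  refine ⟨fun j hj => ?_, fun i j hi hj => ?_, fun i hi => ?_⟩
  · by_cases hm : j ≤ m
    · exact h1 j hj hm
    · by_contra hc
      refine hx ⟨x - j, x, by omega, by omega, le_rfl, by omega, Or.inl ?_⟩
      simpa using hc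
  · by_cases hm : i ≤ m ∧ j ≤ m
    · exact h2 i j hi hj hm.1 hm.2
    · by_contra hc
      refine hx ⟨x - j, x + i, by omega, by omega, by omega, by omega, Or.inr ?_⟩
      rw [not_lt] at hc
      rw [Set.mem_ofPred_eq, show x + (i : ℤ) - (x - j) = j + i by ring]
      exact_mod_cast hc
  · by_cases hm : i ≤ m
    · exact h3 i hi hm
    · by_contra hc
      refine hx ⟨x, x + i, by omega, le_rfl, by omega, by omega, Or.inl ?_⟩
      simpa using hc

open Classical in
theorem expDecay_card_renewalEvent {c₁ c₂ : ℝ}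
    (htail : ExpDecay fun n =>
      weightLaw ν {W | maxWeight W.weights 0 n < ((c₁ * n : ℝ) : EReal)})
    (hq : ExpDecay fun n => ν (Ici ((c₂ * n : ℝ) : EReal)))
    (hpos : 0 < weightLaw ν (renewalEvent c₁ c₂ 0)) :
    ExpDecay fun n => weightLaw ν
      {W | ((Finset.range n).filter fun i : ℕ => W ∈ renewalEvent c₁ c₂ i).card ≤ 1} :=
  (localBad_badInterval htail hq).expDecay_card_good_le_one
    (measurableSet_localRenewalEvent c₁ c₂) (dependsOn_localRenewalEvent c₁ c₂) hpos
    (fun m x => (measure_renewalEvent c₁ c₂ x).ge.trans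
      (measure_mono (renewalEvent_subset_local c₁ c₂ m x)))
    fun _ _ _ => mem_renewalEvent_of_local

end WeightedLineGraph

end

noncomputable section

namespace WeightedLineGraph

open scoped NNReal

variable {ν : Measure EReal} [IsProbabilityMeasure ν]

/-! ### Exponential moments of the maximal weight -/

/-- `exp (C v⁺)` for the weight `v` of the edge `(a, b)`. -/
def edgeExp (C : ℝ) (a b : ℤ) (W : EdgeConfig) : ℝ≥0∞ :=
  EReal.exp ((C : EReal) * max (W.weights a b) 0)

lemma measurable_edgeExp (C : ℝ) (a b : ℤ) : Measurable (edgeExp C a b) :=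
  EReal.measurable_exp.comp (((measurable_weights a b).max measurable_const).const_mul _)

/-- The exponential turns the weight of the path into a product over its edges, which is dominated
by one term of the sum over paths. -/
lemma WalkWeight.exp_le_pathSum {C : ℝ} (hC : 0 < C) {W : EdgeConfig} {a b : ℤ} {r : EReal}
    (h : WalkWeight W.weights a b r) :
    EReal.exp (C * r) ≤ pathSum (fun j k => edgeExp C j k W) a (b - a).toNat := by
  induction h with
  | nil => simp [pathSum]
  | @snoc b c r h hbc ih =>
    have hab := h.le
    rw [EReal.left_distrib_of_nonneg_of_ne_top (by exact_mod_cast hC.le) (EReal.coe_ne_top _),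
      EReal.exp_add]
    refine le_trans (mul_le_mul' ih ?_) (pathSum_mul_le _ a (k := (b - a).toNat) (by omega))
    rw [edgeExp, show a + ((b - a).toNat : ℤ) = b by omega,
      show a + ((c - a).toNat : ℤ) = c by omega]
    exact EReal.exp_monotone (mul_le_mul_of_nonneg_left (le_max_left _ _) (by exact_mod_cast hC.le))

/-- Rewritten as w ≤ (log Z)/C, the bound passes from single paths to their supremum. -/
lemma exp_maxWeight_le_pathSum {C : ℝ} (hC : 0 < C) (W : EdgeConfig) (a : ℤ) (n : ℕ) :
    EReal.exp (C * maxWeight W.weights a (a + n)) ≤ pathSum (fun j k => edgeExp C j k W) a n := by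
  set Z := pathSum (fun j k => edgeExp C j k W) a n with hZ
  have hC' : (C : EReal) > 0 := by exact_mod_cast hC
  rw [← ENNReal.log_le_log_iff, EReal.log_exp, mul_comm,
    ← EReal.le_div_iff_mul_le hC' (EReal.coe_ne_top _)]
  refine maxWeight_le fun s hs => ?_
  rw [EReal.le_div_iff_mul_le hC' (EReal.coe_ne_top _), mul_comm, ← EReal.log_exp (C * s),
    ENNReal.log_le_log_iff]
  simpa using hs.exp_le_pathSum hC

lemma lintegral_exp_maxWeight_le {C : ℝ} (hC : 0 < C) (a : ℤ) (n : ℕ) :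
    ∫⁻ W, EReal.exp (C * maxWeight (EdgeConfig.weights W) a (a + n)) ∂weightLaw ν ≤
      (1 + ∫⁻ x, EReal.exp (C * max x 0) ∂ν) ^ n := by
  set M := ∫⁻ x, EReal.exp (C * max x 0) ∂ν with hM
  refine (lintegral_mono fun W => exp_maxWeight_le_pathSum hC W a n).trans ?_
  refine lintegral_pathSum_le (fun j k _ => measurable_edgeExp C j k) (fun j k hjk W W' hW => ?_)
    (g := fun _ => M) (fun j k hk => ?_) (fun k => ?_) a n
  · rw [edgeExp, edgeExp, agreeOn_weights hW j k le_rfl hjk le_rfl]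
  · exact (lintegral_edge (ν := ν) (j := j) (k := j + k) (by omega)
      (f := fun x => EReal.exp (C * max x 0))
      (EReal.measurable_exp.comp ((measurable_id.max measurable_const).const_mul _))).le
  · rw [Fin.sum_univ_eq_sum_range (fun i => (1 + M) ^ i * M)]
    -- The geometric sum makes (1 + M)^n a supersolution when every edge factor has mean M.
    have : ∀ m, ∑ i ∈ Finset.range m, (1 + M) ^ i * M + 1 = (1 + M) ^ m := by
      intro m
      induction m with
      | zero => simp
      | succ m ih => rw [Finset.sum_range_succ, pow_succ, mul_add, mul_one, ← ih]; ring
    rw [← this]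
    exact le_self_add

lemma exp_mul_mul_eq_rpow {ε C : ℝ} (w : EReal) :
    EReal.exp (((ε * C : ℝ) : EReal) * w) = EReal.exp (C * w) ^ ε := by
  rw [EReal.coe_mul, mul_assoc, mul_comm, EReal.exp_mul]

/-- Take ε = 1/n with n ≥ 2. Then ρ^{1-ε} ≤ σ = ρ^{1/2}, and the n-th power of r^ε σ is r σ^n, which
is less than 1 for large n. -/
lemma exists_rpow_mul_rpow_lt_one {r ρ : ℝ≥0} (hρ0 : 0 < ρ) (hρ : ρ < 1) :
    ∃ ε : ℝ, 0 < ε ∧ ε < 1 ∧ r ^ ε * ρ ^ (1 - ε) < 1 := by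
  set σ := ρ ^ (2⁻¹ : ℝ) with hσ
  have hσ1 : σ < 1 := NNReal.rpow_lt_one hρ (by norm_num)
  have hσ0 : 0 < σ := NNReal.rpow_pos hρ0
  have hlim : Filter.Tendsto (fun n : ℕ => r * σ ^ n) Filter.atTop (nhds 0) := by
    simpa using (NNReal.tendsto_pow_atTop_nhds_zero_of_lt_one hσ1).const_mul r
  obtain ⟨n, hn, hn2⟩ := ((hlim.eventually (gt_mem_nhds zero_lt_one)).and
    (Filter.eventually_ge_atTop 2)).exists
  have hn2' : (2 : ℝ) ≤ n := by exact_mod_cast hn2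
  have hε : (n : ℝ)⁻¹ ≤ 2⁻¹ := inv_anti₀ (by norm_num) hn2'
  refine ⟨(n : ℝ)⁻¹, by positivity, hε.trans_lt (by norm_num), ?_⟩
  have h1 : r ^ (n : ℝ)⁻¹ * ρ ^ (1 - (n : ℝ)⁻¹) ≤ r ^ (n : ℝ)⁻¹ * σ :=
    mul_le_mul_right (NNReal.rpow_le_rpow_of_exponent_ge hρ0 hρ.le (by linarith)) _
  refine h1.trans_lt (lt_of_pow_lt_pow_left₀ n zero_le ?_)
  rw [mul_pow, one_pow, NNReal.rpow_inv_natCast_pow _ (by omega)]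
  exact hn

/-- If the moments of `X k l` grow at most exponentially in `l` and the probabilities of `D l` decay
exponentially, then the sum of small powers of `X k l` on `D l` is integrable. -/
theorem exists_lintegral_tsum_rpow_ne_top {α : Type*} [MeasurableSpace α] {μ : Measure α}
    {X : ℕ → ℕ → α → ℝ≥0∞} (hX : ∀ k l, Measurable (X k l)) {r : ℝ≥0∞} (hr : r ≠ ∞)
    (hXr : ∀ k l, k ≤ l → ∫⁻ W, X k l W ∂μ ≤ r ^ l) {D : ℕ → Set α}
    (hDm : ∀ l, MeasurableSet (D l)) (hD : ExpDecay fun n => μ (D n)) :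
    ∃ ε : ℝ, 0 < ε ∧ ∫⁻ W, ∑' l : ℕ, ∑ k ∈ Finset.range (l + 1),
      X k l W ^ ε * (D l).indicator 1 W ∂μ ≠ ∞ := by
  obtain ⟨A, ρ, hρ0, hρ1, hDρ⟩ := hD
  lift r to ℝ≥0 using hr
  obtain ⟨ε, hε0, hε1, hερ⟩ := exists_rpow_mul_rpow_lt_one (r := r) hρ0 hρ1
  refine ⟨ε, hε0, ?_⟩
  have hterm : ∀ k l, k ≤ l → ∫⁻ W, X k l W ^ ε * (D l).indicator 1 W ∂μ ≤
      (A : ℝ≥0∞) ^ (1 - ε) * ((r ^ ε * ρ ^ (1 - ε) : ℝ≥0) : ℝ≥0∞) ^ l := by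
    intro k l hkl
    -- An indicator equals its power 1-ε, so Hölder's inequality with exponents 1/ε and 1/(1-ε)
    -- bounds the term by (E X)^ε P(D)^{1-ε}.
    have e : ∀ W, X k l W ^ ε * (D l).indicator (1 : α → ℝ≥0∞) W =
        X k l W ^ ε * (D l).indicator (1 : α → ℝ≥0∞) W ^ (1 - ε) := by
      intro W
      by_cases h : W ∈ D l
      · simp [h]
      · rw [Set.indicator_of_notMem h, ENNReal.zero_rpow_of_pos (by linarith)]
    simp only [e]
    refine (ENNReal.lintegral_mul_norm_pow_le (hX k l).aemeasurable
      (measurable_one.indicator (hDm l)).aemeasurable hε0.le (by linarith) (by ring)).trans ?_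
    rw [lintegral_indicator_one (hDm l)]
    calc (∫⁻ W, X k l W ∂μ) ^ ε * μ (D l) ^ (1 - ε)
        ≤ ((r : ℝ≥0∞) ^ l) ^ ε * (A * (ρ : ℝ≥0∞) ^ l) ^ (1 - ε) :=
          mul_le_mul' (ENNReal.rpow_le_rpow (hXr k l hkl) hε0.le)
            (ENNReal.rpow_le_rpow (hDρ l) (by linarith))
      _ = _ := by
          rw [ENNReal.mul_rpow_of_nonneg _ _ (by linarith), ENNReal.coe_mul,
            ENNReal.coe_rpow_of_nonneg _ hε0.le, ENNReal.coe_rpow_of_nonneg _ (by linarith), mul_pow,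
            ← ENNReal.rpow_natCast, ← ENNReal.rpow_natCast, ← ENNReal.rpow_natCast,
            ← ENNReal.rpow_natCast, ← ENNReal.rpow_mul, ← ENNReal.rpow_mul, ← ENNReal.rpow_mul,
            ← ENNReal.rpow_mul, mul_comm (l : ℝ) ε, mul_comm (l : ℝ) (1 - ε)]
          ring
  have hm : ∀ k l, Measurable fun W => X k l W ^ ε * (D l).indicator (1 : α → ℝ≥0∞) W := fun k l =>
    ((hX k l).pow_const _).mul (measurable_one.indicator (hDm l))
  rw [lintegral_tsum fun l => (Finset.measurable_fun_sum _ fun k _ => hm k l).aemeasurable]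
  have hgeo : ExpDecay fun l => (A : ℝ≥0∞) ^ (1 - ε) *
      ((r ^ ε * ρ ^ (1 - ε) : ℝ≥0) : ℝ≥0∞) ^ l :=
    (ExpDecay.pow (by exact_mod_cast hερ)).const_mul
      (ENNReal.rpow_ne_top_of_nonneg (by linarith) (by simp))
  refine ne_top_of_le_ne_top (hgeo.nat_mul.add hgeo).tsum_ne_top (ENNReal.tsum_le_tsum fun l => ?_)
  rw [lintegral_finsetSum _ fun k _ => hm k l]
  refine (Finset.sum_le_sum fun k hk => hterm k l
    (Nat.lt_succ_iff.1 (Finset.mem_range.1 hk))).trans (le_of_eq ?_)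
  rw [Finset.sum_const, Finset.card_range, nsmul_eq_mul]
  push_cast
  ring

open Classical in
/-- Renewal vertices on the canonical space: there are two of them, and the exponentials of the
weights up to the first one and between the first two are dominated by an integrable function. -/
theorem exists_integrable_bound {c₁ c₂ C : ℝ} (hC : 0 < C)
    (hM : ∫⁻ x, EReal.exp (C * max x 0) ∂ν ≠ ∞)
    (hren : ExpDecay fun n => weightLaw ν
      {W | ((Finset.range n).filter fun i : ℕ => W ∈ renewalEvent c₁ c₂ i).card ≤ 1}) :
    ∃ C' : ℝ, 0 < C' ∧ ∃ H : EdgeConfig → ℝ≥0∞, Measurable H ∧ ∫⁻ W, H W ∂weightLaw ν ≠ ∞ ∧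
      ∀ W, (∃ x ∈ renewalSet W.weights c₁ c₂, ∃ y ∈ renewalSet W.weights c₁ c₂, 0 ≤ x ∧ x < y) →
        EReal.exp (C' * maxWeight W.weights 0 (firstPoint (renewalSet W.weights c₁ c₂))) ≤ H W ∧
        EReal.exp (C' * maxWeight W.weights (firstPoint (renewalSet W.weights c₁ c₂))
          (secondPoint (renewalSet W.weights c₁ c₂))) ≤ H W := by
  -- A measurable hull has the same measure, and only membership in it is needed below.
  set D : ℕ → Set EdgeConfig := fun n => toMeasurable (weightLaw ν)
    {W | ((Finset.range n).filter fun i : ℕ => W ∈ renewalEvent c₁ c₂ i).card ≤ 1} with hD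
  set X : ℕ → ℕ → EdgeConfig → ℝ≥0∞ := fun k l W =>
    EReal.exp (C * maxWeight W.weights k l) with hX
  have hXm : ∀ k l, Measurable (X k l) := fun k l =>
    EReal.measurable_exp.comp ((measurable_maxWeight _ _).const_mul _)
  have hDm : ∀ l, MeasurableSet (D l) := fun l => measurableSet_toMeasurable _ _
  obtain ⟨ε, hε, hfin⟩ := exists_lintegral_tsum_rpow_ne_top (μ := weightLaw ν) hXm
    (r := 1 + ∫⁻ x, EReal.exp (C * max x 0) ∂ν) (ENNReal.add_ne_top.2 ⟨by simp, hM⟩)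
    (fun k l hkl => by
      obtain ⟨n, rfl⟩ := Nat.exists_eq_add_of_le hkl
      have := lintegral_exp_maxWeight_le (ν := ν) hC k n
      simp only [hX]
      push_cast
      refine this.trans (pow_le_pow_right₀ le_self_add (by omega)))
    hDm (by simpa only [hD, measure_toMeasurable] using hren)
  refine ⟨ε * C, mul_pos hε hC, _, Measurable.tsum fun l => Finset.measurable_fun_sum _ fun k _ =>
    ((hXm k l).pow_const ε).mul (measurable_one.indicator (hDm l)), hfin, fun W hW => ?_⟩
  have key : ∀ k l : ℕ, k ≤ l → W ∈ D l →
      EReal.exp (((ε * C : ℝ) : EReal) * maxWeight W.weights k l) ≤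
        ∑' l : ℕ, ∑ k ∈ Finset.range (l + 1), X k l W ^ ε * (D l).indicator 1 W := by
    intro k l hkl hWl
    refine le_trans ?_ (ENNReal.le_tsum l)
    refine le_trans ?_ (Finset.single_le_sum
      (f := fun k => X k l W ^ ε * (D l).indicator (1 : EdgeConfig → ℝ≥0∞) W)
      (fun _ _ => zero_le) (Finset.mem_range.2 (Nat.lt_succ_iff.2 hkl)))
    rw [exp_mul_mul_eq_rpow, Set.indicator_of_mem hWl, Pi.one_apply, mul_one]
  obtain ⟨h1, h2⟩ := isLeast_secondPoint hW
  obtain ⟨x, hx, -, -, hx0, -⟩ := hW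
  obtain ⟨h3, h4⟩ := isLeast_firstPoint ⟨x, hx, hx0⟩
  set g := firstPoint (renewalSet W.weights c₁ c₂) with hg
  set g' := secondPoint (renewalSet W.weights c₁ c₂) with hg'
  obtain ⟨k, hk⟩ : ∃ k : ℕ, g = k := ⟨g.toNat, (Int.toNat_of_nonneg h3.2).symm⟩
  have hlt : g < g' := h1.2
  obtain ⟨l, hl⟩ : ∃ l : ℕ, g' = l := ⟨g'.toNat, by omega⟩
  have hWk : W ∈ D k := by
    refine subset_toMeasurable _ _ ?_
    rw [Set.mem_ofPred_eq, Finset.filter_false_of_mem fun i hi hc => ?_]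
    · simp
    · have : g ≤ i := h4 ⟨hc, by omega⟩
      have := Finset.mem_range.1 hi
      omega
  -- Here Γ₀ = k and Γ₁ = l, so Γ₀ is the only renewal vertex in [0,l). The same events thus control
  -- both Γ₀ and Γ₁.
  have hWl : W ∈ D l := by
    refine subset_toMeasurable _ _ ?_
    refine Finset.card_le_one.2 fun i hi j hj => ?_
    have aux : ∀ i ∈ (Finset.range l).filter (fun i : ℕ => W ∈ renewalEvent c₁ c₂ i), i = k := by
      intro i hi
      obtain ⟨hil, hiW⟩ := Finset.mem_filter.1 hi
      have hil := Finset.mem_range.1 hil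
      have e1 : g ≤ i := h4 ⟨hiW, by omega⟩
      by_contra hne
      have e2 : g' ≤ i := h2 ⟨hiW, by omega⟩
      omega
    rw [aux i hi, aux j hj]
  constructor
  · have := key 0 k (Nat.zero_le _) hWk
    rw [hk]
    exact_mod_cast this
  · have := key k l (by omega) hWl
    rwa [hk, hl]

end WeightedLineGraph

end

noncomputable section

namespace WeightedLineGraph

open scoped NNReal

variable {ν : Measure EReal} [IsProbabilityMeasure ν]

/-! ### The density of the skeleton is positive -/

lemma measure_forall_edge_nonpos (k : ℕ) :
    weightLaw ν {W | ∀ i : ℕ, i < k → W.weights i k ≤ 0} = ν (Iic 0) ^ k := by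
  have e : {W : EdgeConfig | ∀ i : ℕ, i < k → W.weights i k ≤ 0} =
      ⋂ i ∈ Finset.range k, {W : EdgeConfig | W.weights (i : ℕ) k ∈ Iic 0} := by
    ext W
    simp
  have hm : ∀ (a b : ℤ), MeasurableSet {W : EdgeConfig | W.weights a b ∈ Iic 0} := fun a b =>
    measurable_weights a b measurableSet_Iic
  rw [e, measure_biInter_of_dependsOn _ (fun i _ => hm (i : ℕ) k)
    (T := fun i => {e : Edge | e.1 = ((i : ℤ), (k : ℤ))})]
  · rw [Finset.prod_congr rfl fun i hi => weightLaw_edge (ν := ν)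
      (by have := Finset.mem_range.1 hi; omega) measurableSet_Iic, Finset.prod_const,
      Finset.card_range]
  · intro i hi W W' hW
    have := dependsOn_weights (j := i) (k := k) (by have := Finset.mem_range.1 hi; omega)
      (S := {e : Edge | e.1 = ((i : ℤ), (k : ℤ))}) rfl hW
    simp only at this
    simp only [Set.mem_ofPred_eq, this]
  · intro i _ j _ hij
    refine Set.disjoint_left.2 fun e h1 h2 => hij ?_
    simp only [Set.mem_ofPred_eq] at h1 h2
    rw [h1] at h2
    simpa using h2

lemma mem_rightConn_of_exists {W : EdgeConfig} (h : ∀ k : ℕ, 1 ≤ k → ∃ i : ℕ, i < k ∧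
    0 < W.weights i k) : W ∈ rightConn 0 := by
  have key : ∀ k : ℕ, Conn W.weights 0 k := by
    intro k
    induction k using Nat.strong_induction_on with
    | _ k ih =>
      rcases Nat.eq_zero_or_pos k with rfl | hk
      · exact Conn.refl _
      · obtain ⟨i, hi, hpos⟩ := h k hk
        exact (ih i hi).trans (Conn.of_pos (by exact_mod_cast hi) hpos)
  intro k hk
  obtain ⟨n, rfl⟩ := Int.eq_ofNat_of_zero_le hk.le
  exact key n

/-- It suffices that each k ≥ 1 receives a positive edge from [0,k), which fails with probability
ν(Iic 0)^k. These probabilities have a tail sum below 1 from N on, and up to N the edges (i, i+1)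
are prescribed to be positive; the two requirements are independent. -/
lemma measure_rightConn_pos (hp : 0 < ν (Ioi 0)) : 0 < weightLaw ν (rightConn 0) := by
  have hq : ν (Iic 0) < 1 := by
    rw [← compl_Ioi, prob_compl_eq_one_sub measurableSet_Ioi]
    exact ENNReal.sub_lt_self ENNReal.one_ne_top one_ne_zero hp.ne'
  obtain ⟨N, hN⟩ := ((ExpDecay.pow hq).tail.tendsto.eventually (gt_mem_nhds zero_lt_one)).exists
  set A : Set EdgeConfig := ⋂ i ∈ Finset.range N,
    {W | W.weights (i : ℕ) ((i : ℕ) + 1) ∈ Ioi 0} with hA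
  set F : Set EdgeConfig := {W | ∃ k : ℕ, N ≤ k ∧ ∀ i : ℕ, i < k → W.weights i k ≤ 0} with hF
  have hm : ∀ (a b : ℤ), MeasurableSet {W : EdgeConfig | W.weights a b ∈ Ioi 0} := fun a b =>
    measurable_weights a b measurableSet_Ioi
  have hApos : 0 < weightLaw ν A := by
    rw [hA, measure_biInter_of_dependsOn _ (fun i _ => hm (i : ℕ) ((i : ℕ) + 1))
      (T := fun i => {e : Edge | e.1 = ((i : ℤ), (i : ℤ) + 1)})]
    · rw [Finset.prod_congr rfl fun i _ => weightLaw_edge (ν := ν) (lt_add_one _)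
        measurableSet_Ioi, Finset.prod_const]
      exact pos_iff_ne_zero.2 (pow_ne_zero _ hp.ne')
    · intro i _ W W' hW
      have := dependsOn_weights (lt_add_one (i : ℤ))
        (S := {e : Edge | e.1 = ((i : ℤ), (i : ℤ) + 1)}) rfl hW
      simp only at this
      simp only [Set.mem_ofPred_eq, this]
    · intro i _ j _ hij
      refine Set.disjoint_left.2 fun e h1 h2 => hij ?_
      simp only [Set.mem_ofPred_eq] at h1 h2
      rw [h1] at h2
      simpa using h2
  have hmA : MeasurableSet A := Finset.measurableSet_biInter _ fun i _ =>
    measurable_weights _ _ measurableSet_Ioi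
  have hmF : MeasurableSet F := by
    simp only [hF, measurableSet_setOfPred]
    exact Measurable.exists fun k => measurable_const.and (Measurable.forall fun i =>
      measurable_const.imp (measurableSet_setOfPred.1 (measurable_weights _ _ measurableSet_Iic)))
  have hFlt : weightLaw ν F < 1 := by
    refine lt_of_le_of_lt ?_ hN
    have hsub : F ⊆ ⋃ k : ℕ, {W | ∀ i : ℕ, i < N + k → W.weights i (N + k : ℕ) ≤ 0} := by
      rintro W ⟨k, hk, h⟩
      obtain ⟨l, rfl⟩ := Nat.exists_eq_add_of_le hk
      exact Set.mem_iUnion.2 ⟨l, h⟩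
    refine (measure_mono hsub).trans ((measure_iUnion_le _).trans (le_of_eq ?_))
    exact tsum_congr fun k => measure_forall_edge_nonpos _
  have hAd : DependsOn (· ∈ A) (edgesIn 0 N) := by
    intro W W' hW
    simp only [hA, Set.mem_iInter, eq_iff_iff]
    refine forall_congr' fun i => forall_congr' fun hi => ?_
    have := dependsOn_weights (lt_add_one (i : ℤ)) (S := edgesIn 0 N)
      ⟨by simp, by have := Finset.mem_range.1 hi; simp; omega⟩ hW
    simp only at this
    simp only [Set.mem_ofPred_eq, this]
  have hFd : DependsOn (· ∈ {W | ∀ k : ℕ, N < k → ∃ i : ℕ, i < k ∧ 0 < EdgeConfig.weights W i k})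
      (edgesIn 0 N)ᶜ := by
    intro W W' hW
    simp only [Set.mem_ofPred_eq, eq_iff_iff]
    refine forall_congr' fun k => forall_congr' fun hk => exists_congr fun i =>
      and_congr_right fun hi => ?_
    have := dependsOn_weights (j := i) (k := k) (by exact_mod_cast hi) (S := (edgesIn 0 N)ᶜ)
      (by rintro ⟨-, h⟩; simp only at h; omega) hW
    simp only at this
    rw [this]
  set G : Set EdgeConfig := {W | ∀ k : ℕ, N < k → ∃ i : ℕ, i < k ∧ 0 < W.weights i k} with hG
  have hmG : MeasurableSet G := by
    simp only [hG, measurableSet_setOfPred]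
    exact Measurable.forall fun k => measurable_const.imp (Measurable.exists fun i =>
      measurable_const.and (measurableSet_setOfPred.1 (measurable_weights _ _ measurableSet_Ioi)))
  have hGpos : 0 < weightLaw ν G := by
    have h : 0 < weightLaw ν Fᶜ := by
      rw [prob_compl_eq_one_sub hmF]
      exact tsub_pos_of_lt hFlt
    refine h.trans_le (measure_mono fun W hW k hk => ?_)
    by_contra! hcon
    exact hW ⟨k, hk.le, hcon⟩
  have hAG : 0 < weightLaw ν (A ∩ G) := by
    rw [measure_inter_of_dependsOn hmA hmG hAd hFd disjoint_compl_right]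
    exact ENNReal.mul_pos hApos.ne' hGpos.ne'
  refine hAG.trans_le (measure_mono fun W hW => mem_rightConn_of_exists fun k hk => ?_)
  by_cases hkN : N < k
  · exact hW.2 k hkN
  · obtain ⟨l, rfl⟩ := Nat.exists_eq_add_of_le' hk
    refine ⟨l, by omega, ?_⟩
    have := Set.mem_iInter₂.1 hW.1 l (Finset.mem_range.2 (by omega))
    exact_mod_cast this

lemma Conn.of_reflect {u : ℤ → ℤ → EReal} {a b : ℤ} (h : Conn (reflectConfig u) a b) :
    Conn u (-b) (-a) := by
  induction h with
  | refl => exact Conn.refl _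
  | @tail b c _ h ih =>
    have h1 : Conn u (-c) (-b) := Conn.of_pos (by have := h.1; omega) h.2
    exact h1.trans ih

/-- The connections to the left and to the right of 0 are independent, and reflection exchanges
them. -/
lemma measure_skelEvent_pos (hp : 0 < ν (Ioi 0)) : 0 < weightLaw ν (skelEvent 0) := by
  have h := measure_rightConn_pos hp
  have h' : 0 < weightLaw ν (leftConn 0) := by
    rw [← (measurePreserving_reflect (ν := ν)).measure_preimage
      (measurableSet_rightConn 0).nullMeasurableSet] at h
    refine h.trans_le (measure_mono fun W hW i hi => ?_)
    have := hW (-i) (by omega)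
    rw [weights_reflect] at this
    simpa using this.of_reflect
  rw [skelEvent_eq, measure_inter_of_dependsOn (measurableSet_leftConn 0)
    (measurableSet_rightConn 0) (dependsOn_leftConn 0) (dependsOn_rightConn 0)
    (disjoint_edgesLE_edgesGE 0)]
  exact ENNReal.mul_pos h'.ne' h.ne'

end WeightedLineGraph

end

noncomputable section

namespace WeightedLineGraph

open scoped NNReal

/-! ### Consequences of the conditions on the law of the weights -/

section Law

variable {ν : Measure EReal}

lemma lintegral_plusLaw (f : EReal → ℝ≥0∞) :
    ∫⁻ x, f x ∂plusLaw ν = (ν (Ioi 0))⁻¹ * ∫⁻ x in Ioi 0, f x ∂ν := by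
  rw [plusLaw, ProbabilityTheory.cond, lintegral_smul_measure, smul_eq_mul]

/-- On x > 0 the integral is the moment under `plusLaw ν` times ν(Ioi 0); elsewhere the integrand is
1. -/
lemma MainCondition.exists_exp_max [IsProbabilityMeasure ν] (hν : MainCondition ν) :
    ∃ C : ℝ, 0 < C ∧ ∫⁻ x, EReal.exp (C * max x 0) ∂ν ≠ ∞ := by
  obtain ⟨C, hC, hfin⟩ := hν.exp_moment
  refine ⟨C, hC, ?_⟩
  rw [lintegral_plusLaw] at hfin
  have hI : ∫⁻ x in Ioi 0, EReal.exp (C * x) ∂ν ≠ ∞ := by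
    intro h
    rw [h, ENNReal.mul_top (ENNReal.inv_ne_zero.2 (measure_ne_top _ _))] at hfin
    exact hfin.ne rfl
  rw [← lintegral_add_compl _ measurableSet_Ioi (A := Ioi (0 : EReal))]
  refine ENNReal.add_ne_top.2 ⟨?_, ?_⟩
  · rwa [setLIntegral_congr_fun measurableSet_Ioi
      (g := fun x => EReal.exp (C * x)) fun x hx => by rw [max_eq_left (le_of_lt hx)]]
  · rw [setLIntegral_congr_fun measurableSet_Ioi.compl
      (g := fun _ => 1) fun x hx => by
        simp only [compl_Ioi, mem_Iic] at hx
        simp [max_eq_right hx]]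
    simp

/-- Markov's inequality for exp(C max(x, 0)). -/
lemma expDecay_Ici {C c : ℝ} (hC : 0 < C) (hc : 0 < c)
    (hM : ∫⁻ x, EReal.exp (C * max x 0) ∂ν ≠ ∞) :
    ExpDecay fun n => ν (Ici ((c * n : ℝ) : EReal)) := by
  refine ((ExpDecay.exp_neg (mul_pos hC hc)).const_mul hM).mono fun n => ?_
  have hmeas : Measurable fun x : EReal => EReal.exp (C * max x 0) :=
    EReal.measurable_exp.comp ((measurable_id.max measurable_const).const_mul _)
  have hpos : (0 : ℝ) < Real.exp (C * (c * n)) := Real.exp_pos _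
  have h := mul_meas_ge_le_lintegral (μ := ν) hmeas (ENNReal.ofReal (Real.exp (C * (c * n))))
  have hsub : Ici ((c * n : ℝ) : EReal) ⊆
      {x | ENNReal.ofReal (Real.exp (C * (c * n))) ≤ EReal.exp (C * max x 0)} := by
    intro x hx
    rw [Set.mem_ofPred_eq, ← EReal.exp_coe, EReal.coe_mul]
    exact EReal.exp_monotone (mul_le_mul_of_nonneg_left (le_trans hx (le_max_left _ _))
      (by exact_mod_cast hC.le))
  rw [neg_mul, mul_assoc, Real.exp_neg, ENNReal.ofReal_inv_of_pos hpos, ← div_eq_mul_inv,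
    ENNReal.le_div_iff_mul_le (by simp [hpos]) (by simp), mul_comm]
  exact (mul_le_mul_right (measure_mono hsub) _).trans h

lemma exists_Ici_pos {c : ℝ} (h : 0 < ν (Ioi (c : EReal))) :
    ∃ η : ℝ, 0 < η ∧ 0 < ν (Ici ((c + η : ℝ) : EReal)) := by
  by_contra! hcon
  refine h.ne' ?_
  have e : Ioi (c : EReal) ⊆ ⋃ n : ℕ, Ici ((c + 1 / (n + 1) : ℝ) : EReal) := by
    intro x hx
    obtain ⟨y, hy, hyx⟩ := EReal.lt_iff_exists_real_btwn.1 hx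
    obtain ⟨n, hn⟩ := exists_nat_one_div_lt (sub_pos.2 (EReal.coe_lt_coe_iff.1 hy))
    refine Set.mem_iUnion.2 ⟨n, le_trans (EReal.coe_le_coe_iff.2 ?_) hyx.le⟩
    linarith
  refine measure_mono_null e (measure_iUnion_null fun n => ?_)
  exact le_antisymm (hcon _ (by positivity)) zero_le

lemma MainCondition.exists_plusLaw_Iio_pos [IsProbabilityMeasure ν] (hν : MainCondition ν) (htop : ν {⊤} = 0) :
    {t : ℝ | 0 < t ∧ 0 < plusLaw ν (Iio (t : EReal))}.Nonempty := by
  by_contra hcon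
  have hnull : ∀ n : ℕ, ν (Ioo 0 (((n + 1 : ℕ) : ℝ) : EReal)) = 0 := by
    intro n
    by_contra hne
    refine hcon ⟨((n + 1 : ℕ) : ℝ), by positivity, ?_⟩
    rw [plusLaw, cond_apply measurableSet_Ioi, Ioi_inter_Iio]
    exact ENNReal.mul_pos (ENNReal.inv_ne_zero.2 (measure_ne_top _ _)) hne
  refine hν.pos.ne' (measure_mono_null (t := (⋃ n : ℕ, Ioo 0 (((n + 1 : ℕ) : ℝ) : EReal)) ∪ {⊤})
    (fun x hx => ?_) (measure_union_null (measure_iUnion_null hnull) htop))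
  rcases eq_or_ne x ⊤ with rfl | hx'
  · simp
  · obtain ⟨y, hy, -⟩ := EReal.lt_iff_exists_real_btwn.1 (lt_top_iff_ne_top.2 hx')
    obtain ⟨n, hn⟩ := exists_nat_gt y
    refine Or.inl (Set.mem_iUnion.2 ⟨n, hx, hy.trans (EReal.coe_lt_coe_iff.2 (hn.trans ?_))⟩)
    push_cast
    linarith

lemma MainCondition.measure_Iio_pos [IsProbabilityMeasure ν] (hν : MainCondition ν)
    (htop : ν {⊤} = 0) {c : ℝ} (hc : essInfPlus ν < c) : 0 < ν (Iio (c : EReal)) := by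
  -- Nonemptiness matters: the infimum of the empty set of reals would be 0 by convention. It holds
  -- because v is almost surely not +∞.
  obtain ⟨t, ⟨-, ht⟩, htc⟩ := exists_lt_of_csInf_lt (hν.exists_plusLaw_Iio_pos htop) hc
  rw [pos_iff_ne_zero]
  intro h
  refine ht.ne' ?_
  exact cond_absolutelyContinuous (measure_mono_null
    (Set.Iio_subset_Iio (EReal.coe_le_coe_iff.2 htc.le)) h)

lemma essInfPlus_nonneg (ν : Measure EReal) : 0 ≤ essInfPlus ν :=
  Real.sInf_nonneg fun _ ht => ht.1.le

end Law

/-! ### Edge weights at a skeleton vertex and almost surely positive weights -/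

variable {ν : Measure EReal} [IsProbabilityMeasure ν]

/-- Otherwise v_{0,1} ≤ c almost surely, and the mean on the right could not exceed the positive
part of c. -/
lemma measure_Ioi_pos_of_lt {c : ℝ}
    (hc : ENNReal.ofReal c < ∫⁻ W in skelEvent 0, (W.weights 0 1).toENNReal ∂weightLaw ν) :
    0 < ν (Ioi (c : EReal)) := by
  rw [pos_iff_ne_zero]
  intro h0
  refine hc.not_ge ?_
  have hae : ∀ᵐ W ∂weightLaw ν, EdgeConfig.weights W 0 1 ≤ c := by
    rw [ae_iff]
    have := weightLaw_edge (ν := ν) zero_lt_one (measurableSet_Ioi (a := (c : EReal)))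
    rw [h0] at this
    simpa using this
  calc ∫⁻ W in skelEvent 0, (W.weights 0 1).toENNReal ∂weightLaw ν
      ≤ ∫⁻ W, (EdgeConfig.weights W 0 1).toENNReal ∂weightLaw ν := setLIntegral_le_lintegral _ _
    _ ≤ ∫⁻ _, ENNReal.ofReal c ∂weightLaw ν := by
        refine lintegral_mono_ae (hae.mono fun W hW => ?_)
        simpa [EReal.toENNReal_of_ne_top] using EReal.toENNReal_le_toENNReal hW
    _ = _ := by simp

lemma ae_skeleton_eq_univ (h : ν (Iic 0) = 0) :
    ∀ᵐ W ∂weightLaw ν, skeletonPlus (EdgeConfig.weights W) = univ := by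
  have hae : ∀ᵐ W ∂weightLaw ν, ∀ j : ℤ, 0 < EdgeConfig.weights W j (j + 1) := by
    rw [ae_all_iff]
    intro j
    rw [ae_iff]
    have := weightLaw_edge (ν := ν) (lt_add_one j) (measurableSet_Iic (a := (0 : EReal)))
    rw [h] at this
    simpa using this
  filter_upwards [hae] with W hW
  have key : ∀ (j : ℤ) (n : ℕ), Conn W.weights j (j + n) := by
    intro j n
    induction n with
    | zero => simpa using Conn.refl _
    | succ n ih =>
      push_cast
      rw [← add_assoc]
      exact ih.trans (Conn.of_pos (by omega) (hW _))
  have key' : ∀ j k : ℤ, j < k → Conn W.weights j k := by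
    intro j k hjk
    have := key j (k - j).toNat
    rwa [show j + ((k - j).toNat : ℤ) = k by omega] at this
  exact Set.eq_univ_of_forall fun x =>
    mem_skeletonPlus.2 ⟨fun j hj => key' j x hj, fun k hk => key' x k hk⟩

lemma firstPoint_univ : firstPoint univ = 0 :=
  (isLeast_firstPoint ⟨0, mem_univ _, le_rfl⟩).unique ⟨by simp, fun _ h => h.2⟩

lemma secondPoint_univ : secondPoint univ = 1 := by
  refine (isLeast_secondPoint ⟨0, mem_univ _, 1, mem_univ _, le_rfl, zero_lt_one⟩).unique
    ⟨by simp [firstPoint_univ], fun x h => ?_⟩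
  have := h.2
  rw [firstPoint_univ] at this
  exact this

open Classical in
/-- Renewal vertices have positive density and the distances between them have exponential
tails, if `c₁` is less than the mean weight of the edge to the right of a skeleton vertex and `2c₂`
exceeds the essential infimum of the weights. -/
theorem expDecay_card_renewal {c₁ c₂ : ℝ} (hν : MainCondition ν) (hc₁ : 0 ≤ c₁) (hc₂ : 0 < c₂)
    (h₁ : ENNReal.ofReal c₁ < ∫⁻ W in skelEvent 0, (W.weights 0 1).toENNReal ∂weightLaw ν)
    (h₂ : 0 < ν (Iio ((2 * c₂ : ℝ) : EReal))) :
    ExpDecay fun n => weightLaw ν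
      {W | ((Finset.range n).filter fun i : ℕ => W ∈ renewalEvent c₁ c₂ i).card ≤ 1} := by
  obtain ⟨C, hC, hM⟩ := hν.exists_exp_max
  have htail := expDecay_maxWeight_lt hν.pos hc₁ h₁
  have hq := expDecay_Ici hC hc₂ hM
  obtain ⟨η, hη, hη'⟩ := exists_Ici_pos (measure_Ioi_pos_of_lt h₁)
  exact expDecay_card_renewalEvent htail hq (measure_renewalEvent_pos
    (measure_rightEvent_pos hν.pos hc₁ hη hη' htail) (measure_crossEvent_pos hc₂ h₂ hq))

end WeightedLineGraph

end

noncomputable section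

namespace WeightedLineGraph

/-! ### The configuration of a family of weights -/

section Congr

variable {u u' : ℤ → ℤ → EReal}

lemma skeletonPlus_congr (h : ∀ j k, j < k → u j k = u' j k) : skeletonPlus u = skeletonPlus u' := by
  have hc : ∀ a b, Conn u a b ↔ Conn u' a b := fun a b => conn_congr fun j k _ hjk _ => h j k hjk
  ext x
  simp only [mem_skeletonPlus, hc]

lemma renewalSet_congr (h : ∀ j k, j < k → u j k = u' j k) (c₁ c₂ : ℝ) :
    renewalSet u c₁ c₂ = renewalSet u' c₁ c₂ := by
  have hw : ∀ a b, maxWeight u a b = maxWeight u' a b :=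
    fun a b => maxWeight_congr fun j k _ hjk _ => h j k hjk
  ext x
  refine and_congr ?_ (and_congr ?_ ?_)
  · simp only [LeftEvent, hw]
  · refine forall_congr' fun i => forall_congr' fun j => forall_congr' fun hi =>
      forall_congr' fun hj => ?_
    rw [h _ _ (by omega)]
  · simp only [RightEvent, hw]

end Congr

variable {Ω : Type*}

/-- The weights at `ω`, as a function on the edges. -/
def edgeConfig (v : ℤ → ℤ → Ω → EReal) (ω : Ω) : EdgeConfig := fun e => v e.1.1 e.1.2 ω

lemma config_eq_weights (v : ℤ → ℤ → Ω → EReal) (ω : Ω) (j k : ℤ) (h : j < k) :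
    config v ω j k = (edgeConfig v ω).weights j k :=
  (EdgeConfig.weights_of_lt (edgeConfig v ω) h).symm

lemma skeletonPlus_config (v : ℤ → ℤ → Ω → EReal) (ω : Ω) :
    skeletonPlus (config v ω) = skeletonPlus (edgeConfig v ω).weights :=
  skeletonPlus_congr (config_eq_weights v ω)

lemma renewalSet_config (v : ℤ → ℤ → Ω → EReal) (ω : Ω) (c₁ c₂ : ℝ) :
    renewalSet (config v ω) c₁ c₂ = renewalSet (edgeConfig v ω).weights c₁ c₂ :=
  renewalSet_congr (config_eq_weights v ω) c₁ c₂

lemma maxWeight_config (v : ℤ → ℤ → Ω → EReal) (ω : Ω) (a b : ℤ) :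
    maxWeight (config v ω) a b = maxWeight (edgeConfig v ω).weights a b :=
  maxWeight_congr fun j k _ h _ => config_eq_weights v ω j k h

lemma tPlus₀_eq (v : ℤ → ℤ → Ω → EReal) (ω : Ω) : tPlus₀ v ω = firstSkel (edgeConfig v ω) := by
  rw [tPlus₀, skeletonPlus_config, firstSkel]

lemma tPlus₁_eq (v : ℤ → ℤ → Ω → EReal) (ω : Ω) : tPlus₁ v ω = secondSkel (edgeConfig v ω) := by
  rw [tPlus₁, skeletonPlus_config, secondSkel]

lemma tPlus_mem {v : ℤ → ℤ → Ω → EReal} {ω : Ω} (h : ∃ x ∈ skeletonPlus (edgeConfig v ω).weights,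
      ∃ y ∈ skeletonPlus (edgeConfig v ω).weights, 0 ≤ x ∧ x < y) :
    tPlus₀ v ω ∈ skeletonPlus (edgeConfig v ω).weights ∧ tPlus₀ v ω < tPlus₁ v ω := by
  rw [tPlus₀_eq, tPlus₁_eq]
  have h' := h
  obtain ⟨x, hx, y, hy, h0, hxy⟩ := h'
  exact ⟨(isLeast_firstPoint ⟨x, hx, h0⟩).1.1, (isLeast_secondPoint h).1.2⟩

variable [MeasurableSpace Ω] {P : Measure Ω} {ν : Measure EReal} {v : ℤ → ℤ → Ω → EReal}

/-! ### Transfer to the given probability space and the role of the admissible constants -/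

namespace IsWeightFamily

lemma isProbabilityMeasure [IsProbabilityMeasure P] (hv : IsWeightFamily P ν v) :
    IsProbabilityMeasure ν := by
  rw [← hv.law 0 1 zero_lt_one]
  exact Measure.isProbabilityMeasure_map (hv.measurable 0 1 zero_lt_one).aemeasurable

lemma measurable_edgeConfig (hv : IsWeightFamily P ν v) : Measurable (edgeConfig v) :=
  measurable_pi_lambda _ fun e => hv.measurable _ _ e.2

variable [IsProbabilityMeasure ν]

lemma map_edgeConfig (hv : IsWeightFamily P ν v) : P.map (edgeConfig v) = weightLaw ν := by
  have h := hv.indep.map_fun_eq_infinitePi_map (fun e => hv.measurable _ _ e.2)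
  simp only [fun e : Edge => hv.law _ _ e.2] at h
  exact h

lemma ae_edgeConfig (hv : IsWeightFamily P ν v) {p : EdgeConfig → Prop}
    (h : ∀ᵐ W ∂weightLaw ν, p W) : ∀ᵐ ω ∂P, p (edgeConfig v ω) := by
  rw [← hv.map_edgeConfig] at h
  exact ae_of_ae_map hv.measurable_edgeConfig.aemeasurable h

lemma lintegral_edgeConfig (hv : IsWeightFamily P ν v) {f : EdgeConfig → ℝ≥0∞}
    (hf : AEMeasurable f (weightLaw ν)) :
    ∫⁻ ω, f (edgeConfig v ω) ∂P = ∫⁻ W, f W ∂weightLaw ν := by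
  rw [← hv.map_edgeConfig] at hf ⊢
  exact (lintegral_map' hf hv.measurable_edgeConfig.aemeasurable).symm

lemma ae_exists_two_skeleton (hv : IsWeightFamily P ν v) (hν : MainCondition ν) :
    ∀ᵐ ω ∂P, ∃ x ∈ skeletonPlus (edgeConfig v ω).weights,
      ∃ y ∈ skeletonPlus (edgeConfig v ω).weights, 0 ≤ x ∧ x < y :=
  hv.ae_edgeConfig (WeightedLineGraph.ae_exists_two_skeleton hν.pos (measure_skelEvent_pos hν.pos))

lemma gammaPlus_nonneg (hv : IsWeightFamily P ν v) (hν : MainCondition ν) : 0 ≤ gammaPlus P v := by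
  refine one_div_nonneg.2 (integral_nonneg_of_ae ?_)
  filter_upwards [hv.ae_exists_two_skeleton hν] with ω hω
  have := (tPlus_mem hω).2
  simp only [Pi.zero_apply]
  exact_mod_cast (sub_pos.2 this).le

lemma lintegral_tPlus (hv : IsWeightFamily P ν v) (hν : MainCondition ν) :
    ∫⁻ ω, ENNReal.ofReal ((tPlus₁ v ω - tPlus₀ v ω : ℤ) : ℝ) ∂P =
      ∫⁻ W, gapLength (W.shift (firstSkel W)) ∂weightLaw ν := by
  rw [← hv.lintegral_edgeConfig (lintegral_firstSkel hν.pos (measure_skelEvent_pos hν.pos)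
    measurable_gapLength dependsOn_gapLength).1]
  refine lintegral_congr_ae ?_
  filter_upwards [hv.ae_exists_two_skeleton hν] with ω hω
  rw [gapLength_shift_firstSkel hω, tPlus₀_eq, tPlus₁_eq]

/-- The edge from t₀⁺ to t₀⁺ + 1 is positive and ends no later than t₁⁺, so it competes in the
minimum. -/
lemma ofReal_minPositiveWeight_le (hv : IsWeightFamily P ν v) (hν : MainCondition ν) :
    ∀ᵐ ω ∂P, ENNReal.ofReal (minPositiveWeight (config v ω) (tPlus₀ v ω) (tPlus₁ v ω)).toReal ≤
      (((edgeConfig v ω).shift (firstSkel (edgeConfig v ω))).weights 0 1).toENNReal := by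
  filter_upwards [hv.ae_exists_two_skeleton hν] with ω hω
  obtain ⟨h0, h1⟩ := tPlus_mem hω
  have hpos : 0 < (edgeConfig v ω).weights (tPlus₀ v ω) (tPlus₀ v ω + 1) :=
    ((mem_skeletonPlus.1 h0).2 _ (lt_add_one _)).pos_succ
  rw [weights_shift, shiftConfig, zero_add, add_comm (1 : ℤ), ← tPlus₀_eq]
  rw [← config_eq_weights v ω _ _ (lt_add_one _)] at hpos ⊢
  have hle : minPositiveWeight (config v ω) (tPlus₀ v ω) (tPlus₁ v ω) ≤
      config v ω (tPlus₀ v ω) (tPlus₀ v ω + 1) :=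
    sInf_le ⟨_, _, le_rfl, lt_add_one _, h1, hpos, rfl⟩
  refine le_trans ?_ (EReal.toENNReal_le_toENNReal hle)
  rw [EReal.toENNReal]
  split_ifs <;> simp

lemma minPositiveWeight_nonneg (u : ℤ → ℤ → EReal) (a b : ℤ) :
    0 ≤ (minPositiveWeight u a b).toReal :=
  EReal.toReal_nonneg (le_sInf fun _ ⟨_, _, _, _, _, h, e⟩ => e ▸ h.le)

/-- The mean minimal weight between two skeleton vertices is at most the mean distance of these
vertices multiplied by the mean weight of the edge to the right of a skeleton vertex. -/
lemma ofReal_meanMinWeight_le (hv : IsWeightFamily P ν v) (hν : MainCondition ν) :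
    ENNReal.ofReal (meanMinWeight P v) ≤
      (∫⁻ W, gapLength (W.shift (firstSkel W)) ∂weightLaw ν) *
        ∫⁻ W in skelEvent 0, (W.weights 0 1).toENNReal ∂weightLaw ν := by
  have hd : DependsOn (fun W : EdgeConfig => (W.weights 0 1).toENNReal) (edgesGE 0) := by
    intro W W' hW
    simp only [EdgeConfig.weights_of_lt _ zero_lt_one]
    rw [hW _ (show (0 : ℤ) ≤ 0 from le_rfl)]
  have hS := measure_skelEvent_pos hν.pos
  rw [← lintegral_edge_firstSkel hν.pos hS, ← hv.lintegral_edgeConfig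
    (lintegral_firstSkel hν.pos hS (measurable_weights 0 1).ereal_toENNReal hd).1]
  refine le_trans ?_ (lintegral_mono_ae (hv.ofReal_minPositiveWeight_le hν))
  by_cases hint : Integrable
      (fun ω => (minPositiveWeight (config v ω) (tPlus₀ v ω) (tPlus₁ v ω)).toReal) P
  · rw [meanMinWeight, ofReal_integral_eq_lintegral_ofReal hint
      (ae_of_all _ fun ω => minPositiveWeight_nonneg _ _ _)]
  -- A non-integrable minimum has integral 0 by convention, and the bound is trivial.
  · rw [meanMinWeight, integral_undef hint]
    simp

variable {c₁ c₂ : ℝ}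

lemma c₂_pos (hv : IsWeightFamily P ν v) (hν : MainCondition ν)
    (hc : AdmissibleConstants P ν v c₁ c₂) : 0 < c₂ :=
  (mul_nonneg (hv.gammaPlus_nonneg hν) (essInfPlus_nonneg ν)).trans_lt hc.1

/-- With D = E(t₁⁺ - t₀⁺), the cycle formula gives V ≤ Dκ for the mean κ on the right, hence c₁ <
V/D ≤ κ. -/
lemma ofReal_c₁_lt (hv : IsWeightFamily P ν v) (hν : MainCondition ν)
    (hc : AdmissibleConstants P ν v c₁ c₂) :
    ENNReal.ofReal c₁ < ∫⁻ W in skelEvent 0, (W.weights 0 1).toENNReal ∂weightLaw ν := by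
  have hc₁ : 0 < c₁ := (hv.c₂_pos hν hc).trans_le hc.2.1
  set D := ∫ ω, ((tPlus₁ v ω - tPlus₀ v ω : ℤ) : ℝ) ∂P with hD
  have hγ : gammaPlus P v = 1 / D := rfl
  have hlt := hc.2.2
  -- If D = 0, which is also the default value for a non-integrable cycle length, then γ⁺ = 0 and c₁
  -- < 0, a contradiction. So D > 0 and the cycle length is integrable.
  have hD0 : 0 < D := by
    refine lt_of_le_of_ne (one_div_nonneg.1 (hγ ▸ hv.gammaPlus_nonneg hν)) fun h => ?_
    rw [hγ, ← h] at hlt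
    simp only [div_zero, zero_mul] at hlt
    linarith
  have hint : Integrable (fun ω => ((tPlus₁ v ω - tPlus₀ v ω : ℤ) : ℝ)) P := by
    by_contra h
    rw [hD, integral_undef h] at hD0
    exact hD0.false
  have hDeq : ENNReal.ofReal D = ∫⁻ W, gapLength (W.shift (firstSkel W)) ∂weightLaw ν := by
    rw [hD, ofReal_integral_eq_lintegral_ofReal hint, hv.lintegral_tPlus hν]
    filter_upwards [hv.ae_exists_two_skeleton hν] with ω hω
    have := (tPlus_mem hω).2
    simp only [Pi.zero_apply]
    exact_mod_cast (sub_pos.2 this).le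
  have hV := hv.ofReal_meanMinWeight_le hν
  rw [← hDeq] at hV
  rw [hγ, one_div, ← div_eq_inv_mul, lt_div_iff₀ hD0] at hlt
  by_contra! hcon
  have h1 : ENNReal.ofReal (meanMinWeight P v) ≤ ENNReal.ofReal (D * c₁) := by
    rw [ENNReal.ofReal_mul hD0.le]
    exact hV.trans (mul_le_mul' le_rfl hcon)
  rw [ENNReal.ofReal_le_ofReal_iff (by positivity)] at h1
  linarith

/-- If v > 0 almost surely, every vertex is skeleton-plus, so γ⁺ = 1 and ess inf v⁺ < c₂ < 2c₂.
Otherwise v ≤ 0 has positive probability and c₂ > 0 is enough. -/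
lemma measure_Iio_two_mul_pos [IsProbabilityMeasure P] (hv : IsWeightFamily P ν v) (hν : MainCondition ν)
    (hc : AdmissibleConstants P ν v c₁ c₂) : 0 < ν (Iio ((2 * c₂ : ℝ) : EReal)) := by
  have hc₂ := hv.c₂_pos hν hc
  rcases eq_or_ne (ν (Iic 0)) 0 with h0 | h0
  · have hγ : gammaPlus P v = 1 := by
      have h1 : ∀ᵐ ω ∂P, ((tPlus₁ v ω - tPlus₀ v ω : ℤ) : ℝ) = 1 := by
        filter_upwards [hv.ae_edgeConfig (ae_skeleton_eq_univ h0)] with ω hω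
        rw [tPlus₀_eq, tPlus₁_eq, firstSkel, secondSkel, hω, firstPoint_univ, secondPoint_univ]
        norm_num
      rw [gammaPlus, integral_congr_ae h1]
      simp
    refine hν.measure_Iio_pos hv.lt_top ?_
    have := hc.1
    rw [hγ, one_mul] at this
    linarith
  · refine (pos_iff_ne_zero.2 h0).trans_le (measure_mono (Set.Iic_subset_Iio.2 ?_))
    exact_mod_cast (by positivity : (0 : ℝ) < 2 * c₂)

end IsWeightFamily

end WeightedLineGraph

end

theorem lemma4 {Ω : Type*} [MeasurableSpace Ω] (P : Measure Ω) [IsProbabilityMeasure P]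
    (ν : Measure EReal) (v : ℤ → ℤ → Ω → EReal) (hv : IsWeightFamily P ν v)
    (hν : MainCondition ν) (c₁ c₂ : ℝ) (hc : AdmissibleConstants P ν v c₁ c₂) :
    (∀ᵐ ω ∂P,
      IsLeast {x : ℤ | x ∈ renewalSet (config v ω) c₁ c₂ ∧ 0 ≤ x} (renewal₀ v c₁ c₂ ω) ∧
      IsLeast {x : ℤ | x ∈ renewalSet (config v ω) c₁ c₂ ∧ renewal₀ v c₁ c₂ ω < x}
        (renewal₁ v c₁ c₂ ω)) ∧
    ∃ C : ℝ, 0 < C ∧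
      ∫⁻ ω, EReal.exp ((C : EReal) * maxWeight (config v ω) 0 (renewal₀ v c₁ c₂ ω)) ∂P < ∞ ∧
      ∫⁻ ω, EReal.exp ((C : EReal) *
        maxWeight (config v ω) (renewal₀ v c₁ c₂ ω) (renewal₁ v c₁ c₂ ω)) ∂P < ∞ := by
  have := hv.isProbabilityMeasure
  have hren := expDecay_card_renewal hν ((hv.c₂_pos hν hc).le.trans hc.2.1) (hv.c₂_pos hν hc)
    (hv.ofReal_c₁_lt hν hc) (hv.measure_Iio_two_mul_pos hν hc)
  have htwo : ∀ᵐ ω ∂P, ∃ x ∈ renewalSet (edgeConfig v ω).weights c₁ c₂,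
      ∃ y ∈ renewalSet (edgeConfig v ω).weights c₁ c₂, 0 ≤ x ∧ x < y :=
    hv.ae_edgeConfig (p := fun W => ∃ x ∈ renewalSet W.weights c₁ c₂,
      ∃ y ∈ renewalSet W.weights c₁ c₂, 0 ≤ x ∧ x < y) (ae_exists_two_of_expDecay hren)
  refine ⟨?_, ?_⟩
  · filter_upwards [htwo] with ω hω
    rw [← renewalSet_config] at hω
    have hω' := hω
    obtain ⟨x, hx, y, -, h0, -⟩ := hω'
    exact ⟨isLeast_firstPoint ⟨x, hx, h0⟩, isLeast_secondPoint hω⟩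
  · obtain ⟨C, hC, hM⟩ := hν.exists_exp_max
    obtain ⟨C', hC', H, hH, hHfin, hbound⟩ := exists_integrable_bound hC hM hren
    have hfin : ∫⁻ ω, H (edgeConfig v ω) ∂P < ∞ := by
      rw [hv.lintegral_edgeConfig hH.aemeasurable]
      exact hHfin.lt_top
    refine ⟨C', hC', lt_of_le_of_lt (lintegral_mono_ae ?_) hfin,
      lt_of_le_of_lt (lintegral_mono_ae ?_) hfin⟩
    · filter_upwards [htwo] with ω hω
      rw [maxWeight_config, renewal₀, renewalSet_config]
      exact (hbound _ hω).1
    · filter_upwards [htwo] with ω hω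
      rw [maxWeight_config, renewal₀, renewal₁, renewalSet_config]
      exact (hbound _ hω).2
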